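/- Let $\mathbb R^{2n}$ carry the standard symplectic form $\sigma(u,v)=u^TJv$, $J=\begin{pmatrix}0&\mathrm{id}\\-\mathrm{id}&0\end{pmatrix}$, in coordinates $(p,q)$, and let $\Pi=\{q=0\}$. Let $X:[0,T]\to\mathbb R^{2n}$ and $b:[0,T]\to\mathbb R$ be piecewise analytic. (For a single-control optimal control problem on an $n$-manifold and an extremal $\lambda(t)$, $b$ is the second derivative in $u$ of the Pontryagin Hamiltonian along the extremal, $X$ is the linearization in $u$ of the Hamiltonian vector field pulled back to $\lambda(0)$, and $\Pi=T_{\lambda(0)}(T^*_{q_0}M)$.) For a finite-dimensional $V\subset L^\infty([0,t])$ let $\mathcal L_t(V)$ be the set of all vectors $\eta(t)$, where $\eta(s)=\eta_0+\int_0^sX v\,d\theta$ with $\eta_0\in\Pi$, $v\in V$ and $$\int_0^t\bigl(\sigma(\eta(s),X(s)w(s))+b(s)v(s)w(s)\bigr)ds=0\qquad\text{for all } w\in V .$$ The Jacobi curve is $\mathcal L_t=\lim_V\mathcal L_t(V)$, the limit, in the Grassmannian, of the net over all finite-dimensional $V\subset L^\infty([0,t])$ ordered by inclusion, whenever this limit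 exists. Away from the zeros of $b$ the Jacobi equation is $\dot\eta=\frac{\sigma(X,\eta)}{b}X$. Let $0\le\tau<T$, $b(\tau)=0$ and $b(s)<0$ for all $s>\tau$ close enough to $\tau$. Assume (with right derivatives at $\tau$) that $\sigma(X(\tau),\dot X(\tau))\neq0$ and that $\dim\operatorname{span}\{\ddot X(s),\dot X(s),X(s)\}$ is constant for $s\in[\tau,\tau+\varepsilon]$, for some $\varepsilon>0$. Then: 1. There are $\delta>0$ with $b<0$ on $(\tau,\tau+\delta]$, a curve $M(s)$, $s\in[\tau,\tau+\delta]$, of symplectic matrices that is $C^\infty$ up to $s=\tau$, and a set $S\subset\{1,\dots,n\}$ with at most two elements, such that in the coordinates $\mu=M^{-1}\eta$ the Jacobi equation on $(\tau,\tau+\delta)$ splits into two independent systems, one for the coordinates $p_i,q_i$ with $i\in S$ (which form a symplectic subspace of dimension at most $4$) and one for the coordinates $p_i,q_i$ with $i\notin S$. The coefficients of the second system extend to $C^\infty$ functions on $[\tau,\tau+\delta]$, so that the whole singularity is in the first one. Moreover $X(\tau)$ is a column of $M(\tau)$, namely the one of a coordinate $p_i$ with $i\in S$. 2. If $\mathcal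 L_\tau$ exists, $\mathcal L_t$ exists for all $t>\tau$ close enough to $\tau$, and the limit $\mathcal L_{\tau+}=\lim_{t\to\tau+}\mathcal L_t$ exists, then $$\dim(\mathcal L_\tau\cap\mathcal L_{\tau+})\ge n-2 .$$ -/

import Mathlib

open Set Filter Topology MeasureTheory
open scoped ContDiff Matrix ENNReal

noncomputable section

/-- The symplectic space `ℝ²ⁿ` in Darboux coordinates `(p, q)`: the index `Sum.inl i` is the
coordinate `pᵢ`, the index `Sum.inr i` is the coordinate `qᵢ`. -/
abbrev PhaseSpace (n : ℕ) : Type := EuclideanSpace ℝ (Fin n ⊕ Fin n)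

/-- The standard complex structure `J = (0 1; -1 0)`. -/
def symplJ (n : ℕ) : Matrix (Fin n ⊕ Fin n) (Fin n ⊕ Fin n) ℝ :=
  Matrix.fromBlocks 0 1 (-1) 0

/-- The symplectic form `σ(u, v) = uᵀ J v`. -/
def symplForm {n : ℕ} (u v : PhaseSpace n) : ℝ :=
  u.ofLp ⬝ᵥ (symplJ n *ᵥ v.ofLp)

/-- The vertical Lagrangian subspace `Π = {q = 0}`. -/
def verticalPlane (n : ℕ) : Submodule ℝ (PhaseSpace n) where
  carrier := {η | ∀ i : Fin n, η (Sum.inr i) = 0}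
  add_mem' := by
    intro a c ha hc i
    simp [ha i, hc i]
  zero_mem' := by
    intro i
    simp
  smul_mem' := by
    intro r a ha i
    simp [ha i]

/-- `f` is piecewise analytic on `[0, T]` (with the value at a break point taken from the right):
at every `s ∈ [0, T)` it agrees on some `[s, s + ε)`, and at every `s ∈ (0, T]` on some
`(s - ε, s)`, with a function that is analytic at `s`. By compactness of `[0, T]` there are only
finitely many break points. -/
def PiecewiseAnalytic {E : Type*} [NormedAddCommGroup E] [NormedSpace ℝ E]
    (T : ℝ) (f : ℝ → E) : Prop :=
  (∀ s ∈ Ico 0 T, ∃ g : ℝ → E, AnalyticAt ℝ g s ∧ f =ᶠ[𝓝[≥] s] g) ∧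
  (∀ s ∈ Ioc 0 T, ∃ g : ℝ → E, AnalyticAt ℝ g s ∧ f =ᶠ[𝓝[<] s] g)

/-- The space `L^∞([0, t])` of scalar variations. -/
abbrev Variations (t : ℝ) : Type := Lp ℝ ∞ (volume.restrict (Ioc 0 t))

/-- The finite-dimensional spaces of variations on `[0, t]`, ordered by inclusion. -/
abbrev FinDimVariations (t : ℝ) : Type :=
  {V : Submodule ℝ (Variations t) // FiniteDimensional ℝ V}

/-- The curve `η(s) = η₀ + ∫₀ˢ X(θ) v(θ) dθ`. -/
def variedCurve {n : ℕ} (X : ℝ → PhaseSpace n) (η₀ : PhaseSpace n) (v : ℝ → ℝ) (s : ℝ) :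
    PhaseSpace n :=
  η₀ + ∫ θ in (0 : ℝ)..s, v θ • X θ

/-- The `𝓛`-derivative over a finite-dimensional space `V` of variations on `[0, t]`: all vectors
`η(t)`, where `η(s) = η₀ + ∫₀ˢ X v` with `η₀` vertical and `v ∈ V` such that
`∫₀ᵗ (σ(η(s), X(s) w(s)) + b(s) v(s) w(s)) ds = 0` for all `w ∈ V`. (For bounded measurable `X`
and `b` these vectors already form a subspace; the span is only there to have one by
construction.) -/
def lPlane {n : ℕ} (X : ℝ → PhaseSpace n) (b : ℝ → ℝ) (t : ℝ)
    (V : Submodule ℝ (Variations t)) : Submodule ℝ (PhaseSpace n) :=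
  Submodule.span ℝ
    {η | ∃ η₀ ∈ verticalPlane n, ∃ v ∈ V,
      (∀ w ∈ V, ∫ s in (0 : ℝ)..t,
        (symplForm (variedCurve X η₀ v s) (w s • X s) + b s * (v s * w s)) = 0) ∧
      η = variedCurve X η₀ v t}

/-- Convergence in the Grassmannian: `Λ i → Λ₀` when the orthogonal projections converge. -/
def PlaneTendsto {ι : Type*} {n : ℕ} (Λ : ι → Submodule ℝ (PhaseSpace n)) (l : Filter ι)
    (Λ₀ : Submodule ℝ (PhaseSpace n)) : Prop :=
  Tendsto (fun i => (Λ i).starProjection) l (𝓝 Λ₀.starProjection)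

/-- `Λ` is the value at time `t` of the Jacobi curve of `(X, b)`: the limit of the net of
`𝓛`-derivatives over all finite-dimensional spaces of variations on `[0, t]`. -/
def IsJacobiPlane {n : ℕ} (X : ℝ → PhaseSpace n) (b : ℝ → ℝ) (t : ℝ)
    (Λ : Submodule ℝ (PhaseSpace n)) : Prop :=
  PlaneTendsto (fun V : FinDimVariations t => lPlane X b t V.1) atTop Λ

/-- The matrix of the Jacobi equation `η' = (σ(X, η) / b) X = (X Xᵀ J / b) η`. -/
def jacobiMatrix {n : ℕ} (X : ℝ → PhaseSpace n) (b : ℝ → ℝ) (s : ℝ) :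
    Matrix (Fin n ⊕ Fin n) (Fin n ⊕ Fin n) ℝ :=
  (b s)⁻¹ • (Matrix.vecMulVec (X s).ofLp (X s).ofLp * symplJ n)

/-- The matrix of the Jacobi equation in the coordinates `μ = M⁻¹ η` of a moving frame `M`:
`μ' = (-M⁻¹ M' + M⁻¹ (X Xᵀ J / b) M) μ`. -/
def jacobiMatrixInFrame {n : ℕ} (X : ℝ → PhaseSpace n) (b : ℝ → ℝ)
    (M : ℝ → Matrix (Fin n ⊕ Fin n) (Fin n ⊕ Fin n) ℝ) (s : ℝ) :
    Matrix (Fin n ⊕ Fin n) (Fin n ⊕ Fin n) ℝ :=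
  -((M s)⁻¹ * Matrix.of fun i j => deriv (fun r => M r i j) s) +
    (M s)⁻¹ * jacobiMatrix X b s * M s

/-- The position `i` of a Darboux coordinate `pᵢ` or `qᵢ`. -/
def pairIndex {n : ℕ} : Fin n ⊕ Fin n → Fin n :=
  Sum.elim id id

/-- On some `[τ, τ + δ]` a smooth symplectic frame `M` splits the Jacobi equation. The coordinates
`pᵢ, qᵢ` with `i ∈ S` (a symplectic subspace of dimension `2 #S ≤ 4`) and those with `i ∉ S` evolve
independently of each other for `s > τ`; the system for `i ∉ S` has coefficients that are smooth up
to `s = τ`, and at time `τ` the vector `X` is one of the frame vectors of the first block. -/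
def JacobiEquationSplits {n : ℕ} (X : ℝ → PhaseSpace n) (b : ℝ → ℝ) (τ : ℝ) : Prop :=
  ∃ δ > 0, (∀ s ∈ Ioc τ (τ + δ), b s < 0) ∧
    ∃ (M R : ℝ → Matrix (Fin n ⊕ Fin n) (Fin n ⊕ Fin n) ℝ) (S : Finset (Fin n)),
      S.card ≤ 2 ∧
      (∀ i j, ContDiffOn ℝ ∞ (fun s => M s i j) (Icc τ (τ + δ))) ∧
      (∀ s ∈ Icc τ (τ + δ), M s ∈ Matrix.symplecticGroup (Fin n) ℝ) ∧
      (∃ i₀ ∈ S, ∀ j, M τ j (Sum.inl i₀) = X τ j) ∧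
      (∀ i j, ContDiffOn ℝ ∞ (fun s => R s i j) (Icc τ (τ + δ))) ∧
      ∀ s ∈ Ioo τ (τ + δ), ∀ i j,
        ((pairIndex i ∈ S ↔ pairIndex j ∉ S) → jacobiMatrixInFrame X b M s i j = 0) ∧
        (pairIndex i ∉ S → pairIndex j ∉ S →
          jacobiMatrixInFrame X b M s i j = R s i j)

end

/-! To the right of τ the data are X(τ+s) = Y(s) and b(τ+s) = −s^k β(s) with Y, β smooth, β > 0 and
k ≥ 1 (`exists_smooth_normal_form`), so the Jacobi equation becomes the singular linear system s^k
η' = −β⁻¹ σ(Y, η) Y. Both claims depend on how many of its solutions are smooth up to s = 0. Put a =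
σ(Y(0), Y'(0)) ≠ 0.

Formal solutions. Write η = ξ + ∫ P Y and measure the defect σ(Y, η) + s^k β P. If ξ is
skew-orthogonal to Y(0) and Y'(0), the defect for P = 0 has order 2. A term s^j in P changes the
defect at order j + e, where e ≤ 2, with a coefficient D j that is computed explicitly
(`exists_jacobiDefect_leading_term`). At most one D j vanishes, and none does if a < 0. Hence the
defect can be removed order by order, except for one possible resonance, which costs one linear
condition on ξ (`exists_jacobiDefect_isBigO_combination`).

Genuine solutions. The correction of an approximate solution is sought as η = g + U with U' = v Y.
With w = σ(Y, U), w₁ = w' and the shifted vector U + w₁ Y / σ(Y, Y'), the singular control v cancels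
from the derivative of the vector part. What remains singular is a scaled plane of (w, w₁) with
coupling of size s^{-k/2}. An energy argument, definite or hyperbolic according to the sign of a and
the size of k, yields a solution vanishing to high order (`exists_decaying_solution`,
`exists_regularized_solution`, `exists_jacobi_solution_isBigO`). Finite dimension makes one solution
work for all orders (`exists_approxSmooth_stable`), and a bootstrap in which (u, u') solves a system
of the same type gives smoothness (`contDiffOn_of_approxSmooth`).

Splitting. The admissible initial values contain the skew-orthogonal complement of Y(0), Y'(0) and
one more vector c. A symplectic basis beginning with the pair Y(0), Y'(0)/a and a pair containing c
therefore has all its other vectors among them. Their solutions are smooth and keep their mutual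
symplectic products, so they are a moving symplectic family. It is completed to a smooth frame,
whose coordinates outside the two exceptional pairs are constant along solutions
(`jacobiEquationSplits_of_smooth`).

The jump. Every 𝓛_τ(V₀) has dimension at least n (`le_finrank_lPlane`), by Green's identity and a
dimension count. For t close to τ and all large V₁ of variations living on (τ, t], a subspace of
𝓛_τ(V₀) of dimension at least n − 2 lies close to 𝓛_t(V₀ ⊕ V₁)
(`eventually_exists_subspace_near_lPlane`). If a < 0 there is no resonance: the elements
skew-orthogonal to Y(0), Y'(0) are continued by smooth solutions, whose bounded controls are put
into V₁. If a > 0 the Galerkin equations with the extra condition of mean zero are solved for all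
but one dimension of the initial values, and integration by parts turns the quadratic form into one
that is coercive in the primitive of the control and keeps the endpoint close. In the limit, a space
of dimension at least n − 2 is almost fixed by the projections to 𝓛_τ and 𝓛_{τ+}, which bounds the
dimension of their intersection (`exists_pos_finrank_le_finrank_inf`). -/

/-! ### Linear differential equations with continuous coefficients -/

/-- A linear differential equation with continuous coefficients has a global solution. -/
theorem exists_linearODE_solution {E : Type*} [NormedAddCommGroup E] [NormedSpace ℝ E]
    [CompleteSpace E] {A : ℝ → E →L[ℝ] E} {f : ℝ → E} (hA : Continuous A) (hf : Continuous f)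
    (c : E) :
    ∃ u : ℝ → E, u 0 = c ∧ ∀ t, HasDerivAt u (A t (u t) + f t) t := by
  set m : ℝ → ℝ := fun t => ‖A t‖ + ‖f t‖ + 1 with hm
  have hmc : Continuous m := by fun_prop
  set θ : ℝ → ℝ := fun t => ∫ s in (0 : ℝ)..t, m s with hθ
  have hθd : ∀ t, HasDerivAt θ (m t) t := fun t =>
    intervalIntegral.integral_hasDerivAt_right (hmc.intervalIntegrable _ _)
      hmc.stronglyMeasurable.stronglyMeasurableAtFilter hmc.continuousAt
  have hθc : Continuous θ := continuous_iff_continuousAt.2 fun t => (hθd t).continuousAt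
  -- A weighted sup norm avoids gluing local solutions. Since θ' = m, the primitive of m W is
  -- sinh(2θ)/2, which is at most W/2 in absolute value on both sides of 0. With u = W w the Picard
  -- operator is then a contraction with constant 1/2 on bounded continuous functions.
  set W : ℝ → ℝ := fun t => Real.cosh (2 * θ t) with hW
  have hWc : Continuous W := Real.continuous_cosh.comp (continuous_const.mul hθc)
  have hWpos : ∀ t, 0 < W t := fun t => Real.cosh_pos _
  have hW1 : ∀ t, 1 ≤ W t := fun t => Real.one_le_cosh _
  have hint : ∀ t, |∫ s in (0 : ℝ)..t, m s * W s| ≤ W t / 2 := by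
    intro t
    have h1 : ∀ s ∈ uIcc 0 t, HasDerivAt (fun s => Real.sinh (2 * θ s) / 2) (m s * W s) s := by
      intro s _
      exact ((((hθd s).const_mul 2).sinh).div_const 2).congr_deriv (by simp only [hW]; ring)
    rw [intervalIntegral.integral_eq_sub_of_hasDerivAt h1
      ((hmc.mul hWc).intervalIntegrable _ _)]
    have h0 : θ 0 = 0 := by simp [hθ]
    rw [h0]
    simp only [mul_zero, Real.sinh_zero, zero_div, sub_zero, abs_div, abs_two]
    gcongr
    simp only [hW]
    rw [abs_le]
    constructor
    · have := Real.sinh_lt_cosh (-(2 * θ t))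
      rw [Real.sinh_neg, Real.cosh_neg] at this
      linarith
    · exact (Real.sinh_lt_cosh _).le
  have hbd : ∀ (g : ℝ → E) (K : ℝ), 0 ≤ K → (∀ s, ‖g s‖ ≤ K * (m s * W s)) → ∀ t,
      ‖(W t)⁻¹ • ∫ s in (0 : ℝ)..t, g s‖ ≤ K / 2 := by
    intro g K hK hg t
    have h1 : ‖∫ s in (0 : ℝ)..t, g s‖ ≤ |∫ s in (0 : ℝ)..t, K * (m s * W s)| :=
      intervalIntegral.norm_integral_le_abs_of_norm_le
        (ae_of_all _ fun s => hg s) ((continuous_const.mul (hmc.mul hWc)).intervalIntegrable _ _)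
    rw [intervalIntegral.integral_const_mul, abs_mul, abs_of_nonneg hK] at h1
    rw [norm_smul, norm_inv, Real.norm_of_nonneg (hWpos t).le, inv_mul_le_iff₀ (hWpos t)]
    calc _ ≤ K * (W t / 2) := h1.trans (by gcongr; exact hint t)
      _ = _ := by ring
  have hI : ∀ w : BoundedContinuousFunction ℝ E,
      Continuous fun s => W s • A s (w s) + f s := fun w => by
    have := w.continuous
    fun_prop
  have hIb : ∀ w : BoundedContinuousFunction ℝ E, ∀ s,
      ‖W s • A s (w s) + f s‖ ≤ (‖w‖ + 1) * (m s * W s) := by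
    intro w s
    have h1 : ‖A s (w s)‖ ≤ ‖A s‖ * ‖w‖ :=
      ((A s).le_opNorm _).trans (by gcongr; exact w.norm_coe_le_norm s)
    have h2 : ‖W s • A s (w s)‖ ≤ W s * (‖A s‖ * ‖w‖) := by
      rw [norm_smul, Real.norm_of_nonneg (hWpos s).le]
      exact mul_le_mul_of_nonneg_left h1 (hWpos s).le
    refine (norm_add_le _ _).trans ?_
    have h3 : 0 ≤ W s * (‖A s‖ * (1:ℝ)) := by have := hWpos s; positivity
    have h4 : 0 ≤ W s * (‖f s‖ * ‖w‖ + ‖w‖ + 1) := by have := hWpos s; positivity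
    have h5 : ‖f s‖ * 1 ≤ ‖f s‖ * W s := by gcongr; exact hW1 s
    simp only [hm]
    nlinarith
  have hSc : ∀ w : BoundedContinuousFunction ℝ E,
      Continuous fun t => (W t)⁻¹ • (c + ∫ s in (0 : ℝ)..t, (W s • A s (w s) + f s)) := by
    intro w
    have h1 : Continuous fun t => ∫ s in (0 : ℝ)..t, (W s • A s (w s) + f s) :=
      intervalIntegral.continuous_primitive (fun a b => (hI w).intervalIntegrable a b) 0
    exact (hWc.inv₀ fun t => (hWpos t).ne').smul (continuous_const.add h1)
  let S : BoundedContinuousFunction ℝ E → BoundedContinuousFunction ℝ E := fun w =>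
    BoundedContinuousFunction.ofNormedAddCommGroup _ (hSc w) (‖c‖ + (‖w‖ + 1) / 2) (by
      intro t
      rw [smul_add]
      refine (norm_add_le _ _).trans (add_le_add ?_ (hbd _ _ (by positivity) (hIb w) t))
      rw [norm_smul, norm_inv, Real.norm_of_nonneg (hWpos t).le]
      exact mul_le_of_le_one_left (norm_nonneg _) (inv_le_one_of_one_le₀ (hW1 t)))
  have hS : ∀ w t, S w t = (W t)⁻¹ • (c + ∫ s in (0 : ℝ)..t, (W s • A s (w s) + f s)) :=
    fun w t => rfl
  have hcontr : ContractingWith (1 / 2) S := by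
    refine ⟨by norm_num, LipschitzWith.of_dist_le_mul fun v w => ?_⟩
    rw [BoundedContinuousFunction.dist_le (by positivity)]
    intro t
    rw [dist_eq_norm, hS, hS, ← smul_sub, add_sub_add_left_eq_sub,
      ← intervalIntegral.integral_sub ((hI v).intervalIntegrable _ _)
        ((hI w).intervalIntegrable _ _)]
    have := hbd (fun s => (W s • A s (v s) + f s) - (W s • A s (w s) + f s)) (dist v w)
      dist_nonneg ?_ t
    · refine this.trans (le_of_eq ?_)
      simp; ring
    · intro s
      have h1 : (W s • A s (v s) + f s) - (W s • A s (w s) + f s) = W s • A s (v s - w s) := by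
        rw [map_sub, smul_sub]; abel
      rw [h1, norm_smul, Real.norm_of_nonneg (hWpos s).le]
      have h2 : ‖A s (v s - w s)‖ ≤ ‖A s‖ * dist v w :=
        ((A s).le_opNorm _).trans (by
          gcongr; rw [← dist_eq_norm]; exact BoundedContinuousFunction.dist_coe_le_dist s)
      have h3 : ‖A s‖ ≤ m s := by simp only [hm]; linarith [norm_nonneg (f s)]
      calc W s * ‖A s (v s - w s)‖ ≤ W s * (m s * dist v w) := by
            have := (hWpos s).le
            gcongr
            exact h2.trans (by gcongr)
        _ = _ := by ring
  obtain ⟨w, hw⟩ : ∃ w, S w = w := ⟨hcontr.fixedPoint, hcontr.fixedPoint_isFixedPt⟩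
  have hu : ∀ t, W t • w t = c + ∫ s in (0 : ℝ)..t, (W s • A s (w s) + f s) := by
    intro t
    conv_lhs => rw [← hw, hS]
    rw [smul_inv_smul₀ (hWpos t).ne']
  refine ⟨fun t => W t • w t, ?_, fun t => ?_⟩
  · simp only [hu]; simp
  · simp only [map_smul]
    have h1 : HasDerivAt (fun t => c + ∫ s in (0 : ℝ)..t, (W s • A s (w s) + f s))
        (W t • A t (w t) + f t) t :=
      (intervalIntegral.integral_hasDerivAt_right ((hI w).intervalIntegrable _ _)
        (hI w).stronglyMeasurable.stronglyMeasurableAtFilter (hI w).continuousAt).const_add c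
    exact h1.congr_of_eventuallyEq (Eventually.of_forall fun s => hu s)

/-- On the half-line, a linear differential equation with continuous coefficients has a solution
with any prescribed value at any given time. -/
theorem exists_linearODE_solution_Ioi {E : Type*} [NormedAddCommGroup E] [NormedSpace ℝ E]
    [CompleteSpace E] {A : ℝ → E →L[ℝ] E} {f : ℝ → E} (hA : ContinuousOn A (Ioi 0))
    (hf : ContinuousOn f (Ioi 0)) {s₀ : ℝ} (hs₀ : 0 < s₀) (c : E) :
    ∃ u : ℝ → E, u s₀ = c ∧ ∀ s, 0 < s → HasDerivAt u (A s (u s) + f s) s := by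
  -- Logarithmic time s = s₀ eᵗ turns the half-line into the whole line, at the price of a factor s
  -- in the coefficients.
  have hmaps : ∀ t : ℝ, s₀ * Real.exp t ∈ Ioi (0 : ℝ) := fun t => by
    simp only [mem_Ioi]; positivity
  have hA' : Continuous fun t => (s₀ * Real.exp t) • A (s₀ * Real.exp t) :=
    (by fun_prop : Continuous fun t => s₀ * Real.exp t).smul
      (hA.comp_continuous (by fun_prop) hmaps)
  have hf' : Continuous fun t => (s₀ * Real.exp t) • f (s₀ * Real.exp t) :=
    (by fun_prop : Continuous fun t => s₀ * Real.exp t).smul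
      (hf.comp_continuous (by fun_prop) hmaps)
  obtain ⟨u, hu0, hu⟩ := exists_linearODE_solution hA' hf' c
  refine ⟨fun s => u (Real.log (s / s₀)), by simp [div_self hs₀.ne', hu0], fun s hs => ?_⟩
  have hd : HasDerivAt (fun s => Real.log (s / s₀)) s⁻¹ s := by
    refine (((hasDerivAt_id' s).div_const s₀).log (by positivity)).congr_deriv ?_
    field_simp
  have h := (hu (Real.log (s / s₀))).scomp s hd
  have he : s₀ * Real.exp (Real.log (s / s₀)) = s := by
    rw [Real.exp_log (by positivity)]; field_simp
  rw [he] at h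
  have h2 : s⁻¹ • ((s • A s) (u (Real.log (s / s₀))) + s • f s) =
      A s (u (Real.log (s / s₀))) + f s := by
    rw [smul_apply, ← smul_add, inv_smul_smul₀ hs.ne']
  rw [h2] at h
  exact h

/-- Uniqueness for linear differential equations on an open interval. -/
theorem linearODE_unique {E : Type*} [NormedAddCommGroup E] [NormedSpace ℝ E]
    {A : ℝ → E →L[ℝ] E} {f : ℝ → E} {a b : ℝ} (hA : ContinuousOn A (Ioo a b)) {u v : ℝ → E}
    (hu : ∀ s ∈ Ioo a b, HasDerivAt u (A s (u s) + f s) s)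
    (hv : ∀ s ∈ Ioo a b, HasDerivAt v (A s (v s) + f s) s)
    {s₀ : ℝ} (hs₀ : s₀ ∈ Ioo a b) (h0 : u s₀ = v s₀) : EqOn u v (Ioo a b) := by
  intro s hs
  obtain ⟨c, hc1, hc2⟩ := exists_between (lt_min hs.1 hs₀.1)
  obtain ⟨d, hd1, hd2⟩ := exists_between (max_lt hs.2 hs₀.2)
  have hsub : Icc c d ⊆ Ioo a b := fun x hx => ⟨hc1.trans_le hx.1, hx.2.trans_lt hd2⟩
  obtain ⟨K, hK⟩ := isCompact_Icc.exists_bound_of_continuousOn (hA.mono hsub)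
  have hL : ∀ t ∈ Ioo c d, LipschitzOnWith (Real.toNNReal K) (fun x => A t x + f t) univ := by
    intro t ht
    refine LipschitzOnWith.of_dist_le_mul fun x _ y _ => ?_
    rw [dist_add_right, dist_eq_norm, dist_eq_norm, ← map_sub]
    refine ((A t).le_opNorm _).trans ?_
    gcongr
    exact (hK t (Ioo_subset_Icc_self ht)).trans (Real.le_coe_toNNReal K)
  have hs₀' : s₀ ∈ Ioo c d :=
    ⟨hc2.trans_le (min_le_right _ _), (le_max_right _ _).trans_lt hd1⟩
  have hs' : s ∈ Ioo c d := ⟨hc2.trans_le (min_le_left _ _), (le_max_left _ _).trans_lt hd1⟩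
  exact ODE_solution_unique_of_mem_Ioo hL hs₀'
    (fun t ht => ⟨hu t (hsub (Ioo_subset_Icc_self ht)), mem_univ _⟩)
    (fun t ht => ⟨hv t (hsub (Ioo_subset_Icc_self ht)), mem_univ _⟩) h0 hs'

theorem sub_le_of_hasDerivAt_le {g g' : ℝ → ℝ} {a b c : ℝ} (hab : a ≤ b)
    (hg : ∀ s ∈ Icc a b, HasDerivAt g (g' s) s) (hc : ∀ s ∈ Icc a b, g' s ≤ c) :
    g b - g a ≤ c * (b - a) :=
  Convex.image_sub_le_mul_sub_of_deriv_le (convex_Icc a b)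
    (fun s hs => (hg s hs).continuousAt.continuousWithinAt)
    (fun s hs => (hg s (interior_subset hs)).differentiableAt.differentiableWithinAt)
    (fun s hs => by rw [(hg s (interior_subset hs)).deriv]; exact hc s (interior_subset hs))
    a (left_mem_Icc.2 hab) b (right_mem_Icc.2 hab) hab

/-! ### Energy method for singular linear systems -/

section SingularSystem

variable {E : Type*} [NormedAddCommGroup E] [NormedSpace ℝ E]

/-- The weight s^{-2m} contributes the term −(m/s) B(u, u). Through it a high prescribed order of
vanishing dominates coefficients of size 1/s. -/
theorem hasDerivAt_inv_pow_mul_form (B : E →L[ℝ] E →L[ℝ] ℝ) (hB : ∀ u v, B u v = B v u)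
    {u : ℝ → E} {u' : E} {s : ℝ} (hs : 0 < s) (hu : HasDerivAt u u' s) (m : ℕ) :
    HasDerivAt (fun r => (r ^ (2 * m))⁻¹ * B (u r) (u r))
      (2 * (s ^ (2 * m))⁻¹ * (B (u s) u' - m / s * B (u s) (u s))) s := by
  have h1 : HasDerivAt (fun r => B (u r) (u r)) (B (u s) u' + B (u s) u') s := by
    have := (B.hasFDerivAt.comp_hasDerivAt s hu).clm_apply hu
    rw [hB u' (u s)] at this
    exact this
  have h2 : HasDerivAt (fun r : ℝ => (r ^ (2 * m))⁻¹) (-(2 * m) / s * (s ^ (2 * m))⁻¹) s := by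
    refine ((hasDerivAt_pow (2 * m) s).fun_inv (pow_ne_zero _ hs.ne')).congr_deriv ?_
    rcases Nat.eq_zero_or_pos m with rfl | hm
    · simp
    · obtain ⟨j, hj⟩ : ∃ j, 2 * m = j + 1 := ⟨2 * m - 1, by omega⟩
      have hj' : (2 * (m : ℝ)) = j + 1 := by exact_mod_cast hj
      rw [hj, Nat.add_sub_cancel, hj']
      push_cast
      field_simp
      ring
  exact (h2.mul h1).congr_deriv (by ring)

/-- The energy estimate behind `exists_decaying_solution`. -/
theorem singular_system_energy_bound {A : ℝ → E →L[ℝ] E} {f : ℝ → E}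
    (B Q : E →L[ℝ] E →L[ℝ] ℝ) (hB : ∀ u v, B u v = B v u) (hQ : ∀ u v, Q u v = Q v u)
    (hQpos : ∀ u, ‖u‖ ^ 2 ≤ Q u u) {δ C : ℝ} (hδ1 : δ ≤ 1) (hC : 0 ≤ C) {M k : ℕ}
    (hmain : ∀ s ∈ Ioc 0 δ, ∀ u, B u (A s u) - (M + k : ℕ) / s * B u u ≤ -(1 / s) * ‖u‖ ^ 2)
    (hAk : ∀ s ∈ Ioc 0 δ, ‖A s‖ ≤ C * (s ^ k)⁻¹)
    (hfN : ∀ s ∈ Ioc 0 δ, ‖f s‖ ≤ C * s ^ (M + k))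
    {ε : ℝ} (hε : 0 < ε) {u : ℝ → E}
    (hu : ∀ s, 0 < s → HasDerivAt u (A s (u s) + f s) s)
    (huδ : 0 ≤ B (u δ) (u δ)) (huε : B (u ε) (u ε) ≤ -‖u ε‖ ^ 2) :
    ∀ s ∈ Icc ε δ, ‖u s‖ ^ 2 ≤ (‖Q‖ * C + (3 * ‖Q‖ * C + ‖Q‖) * (‖B‖ ^ 2 * C ^ 2) +
      (3 * ‖Q‖ * C + ‖Q‖) * (‖B‖ ^ 2 * C ^ 2)) * s ^ (2 * M) := by
  set N := M + k with hN
  -- Below, D is the energy B with weight s^{-2N}, and P is the energy Q with weight s^{-2M}. The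
  -- summand 3‖Q‖C lets the dissipation in D' absorb the growth of P'; the summand ‖Q‖ makes P + K D
  -- nonpositive at ε.
  set K := 3 * ‖Q‖ * C + ‖Q‖ with hK
  have hK0 : 0 ≤ K := by positivity
  have hbil : ∀ (R : E →L[ℝ] E →L[ℝ] ℝ) (x y : E), R x y ≤ ‖R‖ * ‖x‖ * ‖y‖ := fun R x y =>
    (le_abs_self _).trans (R.le_opNorm₂ x y)
  set D : ℝ → ℝ := fun r => (r ^ (2 * N))⁻¹ * B (u r) (u r) with hD
  set P : ℝ → ℝ := fun r => (r ^ (2 * M))⁻¹ * Q (u r) (u r) with hP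
  set D' : ℝ → ℝ := fun s =>
    2 * (s ^ (2 * N))⁻¹ * (B (u s) (A s (u s) + f s) - N / s * B (u s) (u s)) with hD'
  set P' : ℝ → ℝ := fun s =>
    2 * (s ^ (2 * M))⁻¹ * (Q (u s) (A s (u s) + f s) - M / s * Q (u s) (u s)) with hP'
  have hDd : ∀ s, 0 < s → HasDerivAt D (D' s) s := fun s hs =>
    hasDerivAt_inv_pow_mul_form B hB hs (hu s hs) N
  have hPd : ∀ s, 0 < s → HasDerivAt P (P' s) s := fun s hs =>
    hasDerivAt_inv_pow_mul_form Q hQ hs (hu s hs) M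
  have hDle : ∀ s ∈ Ioc 0 δ, D' s ≤ -((s ^ (2 * N))⁻¹ * s⁻¹ * ‖u s‖ ^ 2) + ‖B‖ ^ 2 * C ^ 2 := by
    intro s hs
    have hs0 := hs.1
    have hs1 : s ≤ 1 := hs.2.trans hδ1
    have h1 := hmain s hs (u s)
    have h2 : B (u s) (f s) ≤ ‖B‖ * ‖u s‖ * (C * s ^ N) :=
      (hbil B _ _).trans (by gcongr; exact hfN s hs)
    -- Young's inequality with weight s: the forcing consumes one of the two copies of ‖u‖²/s that
    -- `hmain` provides after doubling.
    have h3 : 2 * (‖B‖ * ‖u s‖ * (C * s ^ N)) ≤ s⁻¹ * ‖u s‖ ^ 2 + s * (‖B‖ * (C * s ^ N)) ^ 2 := by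
      have : 0 ≤ s⁻¹ * (‖u s‖ - s * (‖B‖ * (C * s ^ N))) ^ 2 := by positivity
      have e : s⁻¹ * (‖u s‖ - s * (‖B‖ * (C * s ^ N))) ^ 2 =
          s⁻¹ * ‖u s‖ ^ 2 - 2 * (‖B‖ * ‖u s‖ * (C * s ^ N)) + s * (‖B‖ * (C * s ^ N)) ^ 2 := by
        field_simp
        ring
      linarith
    have h4 : 2 * (B (u s) (A s (u s) + f s) - N / s * B (u s) (u s)) ≤
        -(s⁻¹ * ‖u s‖ ^ 2) + s * (‖B‖ * (C * s ^ N)) ^ 2 := by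
      rw [map_add]
      rw [one_div] at h1
      linarith
    calc D' s = (s ^ (2 * N))⁻¹ * (2 * (B (u s) (A s (u s) + f s) - N / s * B (u s) (u s))) := by
          simp only [hD']; ring
      _ ≤ (s ^ (2 * N))⁻¹ * (-(s⁻¹ * ‖u s‖ ^ 2) + s * (‖B‖ * (C * s ^ N)) ^ 2) := by gcongr
      _ = -((s ^ (2 * N))⁻¹ * s⁻¹ * ‖u s‖ ^ 2) + s * (‖B‖ ^ 2 * C ^ 2) := by
          rw [mul_add]
          congr 1
          · ring
          · rw [mul_pow, mul_pow, ← pow_mul, mul_comm N 2]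
            field_simp
      _ ≤ _ := by
          have : 0 ≤ ‖B‖ ^ 2 * C ^ 2 := by positivity
          linarith [mul_le_of_le_one_left this hs1]
  have hPle : ∀ s ∈ Ioc 0 δ, P' s ≤ 3 * ‖Q‖ * C * ((s ^ (2 * N))⁻¹ * s⁻¹ * ‖u s‖ ^ 2) + ‖Q‖ * C := by
    intro s hs
    have hs0 := hs.1
    have hs1 : s ≤ 1 := hs.2.trans hδ1
    have h1 : Q (u s) (A s (u s)) ≤ ‖Q‖ * ‖u s‖ * (C * (s ^ k)⁻¹ * ‖u s‖) :=
      (hbil Q _ _).trans (by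
        gcongr; exact ((A s).le_opNorm _).trans (by gcongr; exact hAk s hs))
    have h2 : Q (u s) (f s) ≤ ‖Q‖ * ‖u s‖ * (C * s ^ N) :=
      (hbil Q _ _).trans (by gcongr; exact hfN s hs)
    have h3 : 0 ≤ M / s * Q (u s) (u s) :=
      mul_nonneg (div_nonneg (Nat.cast_nonneg _) hs0.le) ((sq_nonneg ‖u s‖).trans (hQpos (u s)))
    have h4 : 2 * (‖u s‖ * s ^ N) ≤ ‖u s‖ ^ 2 + (s ^ N) ^ 2 := by
      nlinarith [sq_nonneg (‖u s‖ - s ^ N)]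
    -- Since N = M + k, the exponent 2M + k is at most 2N + 1, so the blow-up of A is dominated by
    -- the weight of the dissipation.
    have e1 : (s ^ (2 * M))⁻¹ * (s ^ k)⁻¹ ≤ (s ^ (2 * N))⁻¹ * s⁻¹ := by
      rw [← mul_inv, ← mul_inv, ← pow_add, ← pow_succ]
      exact inv_anti₀ (by positivity) (pow_le_pow_of_le_one hs0.le hs1 (by omega))
    have e2 : (s ^ (2 * M))⁻¹ ≤ (s ^ (2 * N))⁻¹ * s⁻¹ := by
      rw [← mul_inv, ← pow_succ]
      exact inv_anti₀ (by positivity) (pow_le_pow_of_le_one hs0.le hs1 (by omega))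
    have e3 : (s ^ (2 * M))⁻¹ * (s ^ N) ^ 2 ≤ 1 := by
      rw [← pow_mul, inv_mul_le_iff₀ (by positivity), mul_one]
      exact pow_le_pow_of_le_one hs0.le hs1 (by omega)
    calc P' s ≤ 2 * (s ^ (2 * M))⁻¹ *
          (‖Q‖ * ‖u s‖ * (C * (s ^ k)⁻¹ * ‖u s‖) + ‖Q‖ * ‖u s‖ * (C * s ^ N)) := by
          simp only [hP', map_add]
          gcongr
          linarith
      _ = 2 * ‖Q‖ * C * (((s ^ (2 * M))⁻¹ * (s ^ k)⁻¹) * ‖u s‖ ^ 2) +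
          ‖Q‖ * C * ((s ^ (2 * M))⁻¹ * (2 * (‖u s‖ * s ^ N))) := by ring
      _ ≤ 2 * ‖Q‖ * C * (((s ^ (2 * M))⁻¹ * (s ^ k)⁻¹) * ‖u s‖ ^ 2) +
          ‖Q‖ * C * ((s ^ (2 * M))⁻¹ * (‖u s‖ ^ 2 + (s ^ N) ^ 2)) := by gcongr
      _ = 2 * ‖Q‖ * C * (((s ^ (2 * M))⁻¹ * (s ^ k)⁻¹) * ‖u s‖ ^ 2) +
          ‖Q‖ * C * ((s ^ (2 * M))⁻¹ * ‖u s‖ ^ 2) +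
          ‖Q‖ * C * ((s ^ (2 * M))⁻¹ * (s ^ N) ^ 2) := by ring
      _ ≤ 2 * ‖Q‖ * C * (((s ^ (2 * N))⁻¹ * s⁻¹) * ‖u s‖ ^ 2) +
          ‖Q‖ * C * (((s ^ (2 * N))⁻¹ * s⁻¹) * ‖u s‖ ^ 2) + ‖Q‖ * C * 1 := by gcongr
      _ = _ := by ring
  intro s hs
  have hsub1 : ∀ r ∈ Icc s δ, r ∈ Ioc 0 δ := fun r hr => ⟨hε.trans_le (hs.1.trans hr.1), hr.2⟩
  have hsub2 : ∀ r ∈ Icc ε s, r ∈ Ioc 0 δ := fun r hr => ⟨hε.trans_le hr.1, hr.2.trans hs.2⟩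
  have hs0 : 0 < s := hε.trans_le hs.1
  -- Integrating back from δ, where B is nonnegative, bounds D from below. Integrating forward from
  -- ε bounds P + K D from above. Together they bound P.
  have hDs : D δ - D s ≤ ‖B‖ ^ 2 * C ^ 2 * (δ - s) :=
    sub_le_of_hasDerivAt_le hs.2 (fun r hr => hDd r (hsub1 r hr).1) fun r hr => by
      have h0 := (hsub1 r hr).1
      have : 0 ≤ (r ^ (2 * N))⁻¹ * r⁻¹ * ‖u r‖ ^ 2 := by positivity
      linarith [hDle r (hsub1 r hr)]
  have hDδ : 0 ≤ D δ := by
    have : 0 < δ := hs0.trans_le hs.2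
    simp only [hD]; positivity
  have hPs : (P s + K * D s) - (P ε + K * D ε) ≤ (‖Q‖ * C + K * (‖B‖ ^ 2 * C ^ 2)) * (s - ε) :=
    sub_le_of_hasDerivAt_le (g := fun r => P r + K * D r) (g' := fun r => P' r + K * D' r) hs.1
      (fun r hr => (hPd r (hsub2 r hr).1).add ((hDd r (hsub2 r hr).1).const_mul K))
      fun r hr => by
        have h0 := (hsub2 r hr).1
        have h1 : 0 ≤ (r ^ (2 * N))⁻¹ * r⁻¹ * ‖u r‖ ^ 2 := by positivity
        have h2 := hPle r (hsub2 r hr)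
        have h3 := mul_le_mul_of_nonneg_left (hDle r (hsub2 r hr)) hK0
        have h4 : 0 ≤ ‖Q‖ * ((r ^ (2 * N))⁻¹ * r⁻¹ * ‖u r‖ ^ 2) := by positivity
        simp only [hK] at h3 ⊢
        nlinarith
  have hε1 : ε ≤ 1 := hs.1.trans (hs.2.trans hδ1)
  have hPε : P ε + K * D ε ≤ 0 := by
    have h1 : Q (u ε) (u ε) ≤ ‖Q‖ * ‖u ε‖ * ‖u ε‖ := hbil Q _ _
    have e2 : (ε ^ (2 * M))⁻¹ ≤ (ε ^ (2 * N))⁻¹ :=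
      inv_anti₀ (by positivity) (pow_le_pow_of_le_one hε.le hε1 (by omega))
    have h3 : P ε ≤ (ε ^ (2 * N))⁻¹ * (‖Q‖ * ‖u ε‖ * ‖u ε‖) := by
      simp only [hP]
      exact mul_le_mul e2 h1 ((sq_nonneg _).trans (hQpos _)) (by positivity)
    have h4 : D ε ≤ (ε ^ (2 * N))⁻¹ * (-‖u ε‖ ^ 2) := by
      simp only [hD]; gcongr
    have h5 := mul_le_mul_of_nonneg_left h4 hK0
    have h6 : 0 ≤ 3 * ‖Q‖ * C * ((ε ^ (2 * N))⁻¹ * ‖u ε‖ ^ 2) := by positivity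
    simp only [hK] at h5 ⊢
    nlinarith
  have hb : 0 ≤ ‖B‖ ^ 2 * C ^ 2 := by positivity
  have hDs' : -(‖B‖ ^ 2 * C ^ 2) ≤ D s := by
    have : ‖B‖ ^ 2 * C ^ 2 * (δ - s) ≤ ‖B‖ ^ 2 * C ^ 2 * 1 := by gcongr; linarith
    linarith
  have hPs' : P s ≤ ‖Q‖ * C + K * (‖B‖ ^ 2 * C ^ 2) + K * (‖B‖ ^ 2 * C ^ 2) := by
    have h1 : (‖Q‖ * C + K * (‖B‖ ^ 2 * C ^ 2)) * (s - ε) ≤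
        (‖Q‖ * C + K * (‖B‖ ^ 2 * C ^ 2)) * 1 := by gcongr; linarith [hs.2]
    have h2 := mul_le_mul_of_nonneg_left hDs' hK0
    linarith
  calc ‖u s‖ ^ 2 ≤ Q (u s) (u s) := hQpos _
    _ = P s * s ^ (2 * M) := by simp only [hP]; field_simp
    _ ≤ _ := by gcongr

/-- A singular linear system on the half-line, whose energy `B` (possibly indefinite) decays fast
enough with respect to `s`, has a solution that vanishes at `0` to the order prescribed by the
inhomogeneous term. -/
theorem exists_decaying_solution [FiniteDimensional ℝ E] {A : ℝ → E →L[ℝ] E} {f : ℝ → E}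
    (hA : ContinuousOn A (Ioi 0)) (hf : ContinuousOn f (Ioi 0))
    (B Q : E →L[ℝ] E →L[ℝ] ℝ) (hB : ∀ u v, B u v = B v u) (hQ : ∀ u v, Q u v = Q v u)
    (hQpos : ∀ u, ‖u‖ ^ 2 ≤ Q u u) (G : E →ₗ[ℝ] E) (hG : ∀ u, G (G u) = u)
    (hGp : ∀ u, G u = u → 0 ≤ B u u) (hGm : ∀ u, G u = -u → B u u ≤ -‖u‖ ^ 2)
    {δ C : ℝ} (hδ : 0 < δ) (hδ1 : δ ≤ 1) (hC : 0 ≤ C) {M k : ℕ}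
    (hmain : ∀ s ∈ Ioc 0 δ, ∀ u, B u (A s u) - (M + k : ℕ) / s * B u u ≤ -(1 / s) * ‖u‖ ^ 2)
    (hAk : ∀ s ∈ Ioc 0 δ, ‖A s‖ ≤ C * (s ^ k)⁻¹)
    (hfN : ∀ s ∈ Ioc 0 δ, ‖f s‖ ≤ C * s ^ (M + k)) :
    ∃ (u : ℝ → E) (C' : ℝ), (∀ s, 0 < s → HasDerivAt u (A s (u s) + f s) s) ∧
      ∀ s ∈ Ioc 0 δ, ‖u s‖ ≤ C' * s ^ M := by
  have hcomp : CompleteSpace E := FiniteDimensional.complete ℝ E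
  set C₃ := ‖Q‖ * C + (3 * ‖Q‖ * C + ‖Q‖) * (‖B‖ ^ 2 * C ^ 2) +
      (3 * ‖Q‖ * C + ‖Q‖) * (‖B‖ ^ 2 * C ^ 2) with hC₃
  have hC₃0 : 0 ≤ C₃ := by positivity
  choose S hSδ hS using fun c : E => exists_linearODE_solution_Ioi hA
    (continuousOn_const (c := (0 : E))) hδ c
  simp only [add_zero] at hS
  obtain ⟨p, hpδ, hp⟩ := exists_linearODE_solution_Ioi hA hf hδ (0 : E)
  have huniq : ∀ v w : ℝ → E, (∀ s, 0 < s → HasDerivAt v (A s (v s)) s) →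
      (∀ s, 0 < s → HasDerivAt w (A s (w s)) s) → ∀ r, 0 < r → v r = w r →
      ∀ s, 0 < s → v s = w s := by
    intro v w hv hw r hr hvw s hs
    have hA' : ContinuousOn A (Ioo 0 (max r s + 1)) := hA.mono fun x hx => hx.1
    refine linearODE_unique (f := 0) hA' (fun x hx => ?_) (fun x hx => ?_)
      ⟨hr, (le_max_left r s).trans_lt (lt_add_one _)⟩ hvw
      ⟨hs, (le_max_right r s).trans_lt (lt_add_one _)⟩
    · simpa using hv x hx.1
    · simpa using hw x hx.1
  have hSadd : ∀ c d s, 0 < s → S (c + d) s = S c s + S d s := fun c d s hs =>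
    huniq (S (c + d)) (fun s => S c s + S d s) (hS _)
      (fun s hs => by simpa using (hS c s hs).fun_add (hS d s hs)) δ hδ (by simp [hSδ]) s hs
  have hSsmul : ∀ (a : ℝ) c s, 0 < s → S (a • c) s = a • S c s := fun a c s hs =>
    huniq (S (a • c)) (fun s => a • S c s) (hS _)
      (fun s hs => by simpa using (hS c s hs).fun_const_smul a) δ hδ (by simp [hSδ]) s hs
  have hsol : ∀ c s, 0 < s →
      HasDerivAt (fun r => S c r + p r) (A s (S c s + p s) + f s) s := fun c s hs => by
    have := (hS c s hs).add (hp s hs)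
    rw [← add_assoc, ← map_add] at this
    exact this
  have hbound := @singular_system_energy_bound E _ _ A f B Q hB hQ hQpos δ C hδ1 hC M k hmain hAk
    hfN
  have hbound0 := @singular_system_energy_bound E _ _ A 0 B Q hB hQ hQpos δ C hδ1 hC M k hmain hAk
    (fun s hs => by have := hs.1; simp only [Pi.zero_apply, norm_zero]; positivity)
  have hcont : ∀ s, 0 < s → Continuous fun c => S c s := fun s hs =>
    LinearMap.continuous_of_finiteDimensional
      ({ toFun := fun c => S c s
         map_add' := fun c d => hSadd c d s hs
         map_smul' := fun a c => hSsmul a c s hs } : E →ₗ[ℝ] E)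
  -- Boundary conditions that fit the signature of B: at δ the value lies in the +1 eigenspace of G,
  -- where B ≥ 0, and at ε in the −1 eigenspace, where B is negative definite.
  have hbvp : ∀ ε, 0 < ε → ε ≤ δ → ∃ c, G c = c ∧ G (S c ε + p ε) = -(S c ε + p ε) := by
    intro ε hε hεδ
    -- The two brackets lie in the −1 and the +1 eigenspace of G, so a single equation L c = e with
    -- G e = e encodes both boundary conditions.
    let L : E →ₗ[ℝ] E :=
      { toFun := fun c => (c - G c) + (S c ε + G (S c ε))
        map_add' := fun c d => by simp only [hSadd c d ε hε, map_add]; abel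
        map_smul' := fun a c => by
          simp only [hSsmul a c ε hε, map_smul, RingHom.id_apply, smul_add, smul_sub] }
    have hL : ∀ c, L c = (c - G c) + (S c ε + G (S c ε)) := fun c => rfl
    have key : ∀ c e, L c = e → G e = e → G c = c ∧ S c ε + G (S c ε) = e := by
      intro c e h1 h2
      have h3 : G (L c) = -(c - G c) + (S c ε + G (S c ε)) := by
        rw [hL]; simp only [map_add, map_sub, hG]; abel
      rw [h1, h2] at h3
      rw [hL] at h1
      have h4 : c - G c = -(c - G c) := add_right_cancel (h1.trans h3)
      have h5 : c - G c = 0 := by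
        refine (smul_eq_zero.1 (?_ : (2 : ℝ) • (c - G c) = 0)).resolve_left two_ne_zero
        rw [two_smul]
        nth_rewrite 1 [h4]
        exact neg_add_cancel _
      rw [h5, zero_add] at h1
      exact ⟨(sub_eq_zero.1 h5).symm, h1⟩
    have hinj : Function.Injective L := by
      rw [injective_iff_map_eq_zero]
      intro c hc
      obtain ⟨h1, h2⟩ := key c 0 hc (map_zero G)
      have h3 : G (S c ε) = -S c ε := eq_neg_of_add_eq_zero_right h2
      -- The energy bound is not homogeneous. All multiples of a homogeneous solution obey the same
      -- bound, which forces c = 0.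
      have h4 : ∀ a : ℝ, (a * ‖c‖) ^ 2 ≤ C₃ := by
        intro a
        have := hbound0 hε (u := S (a • c)) (fun s hs => by simpa using hS (a • c) s hs)
          (by rw [hSδ]; exact hGp _ (by rw [map_smul, h1]))
          (hGm _ (by rw [hSsmul a c ε hε, map_smul, h3, smul_neg])) δ (right_mem_Icc.2 hεδ)
        rw [hSδ, norm_smul, Real.norm_eq_abs, mul_pow, sq_abs, ← mul_pow] at this
        exact this.trans (mul_le_of_le_one_right hC₃0 (pow_le_one₀ hδ.le hδ1))
      by_contra hne
      have hn : 0 < ‖c‖ := norm_pos_iff.2 hne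
      have := h4 ((C₃ + 1) / ‖c‖)
      rw [div_mul_cancel₀ _ hn.ne'] at this
      nlinarith
    obtain ⟨c, hc⟩ := (LinearMap.injective_iff_surjective.1 hinj) (-(p ε + G (p ε)))
    obtain ⟨h1, h2⟩ := key c _ hc (by simp only [map_neg, map_add, hG]; abel)
    refine ⟨c, h1, ?_⟩
    rw [map_add, eq_neg_iff_add_eq_zero, ← add_eq_zero_iff_eq_neg.2 h2]
    abel
  -- Terminal values whose solution obeys the bound down to δ/(j+1). These sets are nested, compact
  -- and nonempty; a common point gives a solution bounded all the way to 0.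
  let Z : ℕ → Set E := fun j =>
    {c | ∀ s, δ / (j + 1) ≤ s → s ≤ δ → ‖S c s + p s‖ ^ 2 ≤ C₃ * s ^ (2 * M)}
  have hpos : ∀ j : ℕ, 0 < δ / (j + 1) := fun j => by positivity
  have hZle : ∀ j : ℕ, δ / (j + 1) ≤ δ := fun j => div_le_self hδ.le (by simp)
  have hZcl : ∀ j, IsClosed (Z j) := by
    intro j
    have : Z j = ⋂ s, ⋂ (_ : δ / (j + 1) ≤ s), ⋂ (_ : s ≤ δ),
        {c | ‖S c s + p s‖ ^ 2 ≤ C₃ * s ^ (2 * M)} := by ext; simp [Z]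
    rw [this]
    refine isClosed_iInter fun s => isClosed_iInter fun h1 => isClosed_iInter fun _ => ?_
    have := hcont s ((hpos j).trans_le h1)
    exact isClosed_le (by fun_prop) continuous_const
  have hZmono : ∀ j, Z (j + 1) ⊆ Z j := by
    intro j c hc s h1 h2
    refine hc s (le_trans ?_ h1) h2
    push_cast
    gcongr
    linarith
  have hZne : ∀ j, (Z j).Nonempty := by
    intro j
    obtain ⟨c, h1, h2⟩ := hbvp _ (hpos j) (hZle j)
    refine ⟨c, fun s hs1 hs2 => ?_⟩
    exact hbound (hpos j) (u := fun r => S c r + p r) (hsol c)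
      (by simp only [hSδ, hpδ, add_zero]; exact hGp _ h1) (hGm _ h2) s ⟨hs1, hs2⟩
  have hZc : IsCompact (Z 0) := by
    refine Metric.isCompact_of_isClosed_isBounded (hZcl 0)
      ((Metric.isBounded_closedBall (x := (0 : E)) (r := C₃ * δ ^ (2 * M) + 1)).subset fun c hc => ?_)
    have := hc δ (by simp) le_rfl
    rw [hSδ, hpδ, add_zero] at this
    rw [mem_closedBall_zero_iff]
    nlinarith [norm_nonneg c]
  obtain ⟨c, hc⟩ := IsCompact.nonempty_iInter_of_sequence_nonempty_isCompact_isClosed Z hZmono hZne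
    hZc hZcl
  refine ⟨fun r => S c r + p r, Real.sqrt C₃, hsol c, fun s hs => ?_⟩
  obtain ⟨j, hj⟩ := exists_nat_gt (δ / s)
  have h1 : δ / (j + 1) ≤ s := by
    rw [div_le_iff₀ (by positivity)]
    rw [div_lt_iff₀ hs.1] at hj
    nlinarith [hs.1]
  have h2 := mem_iInter.1 hc j s h1 hs.2
  refine abs_le_of_sq_le_sq' ?_ (by have := hs.1; positivity) |>.2
  rw [mul_pow, Real.sq_sqrt hC₃0, ← pow_mul, mul_comm M 2]
  exact h2

end SingularSystem

/-! ### Taylor expansions of smooth germs -/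

section Germs

variable {F : Type*} [NormedAddCommGroup F] [NormedSpace ℝ F]

/-- The germ of an analytic function on the line is the germ of a globally smooth function. -/
theorem AnalyticAt.exists_contDiff_eventuallyEq [CompleteSpace F] {f : ℝ → F} {s₀ : ℝ}
    (hf : AnalyticAt ℝ f s₀) : ∃ g : ℝ → F, ContDiff ℝ ∞ g ∧ g =ᶠ[𝓝 s₀] f := by
  obtain ⟨r, hr, hball⟩ := Metric.eventually_nhds_iff_ball.1 hf.eventually_analyticAt
  let χ : ContDiffBump s₀ := ⟨r / 3, r / 2, by positivity, by linarith⟩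
  refine ⟨fun s => χ s • f s, contDiff_iff_contDiffAt.2 fun s => ?_, ?_⟩
  · by_cases hs : s ∈ Metric.ball s₀ r
    · exact χ.contDiff.contDiffAt.smul (hball s hs).contDiffAt
    · have h1 : ∀ᶠ x in 𝓝 s, x ∈ (Metric.closedBall s₀ (r / 2))ᶜ := by
        refine Metric.isClosed_closedBall.isOpen_compl.mem_nhds fun h => hs ?_
        exact Metric.closedBall_subset_ball (by linarith) h
      refine (contDiffAt_const (c := (0 : F))).congr_of_eventuallyEq ?_
      filter_upwards [h1] with x hx
      have : χ x = 0 := χ.zero_of_le_dist (by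
        simpa using (not_le.1 fun h => hx (Metric.mem_closedBall.2 h)).le)
      rw [this, zero_smul]
  · filter_upwards [χ.eventuallyEq_one] with x hx
    rw [hx, Pi.one_apply, one_smul]

theorem isBigO_pow_succ_of_hasDerivAt {f f' : ℝ → F} {N : ℕ} (hf : ∀ s, HasDerivAt f (f' s) s)
    (h0 : f 0 = 0) (hO : f' =O[𝓝 0] fun s : ℝ => s ^ N) : f =O[𝓝 0] fun s : ℝ => s ^ (N + 1) := by
  obtain ⟨C, hC⟩ := hO.bound
  obtain ⟨r, hr, hball⟩ := Metric.eventually_nhds_iff_ball.1 hC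
  refine Asymptotics.IsBigO.of_bound C ?_
  filter_upwards [Metric.ball_mem_nhds 0 hr] with s hs
  have hs' : |s| < r := by simpa using hs
  have h1 : ∀ x ∈ uIcc 0 s, ‖f' x‖ ≤ C * |s| ^ N := by
    intro x hx
    have hxs : |x| ≤ |s| := by simpa using abs_sub_left_of_mem_uIcc hx
    have h2 := hball x (by simpa using hxs.trans_lt hs')
    rw [norm_pow, Real.norm_eq_abs] at h2
    rcases le_or_gt 0 C with hC0 | hC0
    · exact h2.trans (by gcongr)
    · have h3 : |x| ^ N = 0 := by
        have h5 : 0 ≤ |x| ^ N := by positivity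
        have h4 := norm_nonneg (f' x)
        nlinarith
      have hN : N ≠ 0 := by rintro rfl; simp at h3
      have hCr := hball s hs
      have hn := norm_nonneg (f' s)
      rw [norm_pow, Real.norm_eq_abs] at hCr
      have h6 : |s| ^ N = 0 := by
        have h5 : 0 ≤ |s| ^ N := by positivity
        nlinarith
      rw [h3] at h2
      rw [h6]; simpa using h2
  have := (convex_uIcc (0 : ℝ) s).norm_image_sub_le_of_norm_hasDerivWithin_le
    (fun x _ => (hf x).hasDerivWithinAt) h1 left_mem_uIcc right_mem_uIcc
  rw [h0, sub_zero, sub_zero, Real.norm_eq_abs] at this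
  rw [norm_pow, Real.norm_eq_abs, pow_succ, ← mul_assoc]
  exact this

theorem ContDiff.infty_deriv {f : ℝ → F} (hf : ContDiff ℝ ∞ f) : ContDiff ℝ ∞ (deriv f) :=
  (contDiff_infty_iff_deriv.1 hf).2

theorem ContDiff.hasDerivAt_of_infty {f : ℝ → F} (hf : ContDiff ℝ ∞ f) (s : ℝ) :
    HasDerivAt f (deriv f s) s :=
  ((contDiff_infty_iff_deriv.1 hf).1 s).hasDerivAt

theorem isBigO_pow_of_iteratedDeriv_eq_zero (N : ℕ) : ∀ {f : ℝ → F}, ContDiff ℝ ∞ f →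
    (∀ i < N, iteratedDeriv i f 0 = 0) → f =O[𝓝 0] fun s : ℝ => s ^ N := by
  induction N with
  | zero =>
    intro f hf _
    simpa using (hf.continuous.tendsto 0).isBigO_one ℝ
  | succ N ih =>
    intro f hf h
    refine isBigO_pow_succ_of_hasDerivAt hf.hasDerivAt_of_infty (by simpa using h 0 (by omega))
      (ih hf.infty_deriv fun i hi => ?_)
    rw [← iteratedDeriv_succ']
    exact h (i + 1) (by omega)

theorem eq_zero_of_pow_smul_isBigO {c : F} {N : ℕ} {l : Filter ℝ} [l.NeBot] (hl : l ≤ 𝓝 0)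
    (hl0 : ∀ᶠ s in l, s ≠ 0) (h : (fun s : ℝ => s ^ N • c) =O[l] fun s : ℝ => s ^ (N + 1)) :
    c = 0 := by
  have h1 : (fun _ : ℝ => c) =O[l] fun s : ℝ => s := by
    have := (Asymptotics.isBigO_refl (fun s : ℝ => (s ^ N)⁻¹) l).smul h
    refine (this.congr' ?_ ?_)
    · filter_upwards [hl0] with s hs
      rw [inv_smul_smul₀ (pow_ne_zero _ hs)]
    · filter_upwards [hl0] with s hs
      rw [smul_eq_mul, pow_succ, inv_mul_cancel_left₀ (pow_ne_zero _ hs)]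
  have h2 : Tendsto (fun _ : ℝ => c) l (𝓝 0) := h1.trans_tendsto hl
  exact tendsto_nhds_unique tendsto_const_nhds h2

theorem exists_leading_coefficient {f : ℝ → F} (hf : ContDiff ℝ ∞ f) (N : ℕ)
    (h : ∀ i < N, iteratedDeriv i f 0 = 0) :
    (fun s => f s - s ^ N • ((N.factorial : ℝ)⁻¹ • iteratedDeriv N f 0)) =O[𝓝 0]
      fun s : ℝ => s ^ (N + 1) := by
  set c := (N.factorial : ℝ)⁻¹ • iteratedDeriv N f 0 with hc
  have hp : ContDiff ℝ ∞ fun s : ℝ => s ^ N := by fun_prop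
  refine isBigO_pow_of_iteratedDeriv_eq_zero (N + 1) (by fun_prop) fun i hi => ?_
  have h1 : iteratedDeriv i (fun s : ℝ => s ^ N • c) 0 =
      iteratedDeriv i (fun s : ℝ => s ^ N) 0 • c := by
    rw [iteratedDeriv_smul_const (hp.of_le (by exact_mod_cast le_top)).contDiffAt]
  have h2 : ContDiff ℝ ∞ fun s : ℝ => s ^ N • c := by fun_prop
  rw [iteratedDeriv_fun_sub (hf.of_le (by exact_mod_cast le_top)).contDiffAt
    (h2.of_le (by exact_mod_cast le_top)).contDiffAt, h1, iteratedDeriv_fun_pow_zero]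
  rcases Nat.lt_succ_iff_lt_or_eq.1 hi with hi | rfl
  · rw [h i hi, if_neg (by omega)]; simp
  · rw [if_pos rfl, hc, smul_smul, mul_inv_cancel₀ (by positivity), one_smul, sub_self]

/-- The first nonzero Taylor coefficient would produce a term sⁱ c with i < N, which is too large.
Orders of vanishing are thus visible in the derivatives, and smooth functions have honest
expansions. -/
theorem iteratedDeriv_eq_zero_of_isBigO_pow {f : ℝ → F} (hf : ContDiff ℝ ∞ f) {N : ℕ}
    (h : f =O[𝓝 0] fun s : ℝ => s ^ N) : ∀ i < N, iteratedDeriv i f 0 = 0 := by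
  intro i
  induction i using Nat.strong_induction_on with
  | _ i ih =>
    intro hi
    have h1 := exists_leading_coefficient hf i fun j hj => ih j hj (hj.trans hi)
    have h2 : f =O[𝓝 0] fun s : ℝ => s ^ (i + 1) := h.trans (by
      refine Asymptotics.IsBigO.of_bound 1 ?_
      filter_upwards [Metric.ball_mem_nhds (0 : ℝ) one_pos] with s hs
      rw [norm_pow, norm_pow, one_mul]
      exact pow_le_pow_of_le_one (norm_nonneg _) (by simpa using (mem_ball_zero_iff.1 hs).le) hi)
    have h3 := h2.sub h1
    simp only [sub_sub_cancel] at h3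
    have h4 := eq_zero_of_pow_smul_isBigO (l := 𝓝[>] 0) nhdsWithin_le_nhds
      (by filter_upwards [self_mem_nhdsWithin] with s hs using ne_of_gt hs)
      (h3.mono nhdsWithin_le_nhds)
    exact (smul_eq_zero.1 h4).resolve_left (by positivity)

theorem exists_coefficient_of_isBigO_pow {f : ℝ → F} (hf : ContDiff ℝ ∞ f) {N : ℕ}
    (h : f =O[𝓝 0] fun s : ℝ => s ^ N) :
    ∃ c : F, (fun s => f s - s ^ N • c) =O[𝓝 0] fun s : ℝ => s ^ (N + 1) :=
  ⟨_, exists_leading_coefficient hf N (iteratedDeriv_eq_zero_of_isBigO_pow hf h)⟩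

/-- An order of vanishing of a smooth function is a condition on Taylor coefficients, so it may be
differentiated. The bootstrap to higher regularity relies on this. -/
theorem deriv_isBigO_pow {f : ℝ → F} (hf : ContDiff ℝ ∞ f) {N : ℕ}
    (h : f =O[𝓝 0] fun s : ℝ => s ^ (N + 1)) : deriv f =O[𝓝 0] fun s : ℝ => s ^ N :=
  isBigO_pow_of_iteratedDeriv_eq_zero N hf.infty_deriv fun i hi => by
    rw [← iteratedDeriv_succ']
    exact iteratedDeriv_eq_zero_of_isBigO_pow hf h (i + 1) (by omega)

end Germs

theorem isBigO_pow_of_le {F : Type*} [NormedAddCommGroup F] {f : ℝ → F} {l : Filter ℝ} (hl : l ≤ 𝓝 0) {M N : ℕ} (hMN : M ≤ N)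
    (h : f =O[l] fun s : ℝ => s ^ N) : f =O[l] fun s : ℝ => s ^ M :=
  h.trans ((Asymptotics.IsBigO.of_bound 1 (by
    filter_upwards [Metric.ball_mem_nhds (0 : ℝ) one_pos] with s hs
    rw [norm_pow, norm_pow, one_mul]
    exact pow_le_pow_of_le_one (norm_nonneg _) (by simpa using (mem_ball_zero_iff.1 hs).le) hMN)).mono hl)

/-! ### Smoothness of solutions up to the singular time -/

section Smoothness

/-- `u` is approximated to order `N` at `0+` by a smooth function that solves the singular system
`sᵏ u' = B u` up to an error of order `N`. -/
def ApproxSmooth {E : Type} [NormedAddCommGroup E] [NormedSpace ℝ E] (k : ℕ)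
    (B : ℝ → E →L[ℝ] E) (u : ℝ → E) (N : ℕ) : Prop :=
  ∃ g : ℝ → E, ContDiff ℝ ∞ g ∧ (fun s => u s - g s) =O[𝓝[>] 0] (fun s : ℝ => s ^ N) ∧
    (fun s => s ^ k • deriv g s - B s (g s)) =O[𝓝 0] fun s : ℝ => s ^ N

/-- Bootstrap: the pair (u, u') solves a singular system of the same kind with exponent k + 1, and
it is approximated by the pairs (g, g'). The induction therefore quantifies over the space E, and
regularity j of the pair is regularity j + 1 of u. -/
theorem contDiffOn_nat_of_approxSmooth (j : ℕ) :
    ∀ {E : Type} [NormedAddCommGroup E] [NormedSpace ℝ E] {k : ℕ} {B : ℝ → E →L[ℝ] E}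
      {u : ℝ → E} {δ : ℝ}, 0 < δ → ContDiff ℝ ∞ B →
      (∀ s ∈ Ioo 0 δ, HasDerivAt u ((s ^ k)⁻¹ • B s (u s)) s) →
      ContinuousWithinAt u (Ioi 0) 0 → (∀ N, ApproxSmooth k B u N) →
      ContDiffOn ℝ j u (Ico 0 δ) := by
  induction j with
  | zero =>
    intro E _ _ k B u δ hδ _ hu hu0 _
    refine contDiffOn_zero.2 fun s hs => ?_
    rcases hs.1.eq_or_lt with rfl | h
    · exact (continuousWithinAt_Ioi_iff_Ici.1 hu0).mono Ico_subset_Ici_self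
    · exact (hu s ⟨h, hs.2⟩).continuousAt.continuousWithinAt
  | succ j ih =>
    intro E _ _ k B u δ hδ hB hu hu0 hN
    obtain ⟨g₁, hg₁, hug₁, hdg₁⟩ := hN (k + 1)
    -- The derivative of u, with its value at 0 read off from an approximation. The order k + 1 is
    -- taken because the equation divides by s^k and one order must remain for convergence.
    set w : ℝ → E := fun s => if s = 0 then deriv g₁ 0 else (s ^ k)⁻¹ • B s (u s) with hw
    have hwpos : ∀ s, 0 < s → w s = (s ^ k)⁻¹ • B s (u s) := fun s hs => if_neg hs.ne'
    have hBc : ContinuousAt B 0 := hB.continuous.continuousAt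
    -- Passing from u to its derivative through the equation costs exactly k orders of
    -- approximation.
    have hwO : ∀ (g : ℝ → E) (N : ℕ), (fun s => u s - g s) =O[𝓝[>] 0] (fun s : ℝ => s ^ (N + k)) →
        ((fun s => s ^ k • deriv g s - B s (g s)) =O[𝓝 0] fun s : ℝ => s ^ (N + k)) →
        (fun s => w s - deriv g s) =O[𝓝[>] 0] fun s : ℝ => s ^ N := by
      intro g N h1 h2
      have h3 : (fun s => B s (u s - g s)) =O[𝓝[>] 0] fun s : ℝ => s ^ (N + k) := by
        have hb : (fun s => B s) =O[𝓝[>] 0] fun _ : ℝ => (1 : ℝ) :=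
          (hBc.tendsto.mono_left nhdsWithin_le_nhds).isBigO_one ℝ
        have := (hb.norm_norm.mul h1.norm_norm)
        refine (Asymptotics.IsBigO.of_norm_le fun s => ?_ : _ =O[_] _).trans this |>.trans ?_
        · exact (B s).le_opNorm _
        · simpa using (Asymptotics.isBigO_refl (fun s : ℝ => s ^ (N + k)) _).norm_left
      have h4 := (Asymptotics.isBigO_refl (fun s : ℝ => (s ^ k)⁻¹) (𝓝[>] 0)).smul
        (h3.sub (h2.mono nhdsWithin_le_nhds))
      refine h4.congr' ?_ ?_
      · filter_upwards [self_mem_nhdsWithin] with s hs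
        have hs' : s ^ k ≠ 0 := pow_ne_zero _ (ne_of_gt hs)
        rw [hwpos s hs, map_sub]
        rw [show B s (u s) - B s (g s) - (s ^ k • deriv g s - B s (g s)) =
          B s (u s) - s ^ k • deriv g s by abel, smul_sub, inv_smul_smul₀ hs']
      · filter_upwards [self_mem_nhdsWithin] with s hs
        have hs' : s ^ k ≠ 0 := pow_ne_zero _ (ne_of_gt hs)
        rw [smul_eq_mul, pow_add]
        field_simp
    have hw0 : ContinuousWithinAt w (Ioi 0) 0 := by
      have h1 := hwO g₁ 1 (by rwa [add_comm 1 k]) (by rwa [add_comm 1 k])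
      have h2 : Tendsto (fun s => w s - deriv g₁ s) (𝓝[>] 0) (𝓝 0) :=
        h1.trans_tendsto (by
          simpa using! (tendsto_id (α := ℝ) (x := 𝓝 0)).mono_left nhdsWithin_le_nhds)
      have h3 : Tendsto (deriv g₁) (𝓝[>] 0) (𝓝 (deriv g₁ 0)) :=
        (hg₁.infty_deriv.continuous.tendsto 0).mono_left nhdsWithin_le_nhds
      have h4 := h2.add h3
      simp only [sub_add_cancel, zero_add] at h4
      simpa [ContinuousWithinAt, hw] using h4
    have hud : ∀ s ∈ Ico 0 δ, HasDerivWithinAt u (w s) (Ico 0 δ) s := by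
      intro s hs
      rcases hs.1.eq_or_lt with rfl | h
      · have := hasDerivWithinAt_Ici_of_tendsto_deriv (s := Ioo 0 δ) (e := w 0) (a := 0) (f := u)
          (fun x hx => (hu x hx).differentiableAt.differentiableWithinAt)
          (hu0.mono Ioo_subset_Ioi_self) (Ioo_mem_nhdsGT hδ) ?_
        · exact this.mono Ico_subset_Ici_self
        · refine hw0.tendsto.congr' ?_
          filter_upwards [Ioo_mem_nhdsGT hδ] with x hx
          rw [(hu x hx).deriv, hwpos x hx.1]
      · rw [hwpos s h]
        exact (hu s ⟨h, hs.2⟩).hasDerivWithinAt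
    let fs := ContinuousLinearMap.fst ℝ E E
    let sn := ContinuousLinearMap.snd ℝ E E
    -- Differentiate s^k w = B u, multiply by s, and replace s^k w by B u in the lower-order term:
    -- s^{k+1} w' = s B' u − k B u + s B w. No negative power of s survives.
    let B₁ : ℝ → E × E →L[ℝ] E × E := fun s =>
      (s ^ (k + 1) • sn).prod
        ((s • deriv B s - (k : ℝ) • B s).comp fs + (s • B s).comp sn)
    have hB₁ : ContDiff ℝ ∞ B₁ := by
      have h1 : ContDiff ℝ ∞ fun s : ℝ => s ^ (k + 1) • sn :=
        (contDiff_id.pow _).smul contDiff_const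
      have h2 : ContDiff ℝ ∞ fun s : ℝ => s • deriv B s - (k : ℝ) • B s :=
        (contDiff_id.smul hB.infty_deriv).sub (hB.const_smul (k : ℝ))
      have h3 : ContDiff ℝ ∞ fun s : ℝ => s • B s := contDiff_id.smul hB
      have h4 := (h2.clm_comp (contDiff_const (c := fs))).add (h3.clm_comp (contDiff_const (c := sn)))
      exact (ContinuousLinearMap.prodₗᵢ (𝕜 := ℝ) (E := E × E) (F := E) (G := E) ℝ).contDiff.comp
        (h1.prodMk h4)
    have hB₁v : ∀ s x y, B₁ s (x, y) =
        (s ^ (k + 1) • y, s • deriv B s x - (k : ℝ) • B s x + s • B s y) := fun s x y => rfl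
    have hkey := ih (E := E × E) (k := k + 1) (B := B₁) (u := fun s => (u s, w s)) hδ hB₁ ?_ ?_ ?_
    · have hwc : ContDiffOn ℝ j w (Ico 0 δ) := contDiff_snd.comp_contDiffOn hkey
      rw [show ((j + 1 : ℕ) : WithTop ℕ∞) = (j : WithTop ℕ∞) + 1 by push_cast; rfl,
        contDiffOn_succ_iff_derivWithin (uniqueDiffOn_Ico 0 δ)]
      refine ⟨fun s hs => (hud s hs).differentiableWithinAt, by simp, hwc.congr fun s hs => ?_⟩
      exact (hud s hs).derivWithin (uniqueDiffOn_Ico 0 δ s hs)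
    · intro s hs
      have hs0 : s ≠ 0 := hs.1.ne'
      have h1 : HasDerivAt w ((s ^ (k + 1))⁻¹ •
          (s • deriv B s (u s) - (k : ℝ) • B s (u s) + s • B s (w s))) s := by
        have h2 : HasDerivAt (fun r : ℝ => (r ^ k)⁻¹) (-k * (s ^ (k + 1))⁻¹) s := by
          refine ((hasDerivAt_pow k s).fun_inv (pow_ne_zero _ hs0)).congr_deriv ?_
          rcases k with _ | k
          · simp
          · rw [Nat.add_sub_cancel]
            field_simp
            ring
        have h3 := (hB.hasDerivAt_of_infty s).clm_apply (hu s hs)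
        have h4 := (h2.fun_smul h3).congr_of_eventuallyEq (f₁ := w) (by
          filter_upwards [lt_mem_nhds hs.1] with r hr using hwpos r hr)
        refine h4.congr_deriv ?_
        rw [hwpos s hs.1]
        have e1 : (s ^ (k + 1))⁻¹ * s = (s ^ k)⁻¹ := by rw [pow_succ]; field_simp
        simp only [smul_add, smul_sub, smul_smul, map_smul, e1]
        rw [show -(k : ℝ) * (s ^ (k + 1))⁻¹ = -((s ^ (k + 1))⁻¹ * k) by ring, neg_smul, ← mul_assoc,
          e1]
        abel
      refine ((hu s hs).prodMk h1).congr_deriv ?_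
      rw [hB₁v, Prod.smul_mk, inv_smul_smul₀ (pow_ne_zero _ hs0), hwpos s hs.1]
    · exact hu0.prodMk hw0
    · intro N
      obtain ⟨g, hg, hug, hdg⟩ := hN (N + k)
      have hdg' : ContDiff ℝ ∞ fun s => s ^ k • deriv g s - B s (g s) :=
        ((contDiff_id.pow k).smul hg.infty_deriv).sub (hB.clm_apply hg)
      refine ⟨fun s => (g s, deriv g s), hg.prodMk hg.infty_deriv, ?_, ?_⟩
      · exact ((isBigO_pow_of_le nhdsWithin_le_nhds (by omega) hug).prod_left (hwO g N hug hdg))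
      · have hdN := isBigO_pow_of_le le_rfl (by omega : N ≤ N + k) hdg
        -- If d is the defect of g, the second component of the defect of (g, g') is s d' − k d. The
        -- order lost in d' is regained by the factor s.
        have hder : (fun s => s • deriv (fun s => s ^ k • deriv g s - B s (g s)) s)
            =O[𝓝 0] fun s : ℝ => s ^ N := by
          rcases N with _ | N
          · simpa using (((continuous_id.smul hdg'.infty_deriv.continuous).tendsto 0).isBigO_one ℝ)
          · have h1 := deriv_isBigO_pow hdg' (isBigO_pow_of_le le_rfl (by omega : N + 1 ≤ _) hdg)
            simpa [pow_succ'] using (Asymptotics.isBigO_refl (fun s : ℝ => s) (𝓝 0)).smul h1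
        have h2 := (Asymptotics.isBigO_zero (E' := E) (fun s : ℝ => s ^ N) (𝓝 0)).prod_left
          (hder.sub (hdN.const_smul_left (k : ℝ)))
        refine h2.congr_left fun s => ?_
        have hd : deriv (fun s => (g s, deriv g s)) s = (deriv g s, deriv (deriv g) s) :=
          ((hg.hasDerivAt_of_infty s).prodMk (hg.infty_deriv.hasDerivAt_of_infty s)).deriv
        have hdd : deriv (fun s => s ^ k • deriv g s - B s (g s)) s =
            (s ^ k • deriv (deriv g) s + (k * s ^ (k - 1)) • deriv g s) -
              (deriv B s (g s) + B s (deriv g s)) :=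
          (((hasDerivAt_pow k s).fun_smul (hg.infty_deriv.hasDerivAt_of_infty s)).fun_sub
            ((hB.hasDerivAt_of_infty s).clm_apply (hg.hasDerivAt_of_infty s))).deriv
        rw [hd, hdd, hB₁v, Prod.smul_mk, Prod.mk_sub_mk, sub_self]
        congr 1
        have e1 : s * (k * s ^ (k - 1)) = k * s ^ k := by
          rcases k with _ | k
          · simp
          · simp only [Nat.add_sub_cancel]; ring
        simp only [smul_sub, smul_add, smul_smul, e1, Pi.smul_apply]
        rw [← pow_succ']
        abel

/-- A solution of a singular system that has smooth approximations of every order at `0+` is smooth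
up to `0`. -/
theorem contDiffOn_of_approxSmooth {E : Type} [NormedAddCommGroup E] [NormedSpace ℝ E] {k : ℕ}
    {B : ℝ → E →L[ℝ] E} {u : ℝ → E} {δ : ℝ} (hδ : 0 < δ) (hB : ContDiff ℝ ∞ B)
    (hu : ∀ s ∈ Ioo 0 δ, HasDerivAt u ((s ^ k)⁻¹ • B s (u s)) s)
    (hu0 : ContinuousWithinAt u (Ioi 0) 0) (hN : ∀ N, ApproxSmooth k B u N) :
    ContDiffOn ℝ ∞ u (Ico 0 δ) :=
  contDiffOn_infty.2 fun j => contDiffOn_nat_of_approxSmooth j hδ hB hu hu0 hN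

end Smoothness

/-! ### Calculus of the symplectic form -/

section SymplecticForm

variable {n : ℕ}

theorem symplForm_eq_sum (u v : PhaseSpace n) :
    symplForm u v = ∑ i, (u (Sum.inl i) * v (Sum.inr i) - u (Sum.inr i) * v (Sum.inl i)) := by
  simp only [symplForm, symplJ, dotProduct, Fintype.sum_sum_type, Matrix.mulVec,
    Matrix.fromBlocks_apply₁₁, Matrix.fromBlocks_apply₁₂, Matrix.fromBlocks_apply₂₁,
    Matrix.fromBlocks_apply₂₂, Matrix.zero_apply, zero_mul, Finset.sum_const_zero, zero_add,
    add_zero, Matrix.one_apply, ite_mul, one_mul, Finset.sum_ite_eq, Finset.mem_univ, if_true,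
    Matrix.neg_apply, neg_mul, Finset.sum_neg_distrib, mul_neg, Finset.sum_sub_distrib]
  ring

/-- The symplectic form as a continuous bilinear map. -/
noncomputable def symplBilin (n : ℕ) : PhaseSpace n →L[ℝ] PhaseSpace n →L[ℝ] ℝ :=
  LinearMap.toContinuousLinearMap
    { toFun := fun u => LinearMap.toContinuousLinearMap
        { toFun := fun v => symplForm u v
          map_add' := fun v w => by
            simp only [symplForm_eq_sum, PiLp.add_apply, ← Finset.sum_add_distrib]
            exact Finset.sum_congr rfl fun i _ => by ring
          map_smul' := fun c v => by
            simp only [symplForm_eq_sum, PiLp.smul_apply, smul_eq_mul, RingHom.id_apply,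
              Finset.mul_sum]
            exact Finset.sum_congr rfl fun i _ => by ring }
      map_add' := fun u v => by
        ext w
        simp only [LinearMap.coe_toContinuousLinearMap', LinearMap.coe_mk, AddHom.coe_mk,
          add_apply, symplForm_eq_sum, PiLp.add_apply,
          ← Finset.sum_add_distrib]
        exact Finset.sum_congr rfl fun i _ => by ring
      map_smul' := fun c v => by
        ext w
        simp only [LinearMap.coe_toContinuousLinearMap', LinearMap.coe_mk, AddHom.coe_mk,
          smul_apply, symplForm_eq_sum, PiLp.smul_apply, smul_eq_mul,
          RingHom.id_apply, Finset.mul_sum]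
        exact Finset.sum_congr rfl fun i _ => by ring }

@[simp]
theorem symplBilin_apply (u v : PhaseSpace n) : symplBilin n u v = symplForm u v := rfl

theorem symplForm_swap (u v : PhaseSpace n) : symplForm u v = -symplForm v u := by
  simp only [symplForm_eq_sum, ← Finset.sum_neg_distrib]
  exact Finset.sum_congr rfl fun i _ => by ring

@[simp]
theorem symplForm_self (u : PhaseSpace n) : symplForm u u = 0 := by
  linarith [symplForm_swap u u]

theorem symplForm_add_left (u v w : PhaseSpace n) :
    symplForm (u + v) w = symplForm u w + symplForm v w := by simp [← symplBilin_apply]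

theorem symplForm_add_right (u v w : PhaseSpace n) :
    symplForm u (v + w) = symplForm u v + symplForm u w := by simp [← symplBilin_apply]

theorem symplForm_sub_right (u v w : PhaseSpace n) :
    symplForm u (v - w) = symplForm u v - symplForm u w := by simp [← symplBilin_apply]

theorem symplForm_smul_left (c : ℝ) (u v : PhaseSpace n) :
    symplForm (c • u) v = c * symplForm u v := by simp [← symplBilin_apply]

theorem symplForm_smul_right (c : ℝ) (u v : PhaseSpace n) :
    symplForm u (c • v) = c * symplForm u v := by simp [← symplBilin_apply]

@[simp]
theorem symplForm_zero_left (v : PhaseSpace n) : symplForm 0 v = 0 := by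
  simp [← symplBilin_apply]

@[simp]
theorem symplForm_zero_right (v : PhaseSpace n) : symplForm v 0 = 0 := by
  simp [← symplBilin_apply]

theorem HasDerivAt.symplForm {f g : ℝ → PhaseSpace n} {f' g' : PhaseSpace n} {s : ℝ}
    (hf : HasDerivAt f f' s) (hg : HasDerivAt g g' s) :
    HasDerivAt (fun r => symplForm (f r) (g r)) (symplForm f' (g s) + symplForm (f s) g') s :=
  ((symplBilin n).hasFDerivAt.comp_hasDerivAt s hf).clm_apply hg

theorem ContDiff.symplForm {f g : ℝ → PhaseSpace n} {m : WithTop ℕ∞} (hf : ContDiff ℝ m f)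
    (hg : ContDiff ℝ m g) : ContDiff ℝ m fun r => symplForm (f r) (g r) :=
  ((symplBilin n).contDiff.comp hf).clm_apply hg

theorem Continuous.symplForm {f g : ℝ → PhaseSpace n} (hf : Continuous f)
    (hg : Continuous g) : Continuous fun r => symplForm (f r) (g r) :=
  ((symplBilin n).continuous.comp hf).clm_apply hg

theorem symplForm_isBigO {f g : ℝ → PhaseSpace n} {l : Filter ℝ} {p : ℝ → ℝ}
    (hf : f =O[l] fun _ => (1 : ℝ)) (hg : g =O[l] p) : (fun s => symplForm (f s) (g s)) =O[l] p := by
  have h := (hf.norm_norm.mul hg.norm_norm).const_mul_left ‖symplBilin n‖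
  refine (Asymptotics.IsBigO.of_norm_le fun s => ?_ : _ =O[l] _).trans (h.trans ?_)
  · rw [← symplBilin_apply, ← mul_assoc]
    exact (symplBilin n).le_opNorm₂ _ _
  · simpa using (Asymptotics.isBigO_refl p l).norm_left

end SymplecticForm

/-! ### Formal solutions of the Jacobi equation and the resonance -/

section FormalSolution

variable {n : ℕ} {X : ℝ → PhaseSpace n}

theorem hasDerivAt_variedCurve (hX : Continuous X) {P : ℝ → ℝ} (hP : Continuous P)
    (ξ : PhaseSpace n) (s : ℝ) : HasDerivAt (variedCurve X ξ P) (P s • X s) s :=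
  (intervalIntegral.integral_hasDerivAt_right ((hP.smul hX).intervalIntegrable _ _)
    (hP.smul hX).stronglyMeasurable.stronglyMeasurableAtFilter (hP.smul hX).continuousAt).const_add ξ

@[simp]
theorem variedCurve_zero (ξ : PhaseSpace n) (P : ℝ → ℝ) : variedCurve X ξ P 0 = ξ := by
  simp [variedCurve]

theorem contDiff_variedCurve (hX : ContDiff ℝ ∞ X) {P : ℝ → ℝ} (hP : ContDiff ℝ ∞ P)
    (ξ : PhaseSpace n) : ContDiff ℝ ∞ (variedCurve X ξ P) := by
  have h := hasDerivAt_variedCurve hX.continuous hP.continuous ξ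
  rw [contDiff_infty_iff_deriv]
  refine ⟨fun s => (h s).differentiableAt, ?_⟩
  rw [funext fun s => (h s).deriv]
  exact hP.smul hX

theorem variedCurve_add_smul (hX : Continuous X) {P R : ℝ → ℝ} (hP : Continuous P)
    (hR : Continuous R) (ξ ζ : PhaseSpace n) (x y : ℝ) (s : ℝ) :
    variedCurve X (x • ξ + y • ζ) (fun r => x * P r + y * R r) s =
      x • variedCurve X ξ P s + y • variedCurve X ζ R s := by
  have h1 : (fun r => (x * P r + y * R r) • X r) = fun r => x • (P r • X r) + y • (R r • X r) := by
    funext r; rw [add_smul, mul_smul, mul_smul]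
  simp only [variedCurve]
  have hP' : Continuous fun r => x • (P r • X r) := by fun_prop
  have hR' : Continuous fun r => y • (R r • X r) := by fun_prop
  rw [h1, intervalIntegral.integral_add (hP'.intervalIntegrable _ _) (hR'.intervalIntegrable _ _),
    intervalIntegral.integral_smul, intervalIntegral.integral_smul]
  simp only [smul_add]
  abel

/-- The defect `σ(X, η) - b P` of the curve `η = ξ + ∫ P X` in the Jacobi equation with
`b = -sᵏ β`. -/
noncomputable def jacobiDefect (X : ℝ → PhaseSpace n) (β : ℝ → ℝ) (k : ℕ) (ξ : PhaseSpace n)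
    (P : ℝ → ℝ) (s : ℝ) : ℝ :=
  symplForm (X s) (variedCurve X ξ P s) + s ^ k * β s * P s

theorem contDiff_jacobiDefect (hX : ContDiff ℝ ∞ X) {β : ℝ → ℝ} (hβ : ContDiff ℝ ∞ β) (k : ℕ)
    (ξ : PhaseSpace n) {P : ℝ → ℝ} (hP : ContDiff ℝ ∞ P) :
    ContDiff ℝ ∞ (jacobiDefect X β k ξ P) :=
  (hX.symplForm (contDiff_variedCurve hX hP ξ)).add (((contDiff_id.pow k).mul hβ).mul hP)

theorem jacobiDefect_add_smul (hX : Continuous X) (β : ℝ → ℝ) (k : ℕ) {P R : ℝ → ℝ}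
    (hP : Continuous P) (hR : Continuous R) (ξ ζ : PhaseSpace n) (x y : ℝ) (s : ℝ) :
    jacobiDefect X β k (x • ξ + y • ζ) (fun r => x * P r + y * R r) s =
      x * jacobiDefect X β k ξ P s + y * jacobiDefect X β k ζ R s := by
  simp only [jacobiDefect, variedCurve_add_smul hX hP hR, symplForm_add_right,
    symplForm_smul_right]
  ring

/-- The start of the recursion: the constant curve has defect σ(X, ξ), whose first two Taylor
coefficients are the two hypotheses. Order 2 is enough to begin with j = 0, as e ≤ 2. -/
theorem jacobiDefect_zero_isBigO (hX : ContDiff ℝ ∞ X) (β : ℝ → ℝ) (k : ℕ) {ξ : PhaseSpace n}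
    (h0 : symplForm (X 0) ξ = 0) (h1 : symplForm (deriv X 0) ξ = 0) :
    jacobiDefect X β k ξ (fun _ => 0) =O[𝓝 0] fun s : ℝ => s ^ 2 := by
  have e : jacobiDefect X β k ξ (fun _ => 0) = fun s => symplForm (X s) ξ := by
    funext s; simp [jacobiDefect, variedCurve]
  have hd : ∀ (Y : ℝ → PhaseSpace n), ContDiff ℝ ∞ Y → ∀ s,
      HasDerivAt (fun s => symplForm (Y s) ξ) (symplForm (deriv Y s) ξ) s := fun Y hY s => by
    simpa using (hY.hasDerivAt_of_infty s).symplForm (hasDerivAt_const s ξ)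
  rw [e]
  refine isBigO_pow_succ_of_hasDerivAt (hd X hX) h0
    (isBigO_pow_succ_of_hasDerivAt (hd _ hX.infty_deriv) h1 ?_)
  have : Continuous fun s => symplForm (deriv (deriv X) s) ξ :=
    hX.infty_deriv.infty_deriv.continuous.symplForm continuous_const
  simpa using (this.tendsto 0).isBigO_one ℝ

theorem sub_const_isBigO {F : Type*} [NormedAddCommGroup F] [NormedSpace ℝ F] {f : ℝ → F}
    (hf : ContDiff ℝ ∞ f) : (fun s => f s - f 0) =O[𝓝 0] fun s : ℝ => s := by
  simpa using (hf.hasDerivAt_of_infty 0).isBigO_sub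

/-- The leading term of `σ(X, ∫ sʲ X)`. -/
theorem symplForm_variedCurve_pow_isBigO (hX : ContDiff ℝ ∞ X) (j : ℕ) :
    (fun s => symplForm (X s) (variedCurve X 0 (fun r => r ^ j) s) +
      s ^ (j + 2) * (symplForm (X 0) (deriv X 0) / ((j + 1) * (j + 2)))) =O[𝓝 0]
      fun s : ℝ => s ^ (j + 3) := by
  set a := symplForm (X 0) (deriv X 0) with ha
  have hP : ContDiff ℝ ∞ fun r : ℝ => r ^ j := by fun_prop
  set V := variedCurve X 0 (fun r => r ^ j) with hV
  have hVd : ∀ s, HasDerivAt V (s ^ j • X s) s :=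
    hasDerivAt_variedCurve hX.continuous hP.continuous 0
  have hV0 : V 0 = 0 := variedCurve_zero _ _
  have hVO : V =O[𝓝 0] fun s : ℝ => s ^ (j + 1) := by
    refine isBigO_pow_succ_of_hasDerivAt hVd hV0 ?_
    simpa using (Asymptotics.isBigO_refl (fun s : ℝ => s ^ j) (𝓝 0)).smul
      ((hX.continuous.tendsto 0).isBigO_one ℝ)
  have hj1 : ((j : ℝ) + 1) ≠ 0 := by positivity
  have hj2 : ((j : ℝ) + 2) ≠ 0 := by positivity
  -- In the first derivative the term sʲ σ(X, X) drops out, so the leading coefficient only appears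
  -- after a second differentiation.
  refine isBigO_pow_succ_of_hasDerivAt (f' := fun s =>
    symplForm (deriv X s) (V s) + s ^ (j + 1) * (a / (j + 1))) (fun s => ?_) (by simp [hV0]) ?_
  · have h1 := (hX.hasDerivAt_of_infty s).symplForm (hVd s)
    rw [symplForm_smul_right, symplForm_self, mul_zero, add_zero] at h1
    refine (h1.fun_add ((hasDerivAt_pow (j + 2) s).mul_const _)).congr_deriv ?_
    push_cast
    field_simp
  · refine isBigO_pow_succ_of_hasDerivAt (f' := fun s =>
      symplForm (deriv (deriv X) s) (V s) + s ^ j * (symplForm (deriv X s) (X s) + a))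
      (fun s => ?_) (by simp [hV0]) ?_
    · have h1 := (hX.infty_deriv.hasDerivAt_of_infty s).symplForm (hVd s)
      refine (h1.fun_add ((hasDerivAt_pow (j + 1) s).mul_const _)).congr_deriv ?_
      rw [symplForm_smul_right]
      push_cast
      field_simp
      ring
    · refine (symplForm_isBigO
        ((hX.infty_deriv.infty_deriv.continuous.tendsto 0).isBigO_one ℝ) hVO).add ?_
      have h2 := sub_const_isBigO (hX.infty_deriv.symplForm hX)
      have h3 := (Asymptotics.isBigO_refl (fun s : ℝ => s ^ j) (𝓝 0)).mul h2
      refine h3.congr (fun s => ?_) fun s => (pow_succ _ _).symm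
      rw [ha, symplForm_swap (X 0) (deriv X 0)]
      ring

/-- The leading term of the defect of `∫ sʲ X`: it has order `j + e` and coefficient `D j`, where at
most one of the `D j` vanishes, and none if `k = 1` or `σ(X, X') < 0`. -/
theorem exists_jacobiDefect_leading_term (hX : ContDiff ℝ ∞ X) {β : ℝ → ℝ}
    (hβ : ContDiff ℝ ∞ β) (hβ0 : 0 < β 0) {k : ℕ} (hk : 1 ≤ k)
    (ha : symplForm (X 0) (deriv X 0) ≠ 0) :
    ∃ (e : ℕ) (D : ℕ → ℝ), e ≤ 2 ∧ (∀ i j, D i = 0 → D j = 0 → i = j) ∧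
      (symplForm (X 0) (deriv X 0) < 0 → ∀ j, D j ≠ 0) ∧
      ∀ j, (fun s => jacobiDefect X β k 0 (fun r => r ^ j) s - s ^ (j + e) * D j) =O[𝓝 0]
        fun s : ℝ => s ^ (j + e + 1) := by
  set a := symplForm (X 0) (deriv X 0) with ha_def
  have hmain := fun j => symplForm_variedCurve_pow_isBigO hX j
  have hβO := sub_const_isBigO hβ
  have hpow : ∀ (c : ℝ) {M N : ℕ}, M ≤ N → (fun s : ℝ => s ^ N * c) =O[𝓝 0] fun s => s ^ M :=
    fun c M N h => isBigO_pow_of_le le_rfl h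
      (by simpa [mul_comm] using (Asymptotics.isBigO_refl (fun s : ℝ => s ^ N) (𝓝 0)).const_mul_left c)
  have hβpow : ∀ j, (fun s : ℝ => s ^ (j + k) * (β s - β 0)) =O[𝓝 0] fun s => s ^ (j + k + 1) :=
    fun j => ((Asymptotics.isBigO_refl (fun s : ℝ => s ^ (j + k)) (𝓝 0)).mul hβO).congr_right
      fun s => (pow_succ _ _).symm
  have hden : ∀ j : ℕ, (0 : ℝ) < (j + 1) * (j + 2) := fun j => by positivity
  rcases Nat.lt_or_ge k 2 with hk1 | hk2
  · obtain rfl : k = 1 := by omega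
    -- For k = 1 the term s^k β P has order j + 1 and wins over σ(X, ∫ P X), which has order j + 2.
    refine ⟨1, fun _ => β 0, by norm_num, fun i j h => absurd h hβ0.ne', fun _ _ => hβ0.ne',
      fun j => ?_⟩
    have h1 := (isBigO_pow_of_le le_rfl (by omega : j + 1 + 1 ≤ j + 3) (hmain j)).add
      ((hβpow j).sub (hpow (a / ((j + 1) * (j + 2))) (by omega : j + 1 + 1 ≤ j + 2)))
    refine h1.congr_left fun s => ?_
    simp only [jacobiDefect]
    ring
  · rcases hk2.eq_or_lt with rfl | hk3
    -- For k = 2 both terms have order j + 2. Resonance means β(0)(j+1)(j+2) = a, which has at most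
    -- one solution j ≥ 0, and none for a < 0.
    · refine ⟨2, fun j => β 0 - a / ((j + 1) * (j + 2)), le_rfl, fun i j hi hj => ?_,
        fun hneg j => ?_, fun j => ?_⟩
      · have hi' : β 0 * ((i + 1) * (i + 2)) = a := by
          have := hden i; field_simp at hi; linarith
        have hj' : β 0 * ((j + 1) * (j + 2)) = a := by
          have := hden j; field_simp at hj; linarith
        have h3 : ((i : ℝ) + 1) * (i + 2) = (j + 1) * (j + 2) :=
          mul_left_cancel₀ hβ0.ne' (hi'.trans hj'.symm)
        have h4 : ((i : ℝ) - j) * (i + j + 3) = 0 := by linarith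
        rcases mul_eq_zero.1 h4 with h5 | h5
        · exact_mod_cast sub_eq_zero.1 h5
        · exfalso
          have : (0 : ℝ) < i + j + 3 := by positivity
          linarith
      · have := div_neg_of_neg_of_pos hneg (hden j)
        exact (by linarith : (0 : ℝ) < _).ne'
      · refine ((hmain j).add (hβpow j)).congr_left fun s => ?_
        simp only [jacobiDefect]
        ring
    -- For k ≥ 3 the symplectic term alone is leading, and it never vanishes.
    · refine ⟨2, fun j => -(a / ((j + 1) * (j + 2))), le_rfl,
        fun i j hi => absurd hi (neg_ne_zero.2 (div_ne_zero ha (hden i).ne')),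
        fun _ j => neg_ne_zero.2 (div_ne_zero ha (hden j).ne'), fun j => ?_⟩
      have h1 := (hmain j).add ((isBigO_pow_of_le le_rfl (by omega : j + 3 ≤ j + k + 1)
        (hβpow j)).add (hpow (β 0) (by omega : j + 3 ≤ j + k)))
      refine h1.congr_left fun s => ?_
      simp only [jacobiDefect]
      ring

variable {β : ℝ → ℝ} {k e : ℕ} {D : ℕ → ℝ}

/-- Newton's recursion: the coefficient c of s^{N+e} in the defect is cancelled by adding −(c / D N)
s^N to P, which leaves the lower orders alone. -/
theorem exists_jacobiDefect_isBigO_of_ne_zero (hX : ContDiff ℝ ∞ X) (hβ : ContDiff ℝ ∞ β)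
    (hlead : ∀ j, (fun s => jacobiDefect X β k 0 (fun r => r ^ j) s - s ^ (j + e) * D j) =O[𝓝 0]
        fun s : ℝ => s ^ (j + e + 1)) {ξ : PhaseSpace n} {N₀ N : ℕ} (hN : N₀ ≤ N)
    (hD : ∀ j, N₀ ≤ j → j < N → D j ≠ 0)
    (h0 : ∃ P : ℝ → ℝ, ContDiff ℝ ∞ P ∧
      jacobiDefect X β k ξ P =O[𝓝 0] fun s : ℝ => s ^ (N₀ + e)) :
    ∃ P : ℝ → ℝ, ContDiff ℝ ∞ P ∧ jacobiDefect X β k ξ P =O[𝓝 0] fun s : ℝ => s ^ (N + e) := by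
  induction N, hN using Nat.le_induction with
  | base => exact h0
  | succ N hN ih =>
    obtain ⟨P, hP, hPO⟩ := ih fun j h1 h2 => hD j h1 (by omega)
    obtain ⟨c, hc⟩ := exists_coefficient_of_isBigO_pow (contDiff_jacobiDefect hX hβ k ξ hP) hPO
    have hpow : ContDiff ℝ ∞ fun r : ℝ => r ^ N := by fun_prop
    refine ⟨fun r => 1 * P r + (-(c / D N)) * r ^ N,
      (contDiff_const.mul hP).add (contDiff_const.mul hpow), ?_⟩
    have h1 := hc.add ((hlead N).const_mul_left (-(c / D N)))
    rw [show N + 1 + e = N + e + 1 by omega]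
    refine h1.congr_left fun s => ?_
    have h2 := jacobiDefect_add_smul hX.continuous β k hP.continuous hpow.continuous ξ 0 1
      (-(c / D N)) s
    rw [smul_zero, add_zero, one_smul] at h2
    rw [h2, smul_eq_mul]
    have := hD N hN (by omega)
    field_simp
    ring

/-- The recursion can stop only at the resonant index m, where the obstruction is one real number.
Two initial values have a nontrivial combination whose obstructions cancel, and beyond m nothing
stops the recursion again. -/
theorem exists_jacobiDefect_isBigO_combination (hX : ContDiff ℝ ∞ X) (hβ : ContDiff ℝ ∞ β)
    (he : e ≤ 2) (hD : ∀ i j, D i = 0 → D j = 0 → i = j)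
    (hlead : ∀ j, (fun s => jacobiDefect X β k 0 (fun r => r ^ j) s - s ^ (j + e) * D j) =O[𝓝 0]
        fun s : ℝ => s ^ (j + e + 1)) {ξ ζ : PhaseSpace n}
    (hξ0 : symplForm (X 0) ξ = 0) (hξ1 : symplForm (deriv X 0) ξ = 0)
    (hζ0 : symplForm (X 0) ζ = 0) (hζ1 : symplForm (deriv X 0) ζ = 0) :
    ∃ x y : ℝ, (x ≠ 0 ∨ y ≠ 0) ∧ ∀ N, ∃ P : ℝ → ℝ, ContDiff ℝ ∞ P ∧
      jacobiDefect X β k (x • ξ + y • ζ) P =O[𝓝 0] fun s : ℝ => s ^ N := by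
  have start : ∀ χ : PhaseSpace n, symplForm (X 0) χ = 0 → symplForm (deriv X 0) χ = 0 →
      ∃ P : ℝ → ℝ, ContDiff ℝ ∞ P ∧
        jacobiDefect X β k χ P =O[𝓝 0] fun s : ℝ => s ^ (0 + e) := fun χ h0 h1 =>
    ⟨fun _ => 0, contDiff_const,
      isBigO_pow_of_le le_rfl (by omega) (jacobiDefect_zero_isBigO hX β k h0 h1)⟩
  have finish : ∀ (N₀ : ℕ) (χ : PhaseSpace n), (∀ j, N₀ ≤ j → D j ≠ 0) →
      (∃ P : ℝ → ℝ, ContDiff ℝ ∞ P ∧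
        jacobiDefect X β k χ P =O[𝓝 0] fun s : ℝ => s ^ (N₀ + e)) →
      ∀ N, ∃ P : ℝ → ℝ, ContDiff ℝ ∞ P ∧
        jacobiDefect X β k χ P =O[𝓝 0] fun s : ℝ => s ^ N := by
    intro N₀ χ hD' h0 N
    obtain ⟨P, hP, hPO⟩ := exists_jacobiDefect_isBigO_of_ne_zero hX hβ hlead
      (le_max_left N₀ N) (fun j h _ => hD' j h) h0
    exact ⟨P, hP, isBigO_pow_of_le le_rfl (by have := le_max_right N₀ N; omega) hPO⟩
  by_cases hres : ∃ m, D m = 0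
  · obtain ⟨m, hm⟩ := hres
    have hne : ∀ j, j ≠ m → D j ≠ 0 := fun j hj h => hj (hD j m h hm)
    obtain ⟨P, hP, hPO⟩ := exists_jacobiDefect_isBigO_of_ne_zero hX hβ hlead (Nat.zero_le m)
      (fun j _ h => hne j h.ne) (start ξ hξ0 hξ1)
    obtain ⟨R, hR, hRO⟩ := exists_jacobiDefect_isBigO_of_ne_zero hX hβ hlead (Nat.zero_le m)
      (fun j _ h => hne j h.ne) (start ζ hζ0 hζ1)
    obtain ⟨c, hc⟩ := exists_coefficient_of_isBigO_pow (contDiff_jacobiDefect hX hβ k ξ hP) hPO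
    obtain ⟨d, hd⟩ := exists_coefficient_of_isBigO_pow (contDiff_jacobiDefect hX hβ k ζ hR) hRO
    obtain ⟨x, y, hxy, hzero⟩ : ∃ x y : ℝ, (x ≠ 0 ∨ y ≠ 0) ∧ x * c + y * d = 0 := by
      by_cases hc0 : c = 0
      · exact ⟨1, 0, Or.inl one_ne_zero, by simp [hc0]⟩
      · exact ⟨d, -c, Or.inr (neg_ne_zero.2 hc0), by ring⟩
    refine ⟨x, y, hxy, finish (m + 1) _ (fun j h => hne j (by omega))
      ⟨fun r => x * P r + y * R r, (contDiff_const.mul hP).add (contDiff_const.mul hR), ?_⟩⟩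
    rw [show m + 1 + e = m + e + 1 by omega]
    refine ((hc.const_mul_left x).add (hd.const_mul_left y)).congr_left fun s => ?_
    rw [jacobiDefect_add_smul hX.continuous β k hP.continuous hR.continuous, smul_eq_mul,
      smul_eq_mul]
    linear_combination -s ^ (m + e) * hzero
  · push Not at hres
    refine ⟨1, 0, Or.inl one_ne_zero, ?_⟩
    rw [one_smul, zero_smul, add_zero]
    exact finish 0 ξ (fun j _ => hres j) (start ξ hξ0 hξ1)

theorem exists_jacobiDefect_isBigO (hX : ContDiff ℝ ∞ X) (hβ : ContDiff ℝ ∞ β)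
    (he : e ≤ 2) (hD : ∀ j, D j ≠ 0)
    (hlead : ∀ j, (fun s => jacobiDefect X β k 0 (fun r => r ^ j) s - s ^ (j + e) * D j) =O[𝓝 0]
        fun s : ℝ => s ^ (j + e + 1)) {ξ : PhaseSpace n}
    (hξ0 : symplForm (X 0) ξ = 0) (hξ1 : symplForm (deriv X 0) ξ = 0) (N : ℕ) :
    ∃ P : ℝ → ℝ, ContDiff ℝ ∞ P ∧ jacobiDefect X β k ξ P =O[𝓝 0] fun s : ℝ => s ^ N := by
  obtain ⟨P, hP, hPO⟩ := exists_jacobiDefect_isBigO_of_ne_zero hX hβ hlead (Nat.zero_le N)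
    (fun j _ _ => hD j) ⟨fun _ => 0, contDiff_const,
      isBigO_pow_of_le le_rfl (by omega) (jacobiDefect_zero_isBigO hX β k hξ0 hξ1)⟩
  exact ⟨P, hP, isBigO_pow_of_le le_rfl (by omega) hPO⟩

end FormalSolution

/-! ### Positive extensions of germs and scalar energy inequalities -/

/-- A bump function blends f into the constant f(0). Only the germ at 0 matters, while global
positivity allows division and square roots without further restriction of the domain. -/
theorem ContDiff.exists_pos_eventuallyEq {f : ℝ → ℝ} (hf : ContDiff ℝ ∞ f) (h0 : 0 < f 0) :
    ∃ g : ℝ → ℝ, ContDiff ℝ ∞ g ∧ (∀ s, 0 < g s) ∧ g =ᶠ[𝓝 0] f := by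
  obtain ⟨r, hr, hball⟩ := Metric.eventually_nhds_iff_ball.1
    (hf.continuous.continuousAt.eventually (lt_mem_nhds h0))
  let χ : ContDiffBump (0 : ℝ) := ⟨r / 3, r / 2, by positivity, by linarith⟩
  refine ⟨fun s => χ s * f s + (1 - χ s) * f 0, ?_, fun s => ?_, ?_⟩
  · exact (χ.contDiff.mul hf).add ((contDiff_const.sub χ.contDiff).mul contDiff_const)
  · change 0 < χ s * f s + (1 - χ s) * f 0
    by_cases hs : s ∈ Metric.ball 0 r
    · have h1 := hball s hs
      have h2 := χ.nonneg' s
      have h3 := χ.le_one (x := s)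
      rcases h2.eq_or_lt with h | h
      · rw [← h]; simpa using h0
      · have : 0 < χ s * f s := mul_pos h h1
        have : 0 ≤ (1 - χ s) * f 0 := mul_nonneg (by linarith) h0.le
        linarith
    · have : χ s = 0 := χ.zero_of_le_dist (by
        have h1 : r ≤ Dist.dist s 0 := not_lt.1 hs
        have : χ.rOut = r / 2 := rfl
        linarith)
      rw [this]; simpa using h0
  · filter_upwards [χ.eventuallyEq_one] with x hx
    rw [hx]; simp

theorem mul_le_of_abs_le_mul {L w y t : ℝ} (ht : |t| ≤ L * y) :
    w * t ≤ L * ((w ^ 2 + y ^ 2) / 2) ∨ L < 0 := by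
  by_cases hL : L < 0
  · exact Or.inr hL
  left
  push Not at hL
  calc w * t ≤ |w| * |t| := (le_abs_self _).trans (abs_mul _ _).le
    _ ≤ |w| * (L * y) := by gcongr
    _ ≤ L * ((w ^ 2 + y ^ 2) / 2) := by
      have : |w| * y ≤ (w ^ 2 + y ^ 2) / 2 := by
        nlinarith [sq_nonneg (|w| - y), sq_abs w]
      nlinarith

theorem abs_mul_le_half_sq (x w : ℝ) : |x * w| ≤ (x ^ 2 + w ^ 2) / 2 := by
  rw [abs_mul]
  nlinarith [sq_nonneg (|x| - |w|), sq_abs x, sq_abs w]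

theorem mul_mul_le_half_sq {g K : ℝ} (hg : |g| ≤ K) (x w : ℝ) :
    g * (x * w) ≤ K * ((x ^ 2 + w ^ 2) / 2) :=
  (le_abs_self _).trans ((abs_mul _ _).le.trans
    (mul_le_mul hg (abs_mul_le_half_sq x w) (abs_nonneg _) ((abs_nonneg _).trans hg)))

/-- Here y is the norm of the vector part of the state, t its symplectic product with X'', and z, r
its inner products with Z₁, Z₃. All couplings, g included, are at most of size 1/s, so the term N/s
from the weight dominates. -/
theorem definite_energy_bound {L s x w y t z r c l g N : ℝ} (hs : 0 < s) (hs1 : s ≤ 1)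
    (hL : 1 ≤ L) (hl : |l| ≤ L / s) (hg : |g| ≤ L / s) (ht : |t| ≤ L * y) (hz : |z| ≤ L * y)
    (hr : |r| ≤ L * y) (hc : |c| ≤ L) (hN : 3 * L ^ 2 + 1 ≤ N) :
    l * x ^ 2 + g * (x * w) + w * t - c * w ^ 2 + t * z + w * r -
      N / s * (x ^ 2 + w ^ 2 + y ^ 2) ≤ -(1 / s) * (x ^ 2 + w ^ 2 + y ^ 2) := by
  have hL0 : 0 ≤ L := by linarith
  have h1 : l * x ^ 2 ≤ L / s * x ^ 2 := by gcongr; exact (le_abs_self _).trans hl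
  have h2 := mul_mul_le_half_sq hg x w
  have h3 := (mul_le_of_abs_le_mul (w := w) ht).resolve_right (by linarith)
  have h4 := (mul_le_of_abs_le_mul (w := w) hr).resolve_right (by linarith)
  have h5 : -(c * w ^ 2) ≤ L * w ^ 2 := by
    have : -c * w ^ 2 ≤ L * w ^ 2 := by gcongr; exact (neg_le_abs _).trans hc
    linarith
  have h6 : t * z ≤ L ^ 2 * y ^ 2 := by
    calc t * z ≤ |t| * |z| := (le_abs_self _).trans (abs_mul _ _).le
      _ ≤ (L * y) * (L * y) :=
        mul_le_mul ht hz (abs_nonneg _) ((abs_nonneg _).trans ht)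
      _ = _ := by ring
  have hinv : 1 ≤ s⁻¹ := (one_le_inv₀ hs).2 hs1
  have e1 : ∀ A : ℝ, 0 ≤ A → A ≤ s⁻¹ * A := fun A hA => le_mul_of_one_le_left hA hinv
  have b1 := e1 (L * ((w ^ 2 + y ^ 2) / 2)) (by positivity)
  have b2 := e1 (L * w ^ 2) (by positivity)
  have b3 := e1 (L ^ 2 * y ^ 2) (by positivity)
  have hLL : L ≤ L ^ 2 := by nlinarith
  have b4 : s⁻¹ * (L * (x ^ 2 + w ^ 2 + y ^ 2)) ≤ s⁻¹ * (L ^ 2 * (x ^ 2 + w ^ 2 + y ^ 2)) := by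
    gcongr
  have b5 : s⁻¹ * ((3 * L ^ 2 + 1) * (x ^ 2 + w ^ 2 + y ^ 2)) ≤
      s⁻¹ * (N * (x ^ 2 + w ^ 2 + y ^ 2)) := by gcongr
  have b6 : 0 ≤ s⁻¹ * (L ^ 2 * x ^ 2) := by positivity
  have b7 : 0 ≤ s⁻¹ * (L ^ 2 * w ^ 2) := by positivity
  have b8 : 0 ≤ s⁻¹ * (L ^ 2 * y ^ 2) := by positivity
  have b9 : 0 ≤ s⁻¹ * (L * x ^ 2) := by positivity
  have b10 : 0 ≤ s⁻¹ * (L * w ^ 2) := by positivity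
  have b11 : 0 ≤ s⁻¹ * (L * y ^ 2) := by positivity
  simp only [div_eq_mul_inv, one_mul] at *
  nlinarith

/-- For y² − 2xw the coupling h contributes −h(x² + w²), which is favourable. A large h therefore
helps: it pays for all other terms in x and w, including the term of the wrong sign that the weight
N/s puts on −2xw. -/
theorem hyperbolic_energy_bound {L s x w y t z r c l h N : ℝ} (hs : 0 < s) (hs1 : s ≤ 1)
    (hL : 1 ≤ L) (hl : |l| ≤ L / s) (ht : |t| ≤ L * y) (hz : |z| ≤ L * y)
    (hr : |r| ≤ L * y) (hc : |c| ≤ L) (hN : 3 * L ^ 2 + 1 ≤ N) (hh : (2 * L + N + 1) / s ≤ h) :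
    t * z + w * r - x * (h * x + t - c * w) - w * (l * x + h * w) -
      N / s * (y ^ 2 - 2 * (x * w)) ≤ -(1 / s) * (x ^ 2 + w ^ 2 + y ^ 2) := by
  have hL0 : 0 ≤ L := by linarith
  have h2 := mul_mul_le_half_sq (g := -l) (K := L / s) (by rwa [abs_neg]) x w
  have h3 := (mul_le_of_abs_le_mul (w := -x) ht).resolve_right (by linarith)
  have h4 := (mul_le_of_abs_le_mul (w := w) hr).resolve_right (by linarith)
  have h5 := mul_mul_le_half_sq hc x w
  have h6 : t * z ≤ L ^ 2 * y ^ 2 := by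
    calc t * z ≤ |t| * |z| := (le_abs_self _).trans (abs_mul _ _).le
      _ ≤ (L * y) * (L * y) :=
        mul_le_mul ht hz (abs_nonneg _) ((abs_nonneg _).trans ht)
      _ = _ := by ring
  have h7 : (2 * L + N + 1) / s * (x ^ 2 + w ^ 2) ≤ h * (x ^ 2 + w ^ 2) := by gcongr
  have hinv : 1 ≤ s⁻¹ := (one_le_inv₀ hs).2 hs1
  have e1 : ∀ A : ℝ, 0 ≤ A → A ≤ s⁻¹ * A := fun A hA => le_mul_of_one_le_left hA hinv
  have b1 := e1 (L * ((w ^ 2 + y ^ 2) / 2)) (by positivity)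
  have b2 := e1 (L * ((x ^ 2 + y ^ 2) / 2)) (by positivity)
  have b2' := e1 (L * ((x ^ 2 + w ^ 2) / 2)) (by positivity)
  have b3 := e1 (L ^ 2 * y ^ 2) (by positivity)
  have hLL : L ≤ L ^ 2 := by nlinarith
  have b4 : s⁻¹ * (L * y ^ 2) ≤ s⁻¹ * (L ^ 2 * y ^ 2) := by gcongr
  have b5 : s⁻¹ * ((3 * L ^ 2 + 1) * y ^ 2) ≤ s⁻¹ * (N * y ^ 2) := by gcongr
  have hN0 : 0 ≤ N := by nlinarith
  have b6 : s⁻¹ * (N * (2 * (x * w))) ≤ s⁻¹ * (N * (x ^ 2 + w ^ 2)) := by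
    gcongr
    nlinarith [sq_nonneg (x - w)]
  have b8 : 0 ≤ s⁻¹ * (L ^ 2 * y ^ 2) := by positivity
  have b9 : 0 ≤ s⁻¹ * (L * x ^ 2) := by positivity
  have b10 : 0 ≤ s⁻¹ * (L * w ^ 2) := by positivity
  have b11 : 0 ≤ s⁻¹ * (L * y ^ 2) := by positivity
  simp only [div_eq_mul_inv, one_mul] at *
  nlinarith

/-! ### The regularized Jacobi equation -/

section Existence

variable {n : ℕ}

/-- The field of the Jacobi equation with `b = -sᵏ β`, multiplied by `sᵏ`. -/
noncomputable def jacobiField (X : ℝ → PhaseSpace n) (β : ℝ → ℝ) (s : ℝ) :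
    PhaseSpace n →L[ℝ] PhaseSpace n :=
  (-(β s)⁻¹) • (symplBilin n (X s)).smulRight (X s)

theorem jacobiField_apply (X : ℝ → PhaseSpace n) (β : ℝ → ℝ) (s : ℝ) (η : PhaseSpace n) :
    jacobiField X β s η = (-(β s)⁻¹ * symplForm (X s) η) • X s := by
  simp [jacobiField, smul_smul]

theorem contDiff_jacobiField {X : ℝ → PhaseSpace n} {β : ℝ → ℝ} (hX : ContDiff ℝ ∞ X)
    (hβ : ContDiff ℝ ∞ β) (hβ0 : ∀ s, 0 < β s) : ContDiff ℝ ∞ (jacobiField X β) := by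
  refine contDiff_clm_apply_iff.2 fun η => ?_
  simp only [jacobiField_apply]
  exact (((hβ.inv fun s => (hβ0 s).ne').neg).mul (hX.symplForm contDiff_const)).smul hX

/-- The state space of the regularized Jacobi equation. -/
abbrev RegState (n : ℕ) : Type := ℝ × ℝ × PhaseSpace n

/-- The coefficients of the regularized Jacobi equation. -/
noncomputable def regMatrix (l h c ς : ℝ) (X₂ Z₁ Z₃ : PhaseSpace n) :
    RegState n →L[ℝ] RegState n :=
  let p₁ := ContinuousLinearMap.fst ℝ ℝ (ℝ × PhaseSpace n)
  let p₂ := (ContinuousLinearMap.fst ℝ ℝ (PhaseSpace n)).comp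
    (ContinuousLinearMap.snd ℝ ℝ (ℝ × PhaseSpace n))
  let p₃ := (ContinuousLinearMap.snd ℝ ℝ (PhaseSpace n)).comp
    (ContinuousLinearMap.snd ℝ ℝ (ℝ × PhaseSpace n))
  (l • p₁ + h • p₂).prod (((ς * h) • p₁ + (symplBilin n X₂).comp p₃ - c • p₂).prod
    (((symplBilin n X₂).comp p₃).smulRight Z₁ + p₂.smulRight Z₃))

theorem regMatrix_apply (l h c ς : ℝ) (X₂ Z₁ Z₃ : PhaseSpace n) (x w : ℝ) (Y : PhaseSpace n) :
    regMatrix l h c ς X₂ Z₁ Z₃ (x, w, Y) =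
      (l * x + h * w, ς * h * x + symplForm X₂ Y - c * w, symplForm X₂ Y • Z₁ + w • Z₃) := by
  simp [regMatrix]

theorem norm_regMatrix_le {l h c ς L K : ℝ} {X₂ Z₁ Z₃ : PhaseSpace n} (hς : |ς| ≤ 1)
    (hL : 1 ≤ L) (hK : 1 ≤ K)
    (hl : |l| ≤ L * K) (hh : |h| ≤ L * K) (hc : |c| ≤ L) (hX₂ : ∀ Y, |symplForm X₂ Y| ≤ L * ‖Y‖)
    (hZ₁ : ‖Z₁‖ ≤ L) (hZ₃ : ‖Z₃‖ ≤ L) :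
    ‖regMatrix l h c ς X₂ Z₁ Z₃‖ ≤ 3 * L ^ 2 * K := by
  refine ContinuousLinearMap.opNorm_le_bound _ (by positivity) ?_
  rintro ⟨x, w, Y⟩
  set m := ‖((x, w, Y) : RegState n)‖ with hm
  have hm0 : 0 ≤ m := norm_nonneg _
  have hx : |x| ≤ m := le_max_left _ _
  have hw : |w| ≤ m := (le_max_left _ _).trans (le_max_right _ _)
  have hY : ‖Y‖ ≤ m := (le_max_right _ _).trans (le_max_right _ _)
  have ht : |symplForm X₂ Y| ≤ L * m := (hX₂ Y).trans (by gcongr)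
  have hLK : L ≤ L * K := le_mul_of_one_le_right (by linarith) hK
  have hLL : L * K ≤ L ^ 2 * K := by gcongr; nlinarith
  have hLL' : L ^ 2 ≤ L ^ 2 * K := le_mul_of_one_le_right (by positivity) hK
  have a1 : |l * x| ≤ L ^ 2 * K * m := by
    rw [abs_mul]; exact mul_le_mul (hl.trans hLL) hx (abs_nonneg _) (by positivity)
  have a2 : |h * w| ≤ L ^ 2 * K * m := by
    rw [abs_mul]; exact mul_le_mul (hh.trans hLL) hw (abs_nonneg _) (by positivity)
  have a3 : |ς * h * x| ≤ L ^ 2 * K * m := by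
    rw [abs_mul, abs_mul]
    refine mul_le_mul ?_ hx (abs_nonneg _) (by positivity)
    exact (mul_le_of_le_one_left (abs_nonneg _) hς).trans (hh.trans hLL)
  have a4 : |symplForm X₂ Y| ≤ L ^ 2 * K * m :=
    ht.trans (by gcongr; exact hLK.trans hLL)
  have a5 : |c * w| ≤ L ^ 2 * K * m := by
    rw [abs_mul]; exact mul_le_mul (hc.trans (hLK.trans hLL)) hw (abs_nonneg _) (by positivity)
  have a6 : ‖symplForm X₂ Y • Z₁‖ ≤ L ^ 2 * K * m := by
    rw [norm_smul, Real.norm_eq_abs]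
    calc _ ≤ (L * m) * L := mul_le_mul ht hZ₁ (norm_nonneg _) (by positivity)
      _ = L ^ 2 * m := by ring
      _ ≤ _ := by gcongr
  have a7 : ‖w • Z₃‖ ≤ L ^ 2 * K * m := by
    rw [norm_smul, Real.norm_eq_abs]
    calc _ ≤ m * L := mul_le_mul hw hZ₃ (norm_nonneg _) (by positivity)
      _ = L * m := by ring
      _ ≤ _ := by gcongr; exact hLK.trans hLL
  have hpos : 0 ≤ L ^ 2 * K * m := by positivity
  rw [regMatrix_apply]
  refine max_le ?_ (max_le ?_ ?_)
  · refine (abs_add_le _ _).trans (by linarith)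
  · refine (abs_sub _ _).trans ((add_le_add (abs_add_le _ _) le_rfl).trans (by linarith))
  · refine (norm_add_le _ _).trans (by linarith)

/-- The positive definite energy on the states of the regularized Jacobi equation. -/
noncomputable def regEnergy (n : ℕ) : RegState n →L[ℝ] RegState n →L[ℝ] ℝ :=
  let p₁ := ContinuousLinearMap.fst ℝ ℝ (ℝ × PhaseSpace n)
  let p₂ := (ContinuousLinearMap.fst ℝ ℝ (PhaseSpace n)).comp
    (ContinuousLinearMap.snd ℝ ℝ (ℝ × PhaseSpace n))
  let p₃ := (ContinuousLinearMap.snd ℝ ℝ (PhaseSpace n)).comp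
    (ContinuousLinearMap.snd ℝ ℝ (ℝ × PhaseSpace n))
  (ContinuousLinearMap.mul ℝ ℝ).bilinearComp p₁ p₁ +
    (ContinuousLinearMap.mul ℝ ℝ).bilinearComp p₂ p₂ +
    (isBoundedBilinearMap_inner (𝕜 := ℝ) (E := PhaseSpace n)).toContinuousLinearMap.bilinearComp
      p₃ p₃

/-- The energy of signature `(+, -)` in the hyperbolic plane of the regularized Jacobi equation. -/
noncomputable def regHypEnergy (n : ℕ) : RegState n →L[ℝ] RegState n →L[ℝ] ℝ :=
  let p₁ := ContinuousLinearMap.fst ℝ ℝ (ℝ × PhaseSpace n)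
  let p₂ := (ContinuousLinearMap.fst ℝ ℝ (PhaseSpace n)).comp
    (ContinuousLinearMap.snd ℝ ℝ (ℝ × PhaseSpace n))
  let p₃ := (ContinuousLinearMap.snd ℝ ℝ (PhaseSpace n)).comp
    (ContinuousLinearMap.snd ℝ ℝ (ℝ × PhaseSpace n))
  (isBoundedBilinearMap_inner (𝕜 := ℝ) (E := PhaseSpace n)).toContinuousLinearMap.bilinearComp
      p₃ p₃ - (ContinuousLinearMap.mul ℝ ℝ).bilinearComp p₁ p₂ -
    (ContinuousLinearMap.mul ℝ ℝ).bilinearComp p₂ p₁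

theorem regEnergy_apply (x w x' w' : ℝ) (Y Y' : PhaseSpace n) :
    regEnergy n (x, w, Y) (x', w', Y') = x * x' + w * w' + inner ℝ Y Y' := by
  simp [regEnergy]

theorem regHypEnergy_apply (x w x' w' : ℝ) (Y Y' : PhaseSpace n) :
    regHypEnergy n (x, w, Y) (x', w', Y') = inner ℝ Y Y' - x * w' - w * x' := by
  simp [regHypEnergy]

theorem norm_sq_le_regEnergy (u : RegState n) : ‖u‖ ^ 2 ≤ regEnergy n u u := by
  obtain ⟨x, w, Y⟩ := u
  rw [regEnergy_apply, real_inner_self_eq_norm_sq]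
  have : ‖((x, w, Y) : RegState n)‖ = max |x| (max |w| ‖Y‖) := rfl
  rw [this]
  have h1 := sq_abs x
  have h2 := sq_abs w
  rcases max_choice |x| (max |w| ‖Y‖) with h | h
  · rw [h]; nlinarith
  · rw [h]
    rcases max_choice |w| ‖Y‖ with h | h
    · rw [h]; nlinarith
    · rw [h]; nlinarith

/-- The reflection that exchanges the expanding and the contracting direction. -/
noncomputable def regReflection (n : ℕ) : RegState n →ₗ[ℝ] RegState n where
  toFun u := (-u.2.1, -u.1, u.2.2)
  map_add' u v := by ext <;> simp <;> ring
  map_smul' c u := by ext <;> simp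

set_option maxHeartbeats 1000000 in
/-- The regularized Jacobi equation has a solution of arbitrarily high order at `0+`, provided its
inhomogeneous term has a high enough order. -/
theorem exists_regularized_solution {γ c : ℝ → ℝ} {X₂ Z₁ Z₃ : ℝ → PhaseSpace n} {l h : ℝ → ℝ}
    {σ : ℝ} {k : ℕ} (hk : 1 ≤ k) (hσ : σ = 1 ∨ σ = -1) (hγc : Continuous γ) (hγ0 : ∀ s, 0 < γ s)
    {γ' : ℝ → ℝ} (hγ'c : Continuous γ')
    (hcc : Continuous c) (hX₂ : Continuous X₂) (hZ₁ : Continuous Z₁) (hZ₃ : Continuous Z₃)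
    (hl : ∀ s, l s = (γ' s / γ s - k / s) / 2)
    (hh : ∀ s, h s = Real.sqrt (γ s * (s ^ k)⁻¹)) :
    ∃ M₀ : ℕ, ∀ M, M₀ ≤ M → ∀ F : ℝ → ℝ, ContinuousOn F (Ioi 0) →
      F =O[𝓝[>] 0] (fun s : ℝ => s ^ (M + 2 * k)) →
      ∃ u : ℝ → RegState n,
        (∀ s, 0 < s → HasDerivAt u (regMatrix (l s) (h s) (c s) σ (X₂ s) (Z₁ s) (Z₃ s) (u s) +
          (0, σ * (γ s * (s ^ k)⁻¹) * F s, 0)) s) ∧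
        u =O[𝓝[>] 0] fun s : ℝ => s ^ M := by
  have hbd : ∀ {G : Type} [NormedAddCommGroup G] (f : ℝ → G), Continuous f →
      ∃ K : ℝ, 0 ≤ K ∧ ∀ s ∈ Icc (0 : ℝ) 1, ‖f s‖ ≤ K := by
    intro G _ f hf
    obtain ⟨K, hK⟩ := (isCompact_Icc (a := (0 : ℝ)) (b := 1)).exists_bound_of_continuousOn
      hf.continuousOn
    exact ⟨K, (norm_nonneg _).trans (hK 0 (by simp)), hK⟩
  obtain ⟨K₁, hK₁0, hK₁⟩ := hbd γ hγc
  obtain ⟨K₂, hK₂0, hK₂⟩ := hbd (fun s => (γ s)⁻¹) (hγc.inv₀ fun s => (hγ0 s).ne')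
  obtain ⟨K₃, hK₃0, hK₃⟩ := hbd (fun s => γ' s / γ s) (hγ'c.div hγc fun s => (hγ0 s).ne')
  obtain ⟨K₄, hK₄0, hK₄⟩ := hbd c hcc
  obtain ⟨K₅, hK₅0, hK₅⟩ := hbd (fun s => symplBilin n (X₂ s)) ((symplBilin n).continuous.comp hX₂)
  obtain ⟨K₆, hK₆0, hK₆⟩ := hbd Z₁ hZ₁
  obtain ⟨K₇, hK₇0, hK₇⟩ := hbd Z₃ hZ₃
  -- One constant dominating all coefficients on (0, 1]; the factor 2 covers |1 + σ| ≤ 2 in the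
  -- coupling.
  set L : ℝ := 2 * (1 + K₁ + K₂ + K₃ + k + K₄ + K₅ + K₆ + K₇ + K₅ * K₆ + 1) with hL
  clear_value L
  have hk0 : (0 : ℝ) ≤ k := Nat.cast_nonneg k
  have hK56 : 0 ≤ K₅ * K₆ := mul_nonneg hK₅0 hK₆0
  have hL1 : 1 ≤ L := by rw [hL]; linarith
  have hpos : ∀ {s : ℝ}, s ∈ Ioc (0 : ℝ) 1 → s ∈ Icc (0 : ℝ) 1 := fun hs => ⟨hs.1.le, hs.2⟩
  have hsk : ∀ {s : ℝ}, s ∈ Ioc (0 : ℝ) 1 → 1 ≤ (s ^ k)⁻¹ := fun {s} hs =>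
    (one_le_inv₀ (pow_pos hs.1 k)).2 (pow_le_one₀ hs.1.le hs.2)
  have hinv_le : ∀ {s : ℝ}, s ∈ Ioc (0 : ℝ) 1 → s⁻¹ ≤ (s ^ k)⁻¹ := fun {s} hs =>
    inv_anti₀ (pow_pos hs.1 k) (by simpa using pow_le_pow_of_le_one hs.1.le hs.2 hk)
  have hlb : ∀ s ∈ Ioc (0 : ℝ) 1, |l s| ≤ L / s := by
    intro s hs
    have h0 := hs.1
    have h1 := hK₃ s (hpos hs)
    have hi : 1 ≤ s⁻¹ := (one_le_inv₀ h0).2 hs.2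
    rw [Real.norm_eq_abs] at h1
    rw [hl, abs_div, abs_two, div_eq_mul_inv L]
    have h2 : |γ' s / γ s - k / s| ≤ K₃ + k * s⁻¹ := by
      refine (abs_sub _ _).trans (add_le_add h1 ?_)
      rw [abs_of_nonneg (by positivity), div_eq_mul_inv]
    have h3 : K₃ ≤ K₃ * s⁻¹ := le_mul_of_one_le_right hK₃0 hi
    have h4 : (K₃ + k) * s⁻¹ ≤ L * s⁻¹ := by
      gcongr; rw [hL]; linarith
    have h5 : |γ' s / γ s - k / s| / 2 ≤ |γ' s / γ s - k / s| := half_le_self (abs_nonneg _)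
    linarith
  have hh0 : ∀ s, 0 ≤ h s := fun s => by rw [hh]; exact Real.sqrt_nonneg _
  have hhsq : ∀ s, 0 < s → h s ^ 2 = γ s * (s ^ k)⁻¹ := fun s hs => by
    rw [hh, Real.sq_sqrt]
    have := hγ0 s
    positivity
  have hhb : ∀ s ∈ Ioc (0 : ℝ) 1, |h s| ≤ L * (s ^ k)⁻¹ := by
    intro s hs
    have h1 := hK₁ s (hpos hs)
    rw [Real.norm_of_nonneg (hγ0 s).le] at h1
    have h2 := hhsq s hs.1
    have h3 := hsk hs
    rw [abs_of_nonneg (hh0 s)]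
    have h4 : γ s * (s ^ k)⁻¹ ≤ K₁ * (s ^ k)⁻¹ := by gcongr
    have h5 : h s ≤ 1 + h s ^ 2 := by nlinarith [sq_nonneg (h s - 1)]
    have h6 : (1 + K₁) * (s ^ k)⁻¹ ≤ L * (s ^ k)⁻¹ := by
      gcongr; rw [hL]; linarith
    nlinarith
  have hcb : ∀ s ∈ Ioc (0 : ℝ) 1, |c s| ≤ L := fun s hs =>
    (hK₄ s (hpos hs)).trans (by rw [hL]; linarith)
  have htb : ∀ s ∈ Ioc (0 : ℝ) 1, ∀ Y, |symplForm (X₂ s) Y| ≤ L * ‖Y‖ := fun s hs Y => by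
    refine ((symplBilin n (X₂ s)).le_opNorm Y).trans ?_
    gcongr
    exact (hK₅ s (hpos hs)).trans (by rw [hL]; linarith)
  have hZ₁b : ∀ s ∈ Ioc (0 : ℝ) 1, ‖Z₁ s‖ ≤ L := fun s hs =>
    (hK₆ s (hpos hs)).trans (by rw [hL]; linarith)
  have hZ₃b : ∀ s ∈ Ioc (0 : ℝ) 1, ‖Z₃ s‖ ≤ L := fun s hs =>
    (hK₇ s (hpos hs)).trans (by rw [hL]; linarith)
  have hin : ∀ {Z Y : PhaseSpace n}, ‖Z‖ ≤ L → |inner ℝ Y Z| ≤ L * ‖Y‖ := fun {Z Y} hZ =>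
    (abs_real_inner_le_norm Y Z).trans (by rw [mul_comm]; gcongr)
  have hA : ContinuousOn
      (fun s => regMatrix (l s) (h s) (c s) σ (X₂ s) (Z₁ s) (Z₃ s)) (Ioi 0) := by
    refine continuousOn_clm_apply.2 ?_
    rintro ⟨x, w, Y⟩
    simp only [regMatrix_apply]
    have hlc : ContinuousOn l (Ioi 0) := by
      rw [funext hl]
      refine (((hγ'c.div hγc fun s => (hγ0 s).ne').continuousOn).sub
        (continuousOn_const.div continuousOn_id fun s hs => ne_of_gt hs)).div_const 2
    have hhc : ContinuousOn h (Ioi 0) := by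
      rw [funext hh]
      exact (hγc.continuousOn.mul ((continuousOn_pow k).inv₀ fun s hs =>
        pow_ne_zero _ (ne_of_gt hs))).sqrt
    have hsc : Continuous fun s => symplForm (X₂ s) Y := hX₂.symplForm continuous_const
    exact ((hlc.mul continuousOn_const).add (hhc.mul continuousOn_const)).prodMk
      ((((continuousOn_const.mul hhc).mul continuousOn_const).add hsc.continuousOn).sub
        (hcc.continuousOn.mul continuousOn_const) |>.prodMk
        ((hsc.smul hZ₁).add (hZ₃.const_smul w)).continuousOn)
  obtain ⟨M₀, hM₀⟩ := exists_nat_ge (3 * L ^ 2 + 1)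
  refine ⟨M₀, fun M hM F hF hFO => ?_⟩
  have hMk : 3 * L ^ 2 + 1 ≤ ((M + k : ℕ) : ℝ) :=
    hM₀.trans (by exact_mod_cast hM.trans (Nat.le_add_right M k))
  obtain ⟨CF, hCF0, hCF⟩ := hFO.exists_pos
  obtain ⟨δF, hδF, hFδ⟩ := mem_nhdsGT_iff_exists_Ioc_subset.1 hCF.bound
  have hforce : ContinuousOn
      (fun s => ((0, σ * (γ s * (s ^ k)⁻¹) * F s, 0) : RegState n)) (Ioi 0) := by
    refine continuousOn_const.prodMk ((((continuousOn_const.mul (hγc.continuousOn.mul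
      ((continuousOn_pow k).inv₀ fun s hs => pow_ne_zero _ (ne_of_gt hs)))).mul hF)).prodMk
      continuousOn_const)
  have hσ1 : |σ| ≤ 1 := by rcases hσ with rfl | rfl <;> simp
  set C : ℝ := 3 * L ^ 2 + L * CF with hC
  have hC0 : 0 ≤ C := by positivity
  clear_value C
  have hAk : ∀ s ∈ Ioc (0 : ℝ) 1, ‖regMatrix (l s) (h s) (c s) σ (X₂ s) (Z₁ s) (Z₃ s)‖ ≤
      C * (s ^ k)⁻¹ := by
    intro s hs
    refine (norm_regMatrix_le hσ1 hL1 (hsk hs) ((hlb s hs).trans ?_) (hhb s hs) (hcb s hs)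
      (htb s hs) (hZ₁b s hs) (hZ₃b s hs)).trans ?_
    · rw [div_eq_mul_inv]
      exact mul_le_mul_of_nonneg_left (hinv_le hs) (by linarith)
    · have := (zero_le_one.trans (hsk hs))
      gcongr
      rw [hC]
      have : 0 ≤ L * CF := by positivity
      linarith
  -- Of the order M + 2k of F, the factor s^{-k} in the forcing leaves M + k, which is what the
  -- energy argument asks for.
  have hfN : ∀ s ∈ Ioc (0 : ℝ) (min 1 δF),
      ‖((0, σ * (γ s * (s ^ k)⁻¹) * F s, 0) : RegState n)‖ ≤ C * s ^ (M + k) := by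
    intro s hs
    have hs1 : s ∈ Ioc (0 : ℝ) 1 := ⟨hs.1, hs.2.trans (min_le_left _ _)⟩
    have h0 := hs.1
    have h1 : |F s| ≤ CF * s ^ (M + 2 * k) := by
      have := hFδ ⟨hs.1, hs.2.trans (min_le_right _ _)⟩
      simp only [mem_ofPred_eq, norm_pow, Real.norm_eq_abs, abs_of_pos h0] at this
      exact this
    have h2 := hK₁ s (hpos hs1)
    rw [Real.norm_of_nonneg (hγ0 s).le] at h2
    have h3 : |σ * (γ s * (s ^ k)⁻¹) * F s| ≤ C * s ^ (M + k) := by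
      rw [abs_mul, abs_mul, abs_of_pos (mul_pos (hγ0 s) (by positivity))]
      calc |σ| * (γ s * (s ^ k)⁻¹) * |F s| ≤ 1 * (L * (s ^ k)⁻¹) * (CF * s ^ (M + 2 * k)) := by
            have := (hγ0 s).le
            gcongr
            exact h2.trans (by rw [hL]; linarith)
        _ = L * CF * s ^ (M + k) := by
            rw [show M + 2 * k = (M + k) + k by ring, pow_add s (M + k) k]
            field_simp
        _ ≤ _ := by
            gcongr
            rw [hC]
            have : 0 ≤ 3 * L ^ 2 := by positivity
            linarith
    rw [Prod.norm_def, Prod.norm_def]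
    simp only [norm_zero, Real.norm_eq_abs]
    refine max_le (by positivity) (max_le h3 (by positivity))
  have hQsymm : ∀ u v, regEnergy n u v = regEnergy n v u := by
    rintro ⟨x, w, Y⟩ ⟨x', w', Y'⟩
    rw [regEnergy_apply, regEnergy_apply, real_inner_comm]
    ring
  have hdone : ∀ {δ : ℝ}, 0 < δ → (∃ (u : ℝ → RegState n) (C' : ℝ),
      (∀ s, 0 < s → HasDerivAt u (regMatrix (l s) (h s) (c s) σ (X₂ s) (Z₁ s) (Z₃ s) (u s) +
          (0, σ * (γ s * (s ^ k)⁻¹) * F s, 0)) s) ∧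
      ∀ s ∈ Ioc 0 δ, ‖u s‖ ≤ C' * s ^ M) → ∃ u : ℝ → RegState n,
        (∀ s, 0 < s → HasDerivAt u (regMatrix (l s) (h s) (c s) σ (X₂ s) (Z₁ s) (Z₃ s) (u s) +
          (0, σ * (γ s * (s ^ k)⁻¹) * F s, 0)) s) ∧
        u =O[𝓝[>] 0] fun s : ℝ => s ^ M := by
    rintro δ hδ ⟨u, C', hu, hb⟩
    refine ⟨u, hu, Asymptotics.IsBigO.of_bound C' ?_⟩
    filter_upwards [Ioc_mem_nhdsGT hδ] with s hs
    rw [norm_pow, Real.norm_of_nonneg hs.1.le]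
    exact hb s hs
  -- The coupling enters the definite energy as (1 + σ) h. It vanishes for σ = −1 and is O(1/s) for
  -- k ≤ 2, since h² is of order s^{-k}. In the remaining case σ = 1, k ≥ 3 the coupling beats every
  -- multiple of 1/s and the hyperbolic energy is used.
  by_cases hcase : σ = -1 ∨ k ≤ 2
  · have hδ : 0 < min 1 δF := lt_min one_pos hδF
    -- With the identity as reflection the −1 eigenspace is zero: the approximating solutions start
    -- from 0 at ε and are free at δ.
    refine hdone hδ (exists_decaying_solution hA hforce (regEnergy n) (regEnergy n) hQsymm hQsymm
      norm_sq_le_regEnergy LinearMap.id (fun _ => rfl)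
      (fun u _ => (sq_nonneg _).trans (norm_sq_le_regEnergy u)) (fun u hu => ?_) hδ
      (min_le_left _ _) hC0 (M := M) (k := k) ?_ (fun s hs => hAk s ⟨hs.1, hs.2.trans (min_le_left _ _)⟩)
      hfN)
    · have h2 : (2 : ℝ) • u = 0 := by
        rw [two_smul]; nth_rewrite 2 [show u = -u from hu]; exact add_neg_cancel u
      have : u = 0 := (smul_eq_zero.1 h2).resolve_left two_ne_zero
      simp [this]
    · rintro s hs u
      have hs1 : s ∈ Ioc (0 : ℝ) 1 := ⟨hs.1, hs.2.trans (min_le_left _ _)⟩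
      have h0 := hs.1
      have hg : |(1 + σ) * h s| ≤ L / s := by
        rcases hcase with rfl | hk2
        · simp; positivity
        · have h1 : h s ^ 2 ≤ (1 + K₁) ^ 2 / s ^ 2 := by
            rw [hhsq s h0, div_eq_mul_inv]
            have h2 := hK₁ s (hpos hs1)
            rw [Real.norm_of_nonneg (hγ0 s).le] at h2
            have h3 : (s ^ k)⁻¹ ≤ (s ^ 2)⁻¹ :=
              inv_anti₀ (by positivity) (pow_le_pow_of_le_one h0.le hs1.2 hk2)
            refine mul_le_mul (h2.trans (by nlinarith)) h3 (by positivity) (by positivity)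
          rw [← div_pow] at h1
          have h2 : h s ≤ (1 + K₁) / s := le_of_sq_le_sq h1 (by positivity)
          have h3 : |1 + σ| ≤ 2 := by rcases hσ with rfl | rfl <;> norm_num
          rw [abs_mul, abs_of_nonneg (hh0 s)]
          calc |1 + σ| * h s ≤ 2 * ((1 + K₁) / s) := mul_le_mul h3 h2 (hh0 s) (by norm_num)
            _ = (2 * (1 + K₁)) / s := by ring
            _ ≤ L / s := by gcongr; rw [hL]; linarith
      have hu := norm_sq_le_regEnergy u
      obtain ⟨x, w, Y⟩ := u
      have hmain := definite_energy_bound (s := s) (x := x) (w := w) (y := ‖Y‖)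
        (t := symplForm (X₂ s) Y) (z := inner ℝ Y (Z₁ s)) (r := inner ℝ Y (Z₃ s)) (c := c s)
        (l := l s) (g := (1 + σ) * h s) (N := (M + k : ℕ)) h0 hs1.2 hL1 (hlb s hs1) hg (htb s hs1 Y)
        (hin (hZ₁b s hs1)) (hin (hZ₃b s hs1)) (hcb s hs1) hMk
      rw [regEnergy_apply, real_inner_self_eq_norm_sq] at hu
      have hu' : -(1 / s) * (x ^ 2 + w ^ 2 + ‖Y‖ ^ 2) ≤ -(1 / s) * ‖((x, w, Y) : RegState n)‖ ^ 2 := by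
        have : 0 ≤ 1 / s := by positivity
        nlinarith
      refine le_trans (le_of_eq ?_) (hmain.trans hu')
      rw [regMatrix_apply, regEnergy_apply, regEnergy_apply, inner_add_right, inner_smul_right,
        inner_smul_right, real_inner_self_eq_norm_sq]
      ring
  · push Not at hcase
    obtain ⟨hσ', hk3⟩ := hcase
    have hσ1 : σ = 1 := hσ.resolve_right hσ'
    set T : ℝ := 2 * L + (M + k : ℕ) + 1 with hT
    have hT0 : 0 < T := by positivity
    clear_value T
    -- For s ≤ 1/(T² L) and k ≥ 3 one has h² = γ s^{-k} ≥ L⁻¹ s⁻³ ≥ (T/s)², the size of coupling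
    -- that the hyperbolic estimate needs.
    set δ : ℝ := min (min 1 δF) ((T ^ 2 * L)⁻¹) with hδdef
    have hδ : 0 < δ := lt_min (lt_min one_pos hδF) (by positivity)
    have hδle : δ ≤ min 1 δF := min_le_left _ _
    have hδT : δ ≤ (T ^ 2 * L)⁻¹ := min_le_right _ _
    clear_value δ
    have hB : ∀ u v, regHypEnergy n u v = regHypEnergy n v u := by
      rintro ⟨x, w, Y⟩ ⟨x', w', Y'⟩
      rw [regHypEnergy_apply, regHypEnergy_apply, real_inner_comm]
      ring
    refine hdone hδ (exists_decaying_solution hA hforce (regHypEnergy n) (regEnergy n) hB hQsymm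
      norm_sq_le_regEnergy (regReflection n) (fun u => by simp [regReflection])
      (fun u hu => ?_) (fun u hu => ?_) hδ
      (hδle.trans (min_le_left _ _)) hC0 (M := M) (k := k) ?_
      (fun s hs => hAk s ⟨hs.1, hs.2.trans (hδle.trans (min_le_left _ _))⟩)
      fun s hs => hfN s ⟨hs.1, hs.2.trans hδle⟩)
    · obtain ⟨x, w, Y⟩ := u
      simp only [regReflection, LinearMap.coe_mk, AddHom.coe_mk, Prod.mk.injEq] at hu
      rw [regHypEnergy_apply, real_inner_self_eq_norm_sq]
      rw [← hu.1]
      nlinarith [sq_nonneg ‖Y‖, sq_nonneg w]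
    · obtain ⟨x, w, Y⟩ := u
      simp only [regReflection, LinearMap.coe_mk, AddHom.coe_mk, Prod.neg_mk, Prod.mk.injEq,
        neg_inj] at hu
      have hY : Y = 0 := by
        have h2 : (2 : ℝ) • Y = 0 := by
          rw [two_smul]; nth_rewrite 2 [hu.2.2]; exact add_neg_cancel Y
        exact (smul_eq_zero.1 h2).resolve_left two_ne_zero
      have h1 := norm_sq_le_regEnergy ((x, w, Y) : RegState n)
      rw [regEnergy_apply] at h1
      rw [regHypEnergy_apply]
      have hw : w = x := hu.1
      subst hw
      rw [hY, inner_zero_left] at *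
      linarith
    · rintro s hs u
      have hs1 : s ∈ Ioc (0 : ℝ) 1 := ⟨hs.1, hs.2.trans (hδle.trans (min_le_left _ _))⟩
      have h0 := hs.1
      have hh' : T / s ≤ h s := by
        refine le_of_sq_le_sq ?_ (hh0 s)
        rw [hhsq s h0, div_pow]
        have h2 := hK₂ s (hpos hs1)
        rw [norm_inv, Real.norm_of_nonneg (hγ0 s).le] at h2
        have h3 : L⁻¹ ≤ γ s := inv_le_of_inv_le₀ (hγ0 s) (h2.trans (by rw [hL]; linarith))
        have h4 : (s ^ 3)⁻¹ ≤ (s ^ k)⁻¹ :=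
          inv_anti₀ (by positivity) (pow_le_pow_of_le_one h0.le hs1.2 (by omega))
        have h5 : s ≤ (T ^ 2 * L)⁻¹ := hs.2.trans hδT
        calc T ^ 2 / s ^ 2 ≤ L⁻¹ * (s ^ 3)⁻¹ := by
              have h6 : s * (T ^ 2 * L) ≤ 1 := by
                rwa [← one_div, le_div_iff₀ (by positivity)] at h5
              rw [div_le_iff₀ (by positivity), ← mul_inv, inv_mul_eq_div, le_div_iff₀ (by positivity)]
              nlinarith [pow_pos h0 2]
          _ ≤ γ s * (s ^ k)⁻¹ := mul_le_mul h3 h4 (by positivity) (hγ0 s).le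
      have hu := norm_sq_le_regEnergy u
      obtain ⟨x, w, Y⟩ := u
      have hmain := hyperbolic_energy_bound (s := s) (x := x) (w := w) (y := ‖Y‖)
        (t := symplForm (X₂ s) Y) (z := inner ℝ Y (Z₁ s)) (r := inner ℝ Y (Z₃ s)) (c := c s)
        (l := l s) (h := h s) (N := (M + k : ℕ)) h0 hs1.2 hL1 (hlb s hs1) (htb s hs1 Y)
        (hin (hZ₁b s hs1)) (hin (hZ₃b s hs1)) (hcb s hs1) hMk (hT ▸ hh')
      rw [regEnergy_apply, real_inner_self_eq_norm_sq] at hu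
      have hu' : -(1 / s) * (x ^ 2 + w ^ 2 + ‖Y‖ ^ 2) ≤ -(1 / s) * ‖((x, w, Y) : RegState n)‖ ^ 2 := by
        have : 0 ≤ 1 / s := by positivity
        nlinarith
      refine le_trans (le_of_eq ?_) (hmain.trans hu')
      rw [regMatrix_apply, regHypEnergy_apply, regHypEnergy_apply, inner_add_right,
        inner_smul_right, inner_smul_right, real_inner_self_eq_norm_sq, hσ1]
      ring

end Existence

theorem eq_zero_of_hasDerivAt_zero_of_tendsto {f : ℝ → ℝ} {δ : ℝ}
    (hf : ∀ s ∈ Ioo 0 δ, HasDerivAt f 0 s) (h0 : Tendsto f (𝓝[>] 0) (𝓝 0)) :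
    ∀ s ∈ Ioo 0 δ, f s = 0 := by
  intro s hs
  have hc : ∀ r ∈ Ioo 0 δ, f r = f s := fun r hr =>
    isOpen_Ioo.is_const_of_deriv_eq_zero isPreconnected_Ioo
      (fun x hx => (hf x hx).differentiableAt.differentiableWithinAt) (fun x hx => (hf x hx).deriv)
      hr hs
  have h1 : Tendsto f (𝓝[>] 0) (𝓝 (f s)) := by
    refine tendsto_const_nhds.congr' ?_
    filter_upwards [Ioo_mem_nhdsGT (hs.1.trans hs.2)] with r hr
    exact (hc r hr).symm
  exact tendsto_nhds_unique h1 h0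

theorem tendsto_zero_of_isBigO_pow {F : Type*} [NormedAddCommGroup F] {f : ℝ → F} {M : ℕ}
    (hM : 1 ≤ M) (hf : f =O[𝓝[>] 0] fun s : ℝ => s ^ M) : Tendsto f (𝓝[>] 0) (𝓝 0) := by
  refine hf.trans_tendsto (Tendsto.mono_left ?_ nhdsWithin_le_nhds)
  simpa [zero_pow (Nat.one_le_iff_ne_zero.1 hM)] using (continuous_pow M).tendsto (0 : ℝ)

/-! ### From approximate to exact solutions -/

section ExactSolution

variable {n : ℕ} {X : ℝ → PhaseSpace n} {β : ℝ → ℝ} {k : ℕ}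

theorem continuousOn_singular_field {E : Type*} [NormedAddCommGroup E] [NormedSpace ℝ E]
    {B : ℝ → E →L[ℝ] E} (hB : Continuous B) (k : ℕ) :
    ContinuousOn (fun s : ℝ => (s ^ k)⁻¹ • B s) (Ioi 0) :=
  ((continuousOn_pow k).inv₀ fun _ hs => pow_ne_zero _ (ne_of_gt hs)).smul hB.continuousOn

/-- An approximate solution of the Jacobi equation of a high enough order is close to a solution. -/
theorem exists_jacobi_solution_isBigO (hX : ContDiff ℝ ∞ X) (hβ : ContDiff ℝ ∞ β)
    (hβ0 : ∀ s, 0 < β s) (hk : 1 ≤ k) (ha : symplForm (X 0) (deriv X 0) ≠ 0) :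
    ∃ M₀ : ℕ, ∀ M, M₀ ≤ M → 1 ≤ M → ∀ (ξ : PhaseSpace n) (P : ℝ → ℝ), ContDiff ℝ ∞ P →
      jacobiDefect X β k ξ P =O[𝓝 0] (fun s : ℝ => s ^ (M + 2 * k)) →
      ∃ η : ℝ → PhaseSpace n,
        (∀ s, 0 < s → HasDerivAt η ((s ^ k)⁻¹ • jacobiField X β s (η s)) s) ∧
        (fun s => η s - variedCurve X ξ P s) =O[𝓝[>] 0] (fun s : ℝ => s ^ M) ∧
        (fun s => s ^ k • deriv (variedCurve X ξ P) s - jacobiField X β s (variedCurve X ξ P s))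
          =O[𝓝 0] fun s : ℝ => s ^ M := by
  have haC : ContDiff ℝ ∞ fun s => symplForm (X s) (deriv X s) := hX.symplForm hX.infty_deriv
  obtain ⟨ς, hς⟩ : ∃ ς : ℝ, (ς = 1 ∨ ς = -1) ∧ 0 < ς * symplForm (X 0) (deriv X 0) := by
    rcases ha.lt_or_gt with h | h
    · exact ⟨-1, Or.inr rfl, by linarith⟩
    · exact ⟨1, Or.inl rfl, by linarith⟩
  obtain ⟨hς1, hςa⟩ := hς
  have hςς : ς * ς = 1 := by rcases hς1 with rfl | rfl <;> norm_num
  have hς0 : ς ≠ 0 := fun h => by simp [h] at hςς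
  -- α = ς α₁ is a nowhere vanishing function with the germ of σ(X, X') at 0, and ς is its sign.
  obtain ⟨α₁, hα₁, hα₁0, hα₁e⟩ :=
    (contDiff_const (c := ς) |>.mul haC).exists_pos_eventuallyEq hςa
  set α : ℝ → ℝ := fun s => ς * α₁ s with hα
  have hαC : ContDiff ℝ ∞ α := contDiff_const.mul hα₁
  have hα0 : ∀ s, α s ≠ 0 := fun s => mul_ne_zero hς0 (hα₁0 s).ne'
  have hαe : ∀ᶠ s in 𝓝 0, α s = symplForm (X s) (deriv X s) := by
    filter_upwards [hα₁e] with s hs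
    rw [hα]; simp only [hs]; rw [← mul_assoc, hςς, one_mul]
  set γ : ℝ → ℝ := fun s => α₁ s / β s with hγ
  have hγC : ContDiff ℝ ∞ γ := hα₁.div hβ fun s => (hβ0 s).ne'
  have hγ0 : ∀ s, 0 < γ s := fun s => div_pos (hα₁0 s) (hβ0 s)
  set X₂ := deriv (deriv X) with hX₂
  have hX₂C : ContDiff ℝ ∞ X₂ := hX.infty_deriv.infty_deriv
  -- The regularization. A correction U with U' = v X must satisfy s^k β v = −(w + F) with w = σ(X,
  -- U). Then w' = σ(X', U) =: w₁ and w₁' = σ(X'', U) − α v. In Y = U + w₁ Z₁ the term v X cancels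
  -- against −α v Z₁, and Y' = σ(X'', Y) Z₁ + w₁ Z₃ is regular. Scaling x = h w with h² = γ s^{-k}
  -- balances the singular coupling between x and w₁, and l is the logarithmic derivative h'/h.
  set Z₁ : ℝ → PhaseSpace n := fun s => (α s)⁻¹ • X s with hZ₁
  have hZ₁C : ContDiff ℝ ∞ Z₁ := (hαC.inv hα0).smul hX
  set c : ℝ → ℝ := fun s => symplForm (X₂ s) (Z₁ s) with hc
  have hcC : ContDiff ℝ ∞ c := hX₂C.symplForm hZ₁C
  set Z₃ : ℝ → PhaseSpace n := fun s => deriv Z₁ s - c s • Z₁ s with hZ₃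
  have hZ₃C : ContDiff ℝ ∞ Z₃ := hZ₁C.infty_deriv.sub (hcC.smul hZ₁C)
  set l : ℝ → ℝ := fun s => (deriv γ s / γ s - k / s) / 2 with hl
  set h : ℝ → ℝ := fun s => Real.sqrt (γ s * (s ^ k)⁻¹) with hh
  obtain ⟨M₀, hM₀⟩ := exists_regularized_solution (n := n) hk hς1 hγC.continuous hγ0
    hγC.infty_deriv.continuous hcC.continuous hX₂C.continuous hZ₁C.continuous hZ₃C.continuous
    (fun s => rfl : ∀ s, l s = _) (fun s => rfl : ∀ s, h s = _)
  refine ⟨M₀, fun M hM hM1 ξ P hP hPO => ?_⟩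
  set F := jacobiDefect X β k ξ P with hF
  have hFC : ContDiff ℝ ∞ F := contDiff_jacobiDefect hX hβ k ξ hP
  obtain ⟨u, hu, huO⟩ := hM₀ M hM F hFC.continuous.continuousOn (hPO.mono nhdsWithin_le_nhds)
  set x : ℝ → ℝ := fun s => (u s).1 with hx
  set w₁ : ℝ → ℝ := fun s => (u s).2.1 with hw₁
  set Y : ℝ → PhaseSpace n := fun s => (u s).2.2 with hY
  have hsplit : ∀ s, u s = (x s, w₁ s, Y s) := fun s => rfl
  have hxO : x =O[𝓝[>] 0] fun s : ℝ => s ^ M :=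
    (Asymptotics.IsBigO.of_norm_le fun s => norm_fst_le (u s)).trans huO.norm_left
  have hwO : w₁ =O[𝓝[>] 0] fun s : ℝ => s ^ M :=
    (Asymptotics.IsBigO.of_norm_le fun s => (norm_fst_le _).trans (norm_snd_le (u s))).trans huO.norm_left
  have hYO : Y =O[𝓝[>] 0] fun s : ℝ => s ^ M :=
    (Asymptotics.IsBigO.of_norm_le fun s => (norm_snd_le _).trans (norm_snd_le (u s))).trans huO.norm_left
  have hxd : ∀ s, 0 < s → HasDerivAt x (l s * x s + h s * w₁ s) s := fun s hs => by
    refine ((ContinuousLinearMap.fst ℝ ℝ (ℝ × PhaseSpace n)).hasFDerivAt.comp_hasDerivAt s (hu s hs)).congr_deriv ?_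
    rw [hsplit s, regMatrix_apply]
    simp
  have hwd : ∀ s, 0 < s → HasDerivAt w₁ (ς * h s * x s + symplForm (X₂ s) (Y s) - c s * w₁ s +
      ς * (γ s * (s ^ k)⁻¹) * F s) s := fun s hs => by
    refine (((ContinuousLinearMap.fst ℝ ℝ (PhaseSpace n)).comp
      (ContinuousLinearMap.snd ℝ ℝ (ℝ × PhaseSpace n))).hasFDerivAt.comp_hasDerivAt s (hu s hs)).congr_deriv ?_
    rw [hsplit s, regMatrix_apply]
    simp
  have hYd : ∀ s, 0 < s → HasDerivAt Y (symplForm (X₂ s) (Y s) • Z₁ s + w₁ s • Z₃ s) s :=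
    fun s hs => by
    refine (((ContinuousLinearMap.snd ℝ ℝ (PhaseSpace n)).comp
      (ContinuousLinearMap.snd ℝ ℝ (ℝ × PhaseSpace n))).hasFDerivAt.comp_hasDerivAt s (hu s hs)).congr_deriv ?_
    rw [hsplit s, regMatrix_apply]
    simp
  have hhpos : ∀ s, 0 < s → 0 < h s := fun s hs =>
    Real.sqrt_pos.2 (mul_pos (hγ0 s) (inv_pos.2 (pow_pos hs k)))
  have hhsq : ∀ s, 0 < s → h s * h s = γ s * (s ^ k)⁻¹ := fun s hs =>
    Real.mul_self_sqrt (mul_pos (hγ0 s) (inv_pos.2 (pow_pos hs k))).le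
  have hhd : ∀ s, 0 < s → HasDerivAt h (l s * h s) s := fun s hs => by
    have hne : s ≠ 0 := hs.ne'
    have h1 : HasDerivAt (fun s => γ s * (s ^ k)⁻¹) (deriv γ s * (s ^ k)⁻¹ +
        γ s * (-(k * s ^ (k - 1)) / (s ^ k) ^ 2)) s :=
      (hγC.hasDerivAt_of_infty s).mul ((hasDerivAt_pow k s).inv (pow_ne_zero _ hne))
    refine (h1.sqrt (mul_pos (hγ0 s) (inv_pos.2 (pow_pos hs k))).ne').congr_deriv ?_
    have h2 := hhpos s hs
    change _ / (2 * h s) = _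
    rw [div_eq_iff (by positivity)]
    have h3 := hhsq s hs
    have h4 : l s * h s * (2 * h s) = 2 * l s * (h s * h s) := by ring
    rw [h4, h3, hl]
    have h5 := (hγ0 s).ne'
    obtain ⟨j, rfl⟩ : ∃ j, k = j + 1 := ⟨k - 1, by omega⟩
    simp only [Nat.add_sub_cancel]
    field_simp
    ring
  set w : ℝ → ℝ := fun s => (h s)⁻¹ * x s with hw
  have hwd' : ∀ s, 0 < s → HasDerivAt w (w₁ s) s := fun s hs => by
    have h0 := (hhpos s hs).ne'
    refine (((hhd s hs).inv h0).mul (hxd s hs)).congr_deriv ?_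
    simp only [Pi.inv_apply]
    field_simp
    ring
  have hwO' : w =O[𝓝[>] 0] fun s : ℝ => s ^ M := by
    have hb : (fun s => (h s)⁻¹) =O[𝓝[>] 0] fun _ : ℝ => (1 : ℝ) := by
      have e : (fun s => (h s)⁻¹) = fun s => Real.sqrt ((γ s)⁻¹ * s ^ k) := by
        funext s
        simp only [hh]
        rw [← Real.sqrt_inv, mul_inv, inv_inv]
      rw [e]
      have hcont : Continuous fun s => Real.sqrt ((γ s)⁻¹ * s ^ k) :=
        ((hγC.continuous.inv₀ fun s => (hγ0 s).ne').mul (continuous_pow k)).sqrt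
      exact ((hcont.tendsto 0).isBigO_one ℝ).mono nhdsWithin_le_nhds
    simpa using hb.mul hxO
  set U : ℝ → PhaseSpace n := fun s => Y s - w₁ s • Z₁ s with hU
  set v : ℝ → ℝ := fun s => -((s ^ k)⁻¹ * ((β s)⁻¹ * (w s + F s))) with hv
  have hςγ : ∀ s, ς * (γ s * (s ^ k)⁻¹) = α s * ((s ^ k)⁻¹ * (β s)⁻¹) := fun s => by
    simp only [hγ, hα, div_eq_mul_inv]; ring
  have hkey : ∀ s, 0 < s → ς * h s * x s + ς * (γ s * (s ^ k)⁻¹) * F s = -(α s * v s) :=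
    fun s hs => by
    have h0 := (hhpos s hs).ne'
    have h1 : x s = h s * w s := by simp only [hw]; field_simp
    have h2 : ς * h s * x s = ς * (h s * h s) * w s := by rw [h1]; ring
    rw [h2, hhsq s hs, ← mul_add, hςγ, hv]
    ring
  have hUd : ∀ s, 0 < s → HasDerivAt U (v s • X s) s := fun s hs => by
    have hk1 := hkey s hs
    have h0 := hα0 s
    refine ((hYd s hs).sub ((hwd s hs).smul (hZ₁C.hasDerivAt_of_infty s))).congr_deriv ?_
    have e1 : ς * h s * x s + symplForm (X₂ s) (Y s) - c s * w₁ s + ς * (γ s * (s ^ k)⁻¹) * F s =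
        symplForm (X₂ s) (Y s) - c s * w₁ s - α s * v s := by linarith
    have e2 : v s • X s = (α s * v s) • Z₁ s := by
      simp only [hZ₁, smul_smul]; congr 1; field_simp
    rw [e1, e2]
    simp only [hZ₃]
    module
  have hUO : U =O[𝓝[>] 0] fun s : ℝ => s ^ M := by
    refine hYO.sub ?_
    have := hwO.smul (((hZ₁C.continuous.tendsto 0).isBigO_one ℝ).mono
      (nhdsWithin_le_nhds (s := Ioi (0 : ℝ))))
    simpa using this
  obtain ⟨δ, hδ, hαδ⟩ := mem_nhdsGT_iff_exists_Ioo_subset.1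
    (nhdsWithin_le_nhds (s := Ioi (0 : ℝ)) hαe)
  -- The regularized system forgets the constraints w₁ = σ(X', U) and w = σ(X, U). Their defects are
  -- constant along solutions and tend to 0 at 0, so the constraints hold.
  have hD₁ : ∀ s ∈ Ioo 0 δ, w₁ s - symplForm (deriv X s) (U s) = 0 := by
    refine eq_zero_of_hasDerivAt_zero_of_tendsto (fun s hs => ?_) ?_
    · refine ((hwd s hs.1).sub ((hX.infty_deriv.hasDerivAt_of_infty s).symplForm
        (hUd s hs.1))).congr_deriv ?_
      have hk1 := hkey s hs.1
      have e : α s = symplForm (X s) (deriv X s) := hαδ hs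
      have e1 : symplForm (X₂ s) (U s) = symplForm (X₂ s) (Y s) - c s * w₁ s := by
        simp only [hU, hc, symplForm_sub_right, symplForm_smul_right]; ring
      change _ - (symplForm (X₂ s) (U s) + _) = _
      rw [e1, symplForm_smul_right, symplForm_swap (deriv X s), ← e]
      linarith
    · refine tendsto_zero_of_isBigO_pow hM1 (hwO.sub (symplForm_isBigO ?_ hUO))
      exact ((hX.infty_deriv.continuous.tendsto 0).isBigO_one ℝ).mono nhdsWithin_le_nhds
  have hD : ∀ s ∈ Ioo 0 δ, w s - symplForm (X s) (U s) = 0 := by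
    refine eq_zero_of_hasDerivAt_zero_of_tendsto (fun s hs => ?_) ?_
    · refine ((hwd' s hs.1).sub ((hX.hasDerivAt_of_infty s).symplForm (hUd s hs.1))).congr_deriv ?_
      rw [symplForm_smul_right, symplForm_self]
      linarith [hD₁ s hs]
    · refine tendsto_zero_of_isBigO_pow hM1 (hwO'.sub (symplForm_isBigO ?_ hUO))
      exact ((hX.continuous.tendsto 0).isBigO_one ℝ).mono nhdsWithin_le_nhds
  set g := variedCurve X ξ P with hg
  have hgd : ∀ s, HasDerivAt g (P s • X s) s :=
    hasDerivAt_variedCurve hX.continuous hP.continuous ξ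
  have hFg : ∀ s, F s = symplForm (X s) (g s) + s ^ k * β s * P s := fun s => rfl
  have hsol : ∀ s ∈ Ioo 0 δ, HasDerivAt (fun s => g s + U s)
      ((s ^ k)⁻¹ • jacobiField X β s (g s + U s)) s := fun s hs => by
    refine ((hgd s).add (hUd s hs.1)).congr_deriv ?_
    have h0 := (hβ0 s).ne'
    have h1 : s ^ k ≠ 0 := pow_ne_zero _ hs.1.ne'
    have h2 := hD s hs
    rw [jacobiField_apply, smul_smul, ← add_smul, symplForm_add_right]
    congr 1
    simp only [hv]
    rw [hFg s, show w s = symplForm (X s) (U s) by linarith]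
    field_simp
    ring
  have hfield : Continuous (jacobiField X β) := (contDiff_jacobiField hX hβ hβ0).continuous
  have hfield' := continuousOn_singular_field hfield k
  -- Since α agrees with σ(X, X') only near 0, the sum g + U solves the equation on (0, δ) only;
  -- beyond, the solution is continued by linear existence and uniqueness.
  obtain ⟨η, hη0, hη⟩ := exists_linearODE_solution_Ioi hfield' continuousOn_const
    (f := fun _ => 0) (half_pos hδ) (g (δ / 2) + U (δ / 2))
  have heq : EqOn η (fun s => g s + U s) (Ioo 0 δ) :=
    linearODE_unique (f := fun _ => 0) (hfield'.mono fun s hs => hs.1) (fun s hs => hη s hs.1)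
      (fun s hs => by simpa using hsol s hs) ⟨half_pos hδ, half_lt_self hδ⟩ hη0
  refine ⟨η, fun s hs => by simpa using hη s hs, hUO.congr' ?_ EventuallyEq.rfl, ?_⟩
  · filter_upwards [Ioo_mem_nhdsGT hδ] with s hs
    rw [heq hs]; simp
  · have e : (fun s => s ^ k • deriv g s - jacobiField X β s (g s)) =
        fun s => F s • ((β s)⁻¹ • X s) := by
      funext s
      have h0 := (hβ0 s).ne'
      rw [(hgd s).deriv, jacobiField_apply, hFg s, smul_smul, smul_smul, ← sub_smul]
      congr 1
      field_simp
      ring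
    have hb : (fun s => (β s)⁻¹ • X s) =O[𝓝 0] fun _ => (1 : ℝ) :=
      ((((hβ.continuous.inv₀ fun s => (hβ0 s).ne').smul hX.continuous)).tendsto 0).isBigO_one ℝ
    rw [e]
    refine isBigO_pow_of_le le_rfl (Nat.le_add_right M (2 * k)) ?_
    simpa using hPO.smul hb

end ExactSolution

/-! ### Approximation of every order by a single solution -/

section Stabilization

variable {E : Type} [NormedAddCommGroup E] [NormedSpace ℝ E] {k : ℕ} {B : ℝ → E →L[ℝ] E}

/-- `u` solves `sᵏ u' = B u` for all positive times. -/
def IsSingularSolution (k : ℕ) (B : ℝ → E →L[ℝ] E) (u : ℝ → E) : Prop :=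
  ∀ s, 0 < s → HasDerivAt u ((s ^ k)⁻¹ • B s (u s)) s

theorem IsSingularSolution.add {u v : ℝ → E} (hu : IsSingularSolution k B u)
    (hv : IsSingularSolution k B v) : IsSingularSolution k B fun s => u s + v s := fun s hs =>
  ((hu s hs).add (hv s hs)).congr_deriv (by rw [map_add, smul_add])

theorem IsSingularSolution.const_smul {u : ℝ → E} (hu : IsSingularSolution k B u) (c : ℝ) :
    IsSingularSolution k B fun s => c • u s := fun s hs =>
  ((hu s hs).const_smul c).congr_deriv (by rw [map_smul, smul_comm])

theorem ApproxSmooth.mono {u : ℝ → E} {M N : ℕ} (hMN : M ≤ N) (h : ApproxSmooth k B u N) :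
    ApproxSmooth k B u M := by
  obtain ⟨g, hg, h1, h2⟩ := h
  exact ⟨g, hg, isBigO_pow_of_le nhdsWithin_le_nhds hMN h1, isBigO_pow_of_le le_rfl hMN h2⟩

theorem ApproxSmooth.congr {u v : ℝ → E} {N : ℕ} (h : ApproxSmooth k B u N)
    (huv : ∀ s, 0 < s → u s = v s) : ApproxSmooth k B v N := by
  obtain ⟨g, hg, h1, h2⟩ := h
  refine ⟨g, hg, h1.congr' ?_ EventuallyEq.rfl, h2⟩
  filter_upwards [self_mem_nhdsWithin] with s hs
  rw [huv s hs]

theorem ApproxSmooth.add {u v : ℝ → E} {N : ℕ} (hu : ApproxSmooth k B u N)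
    (hv : ApproxSmooth k B v N) : ApproxSmooth k B (fun s => u s + v s) N := by
  obtain ⟨g, hg, h1, h2⟩ := hu
  obtain ⟨f, hf, h3, h4⟩ := hv
  refine ⟨fun s => g s + f s, hg.add hf, (h1.add h3).congr_left fun s => (add_sub_add_comm _ _ _ _).symm,
    (h2.add h4).congr_left fun s => ?_⟩
  rw [((hg.hasDerivAt_of_infty s).fun_add (hf.hasDerivAt_of_infty s)).deriv, map_add, smul_add]
  abel

theorem ApproxSmooth.const_smul {u : ℝ → E} {N : ℕ} (hu : ApproxSmooth k B u N) (c : ℝ) :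
    ApproxSmooth k B (fun s => c • u s) N := by
  obtain ⟨g, hg, h1, h2⟩ := hu
  refine ⟨fun s => c • g s, contDiff_const.smul hg,
    (h1.const_smul_left c).congr_left fun s => smul_sub _ _ _,
    (h2.const_smul_left c).congr_left fun s => ?_⟩
  rw [((hg.hasDerivAt_of_infty s).fun_const_smul c).deriv, Pi.smul_apply, map_smul, smul_comm (s ^ k), smul_sub]

theorem IsSingularSolution.eq_of_eq {u v : ℝ → E} (hB : Continuous B)
    (hu : IsSingularSolution k B u) (hv : IsSingularSolution k B v) {s₀ : ℝ} (hs₀ : 0 < s₀)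
    (h : u s₀ = v s₀) : ∀ s, 0 < s → u s = v s := by
  intro s hs
  have hb : s < max s s₀ + 1 := (le_max_left _ _).trans_lt (lt_add_one _)
  have hb₀ : s₀ < max s s₀ + 1 := (le_max_right _ _).trans_lt (lt_add_one _)
  exact linearODE_unique (f := fun _ => 0)
    ((continuousOn_singular_field hB k).mono fun r hr => hr.1)
    (fun r hr => by simpa using hu r hr.1) (fun r hr => by simpa using hv r hr.1)
    ⟨hs₀, hb₀⟩ h ⟨hs, hb⟩

/-- The values at time `1` of the solutions that are approximately smooth of order `N`. -/
def approxSmoothSubmodule (k : ℕ) (B : ℝ → E →L[ℝ] E) (N : ℕ) : Submodule ℝ E where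
  carrier := {c | ∃ u, IsSingularSolution k B u ∧ u 1 = c ∧ ApproxSmooth k B u N}
  add_mem' := by
    rintro _ _ ⟨u, hu, rfl, hu'⟩ ⟨v, hv, rfl, hv'⟩
    exact ⟨_, hu.add hv, rfl, hu'.add hv'⟩
  zero_mem' := by
    refine ⟨fun _ => 0, fun s _ => (hasDerivAt_const s 0).congr_deriv (by simp), rfl,
      fun _ => 0, contDiff_const, ?_, ?_⟩
    · simpa using Asymptotics.isBigO_zero _ _
    · simpa using Asymptotics.isBigO_zero _ _
  smul_mem' := by
    rintro c _ ⟨u, hu, rfl, hu'⟩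
    exact ⟨_, hu.const_smul c, rfl, hu'.const_smul c⟩

/-- A solution that is approximately smooth of a high enough order is so of every order. -/
theorem exists_approxSmooth_stable [FiniteDimensional ℝ E] (hB : Continuous B) (k : ℕ) :
    ∃ N₁, ∀ u, IsSingularSolution k B u → ApproxSmooth k B u N₁ → ∀ N, ApproxSmooth k B u N := by
  have hanti : ∀ M N, M ≤ N → approxSmoothSubmodule k B N ≤ approxSmoothSubmodule k B M := by
    rintro M N hMN c ⟨u, hu, h1, h2⟩
    exact ⟨u, hu, h1, h2.mono hMN⟩
  -- The values at time 1 of approximately smooth solutions form a decreasing sequence of subspaces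
  -- in N, which becomes stationary in finite dimension. As the value at 1 determines the solution,
  -- the better approximated solution is the given one.
  obtain ⟨N₁, hN₁⟩ := IsArtinian.monotone_stabilizes
    (⟨fun N => OrderDual.toDual (approxSmoothSubmodule k B N), hanti⟩ :
      ℕ →o (Submodule ℝ E)ᵒᵈ)
  refine ⟨N₁, fun u hu hu' N => ?_⟩
  rcases le_total N N₁ with h | h
  · exact hu'.mono h
  · have h1 : approxSmoothSubmodule k B N₁ = approxSmoothSubmodule k B N := hN₁ N h
    have h2 : u 1 ∈ approxSmoothSubmodule k B N₁ := ⟨u, hu, rfl, hu'⟩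
    rw [h1] at h2
    obtain ⟨v, hv, hv1, hv'⟩ := h2
    exact hv'.congr (hv.eq_of_eq hB hu one_pos hv1)

end Stabilization

/-! ### Smooth solutions with formal initial values -/

section SmoothSolutions

variable {n : ℕ} {X : ℝ → PhaseSpace n} {β : ℝ → ℝ} {k : ℕ}

/-- The initial values for which the Jacobi equation has a formal solution. -/
def formalInitialValues (X : ℝ → PhaseSpace n) (hX : ContDiff ℝ ∞ X) (β : ℝ → ℝ) (k : ℕ) :
    Submodule ℝ (PhaseSpace n) where
  carrier := {ξ | ∀ N, ∃ P : ℝ → ℝ, ContDiff ℝ ∞ P ∧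
    jacobiDefect X β k ξ P =O[𝓝 0] fun s : ℝ => s ^ N}
  add_mem' := by
    intro ξ ζ hξ hζ N
    obtain ⟨P, hP, h1⟩ := hξ N
    obtain ⟨R, hR, h2⟩ := hζ N
    refine ⟨fun r => 1 * P r + 1 * R r, (contDiff_const.mul hP).add (contDiff_const.mul hR), ?_⟩
    refine (h1.add h2).congr_left fun s => ?_
    have := jacobiDefect_add_smul hX.continuous β k hP.continuous hR.continuous ξ ζ 1 1 s
    simp only [one_smul] at this
    rw [this]; ring
  zero_mem' := fun N => ⟨fun _ => 0, contDiff_const, 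
    (Asymptotics.isBigO_zero (E' := ℝ) (fun s : ℝ => s ^ N) (𝓝 0)).congr_left fun s => by
      simp [jacobiDefect, variedCurve]⟩
  smul_mem' := by
    intro c ξ hξ N
    obtain ⟨P, hP, h1⟩ := hξ N
    refine ⟨fun r => c * P r + 0 * P r, (contDiff_const.mul hP).add (contDiff_const.mul hP), ?_⟩
    refine (h1.const_mul_left c).congr_left fun s => ?_
    have := jacobiDefect_add_smul hX.continuous β k hP.continuous hP.continuous ξ ξ c 0 s
    simp only [zero_smul, add_zero] at this
    rw [this]; ring

/-- The Jacobi equation has a smooth solution for every initial value that admits a formal one. -/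
theorem exists_smooth_jacobi_solution (hX : ContDiff ℝ ∞ X) (hβ : ContDiff ℝ ∞ β)
    (hβ0 : ∀ s, 0 < β s) (hk : 1 ≤ k) (ha : symplForm (X 0) (deriv X 0) ≠ 0)
    {ξ : PhaseSpace n} (hξ : ξ ∈ formalInitialValues X hX β k) :
    ∃ η : ℝ → PhaseSpace n, IsSingularSolution k (jacobiField X β) η ∧ η 0 = ξ ∧
      ∀ δ, 0 < δ → ContDiffOn ℝ ∞ η (Ico 0 δ) := by
  have hBC := contDiff_jacobiField hX hβ hβ0
  obtain ⟨N₁, hN₁⟩ := exists_approxSmooth_stable hBC.continuous k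
  obtain ⟨M₀, hM₀⟩ := exists_jacobi_solution_isBigO hX hβ hβ0 hk ha
  -- At least M₀ for the exact correction, at least N₁ for the stabilization, and at least 1 so that
  -- the solution tends to ξ.
  set M := max M₀ (max N₁ 1) with hM
  have hM1 : 1 ≤ M := (le_max_right _ _).trans (le_max_right _ _)
  have hMN : N₁ ≤ M := (le_max_left _ _).trans (le_max_right _ _)
  obtain ⟨P, hP, hPO⟩ := hξ (M + 2 * k)
  obtain ⟨η, hη, h1, h2⟩ := hM₀ M (le_max_left _ _) hM1 ξ P hP hPO
  have hgC := contDiff_variedCurve hX hP ξ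
  have hall := hN₁ η hη (ApproxSmooth.mono hMN ⟨_, hgC, h1, h2⟩)
  have hlim : Tendsto η (𝓝[>] 0) (𝓝 ξ) := by
    have h3 := tendsto_zero_of_isBigO_pow hM1 h1
    have h4 : Tendsto (variedCurve X ξ P) (𝓝[>] 0) (𝓝 ξ) := by
      have := (hgC.continuous.tendsto 0).mono_left (nhdsWithin_le_nhds (s := Ioi (0 : ℝ)))
      rwa [variedCurve_zero] at this
    simpa using h3.add h4
  -- The solution property says nothing about the value at 0, which is set to the limit.
  set η' := Function.update η 0 ξ with hη'
  have hne : ∀ s, 0 < s → η s = η' s := fun s hs => by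
    rw [hη', Function.update_of_ne hs.ne']
  have hη's : IsSingularSolution k (jacobiField X β) η' := fun s hs => by
    rw [← hne s hs]
    refine (hη s hs).congr_of_eventuallyEq ?_
    filter_upwards [lt_mem_nhds hs] with r hr
    exact (hne r hr).symm
  have h0 : η' 0 = ξ := by simp [hη']
  refine ⟨η', hη's, h0, fun δ hδ => contDiffOn_of_approxSmooth hδ hBC (fun s hs => hη's s hs.1) ?_
    fun N => (hall N).congr hne⟩
  rw [ContinuousWithinAt, h0]
  refine hlim.congr' ?_
  filter_upwards [self_mem_nhdsWithin] with s hs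
  exact hne s hs

/-- Two vectors in the skew-orthogonal complement of `X(0), X'(0)` have a nontrivial combination
that is a formal initial value. -/
theorem exists_combination_mem_formalInitialValues (hX : ContDiff ℝ ∞ X) (hβ : ContDiff ℝ ∞ β)
    (hβ0 : 0 < β 0) (hk : 1 ≤ k) (ha : symplForm (X 0) (deriv X 0) ≠ 0)
    {ξ ζ : PhaseSpace n} (hξ0 : symplForm (X 0) ξ = 0) (hξ1 : symplForm (deriv X 0) ξ = 0)
    (hζ0 : symplForm (X 0) ζ = 0) (hζ1 : symplForm (deriv X 0) ζ = 0) :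
    ∃ x y : ℝ, (x ≠ 0 ∨ y ≠ 0) ∧ x • ξ + y • ζ ∈ formalInitialValues X hX β k := by
  obtain ⟨e, D, he, hD, -, hlead⟩ := exists_jacobiDefect_leading_term hX hβ hβ0 hk ha
  exact exists_jacobiDefect_isBigO_combination hX hβ he hD hlead hξ0 hξ1 hζ0 hζ1

/-- For negative σ(X, X') no coefficient D j vanishes, so the recursion never stops and no condition
beyond the two orthogonality relations arises. -/
theorem mem_formalInitialValues_of_neg (hX : ContDiff ℝ ∞ X) (hβ : ContDiff ℝ ∞ β)
    (hβ0 : 0 < β 0) (hk : 1 ≤ k) (ha : symplForm (X 0) (deriv X 0) < 0)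
    {ξ : PhaseSpace n} (hξ0 : symplForm (X 0) ξ = 0) (hξ1 : symplForm (deriv X 0) ξ = 0) :
    ξ ∈ formalInitialValues X hX β k := by
  obtain ⟨e, D, he, -, hD, hlead⟩ := exists_jacobiDefect_leading_term hX hβ hβ0 hk ha.ne
  exact fun N => exists_jacobiDefect_isBigO hX hβ he (hD ha) hlead hξ0 hξ1 N

end SmoothSolutions

/-! ### Partial symplectic bases -/

section SymplecticFamilies

variable {n : ℕ}

theorem exists_symplForm_eq (f : PhaseSpace n →ₗ[ℝ] ℝ) : ∃ c, ∀ v, symplForm c v = f v := by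
  refine ⟨WithLp.toLp 2 (Sum.elim (fun i => f (EuclideanSpace.single (Sum.inr i) 1))
    fun i => -f (EuclideanSpace.single (Sum.inl i) 1)), fun v => ?_⟩
  have hv : v = ∑ r, v r • EuclideanSpace.single r (1 : ℝ) := by
    ext r
    rcases r with r | r <;> simp [Finset.sum_apply, Pi.single_apply]
  conv_rhs => rw [hv]
  rw [symplForm_eq_sum, map_sum, Fintype.sum_sum_type, ← Finset.sum_add_distrib]
  refine Finset.sum_congr rfl fun i _ => ?_
  simp only [Sum.elim_inl, Sum.elim_inr, map_smul, smul_eq_mul]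
  ring

theorem exists_symplForm_eq_one {e : PhaseSpace n} (he : e ≠ 0) : ∃ g, symplForm e g = 1 := by
  obtain ⟨c, hc⟩ := exists_symplForm_eq ((innerSL ℝ e).toLinearMap)
  have h1 : symplForm c e ≠ 0 := by
    rw [hc]
    simpa using he
  refine ⟨-((symplForm c e)⁻¹ • c), ?_⟩
  rw [← neg_one_smul ℝ, symplForm_smul_right, symplForm_smul_right, symplForm_swap e c]
  field_simp

/-- The vectors `e i, f i` with `i ∈ A` are part of a symplectic basis. -/
structure IsSymplecticFamily {ι : Type*} [DecidableEq ι] (A : Finset ι) (e f : ι → PhaseSpace n) :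
    Prop where
  ee : ∀ i ∈ A, ∀ j ∈ A, symplForm (e i) (e j) = 0
  ff : ∀ i ∈ A, ∀ j ∈ A, symplForm (f i) (f j) = 0
  ef : ∀ i ∈ A, ∀ j ∈ A, symplForm (e i) (f j) = if i = j then 1 else 0

variable {ι : Type*} {A : Finset ι} {e f : ι → PhaseSpace n}

/-- The projection onto the skew-orthogonal complement of a symplectic family. -/
noncomputable def skewProj (A : Finset ι) (e f : ι → PhaseSpace n) (v : PhaseSpace n) :
    PhaseSpace n :=
  v - ∑ i ∈ A, symplForm (e i) v • f i + ∑ i ∈ A, symplForm (f i) v • e i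

theorem symplForm_sum_right {κ : Type*} (s : Finset κ) (u : PhaseSpace n) (v : κ → PhaseSpace n) :
    symplForm u (∑ i ∈ s, v i) = ∑ i ∈ s, symplForm u (v i) := by
  simp [← symplBilin_apply]

theorem IsSymplecticFamily.symplForm_skewProj_left [DecidableEq ι] (h : IsSymplecticFamily A e f)
    (v : PhaseSpace n) {j : ι} (hj : j ∈ A) : symplForm (e j) (skewProj A e f v) = 0 := by
  rw [skewProj, symplForm_add_right, symplForm_sub_right, symplForm_sum_right, symplForm_sum_right]
  simp only [symplForm_smul_right]
  rw [Finset.sum_congr rfl fun i hi => by rw [h.ef j hj i hi],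
    Finset.sum_eq_zero (f := fun i => symplForm (f i) v * symplForm (e j) (e i)) fun i hi => by
      rw [h.ee j hj i hi, mul_zero]]
  simp [hj]

theorem IsSymplecticFamily.symplForm_skewProj_right [DecidableEq ι] (h : IsSymplecticFamily A e f)
    (v : PhaseSpace n) {j : ι} (hj : j ∈ A) : symplForm (f j) (skewProj A e f v) = 0 := by
  rw [skewProj, symplForm_add_right, symplForm_sub_right, symplForm_sum_right, symplForm_sum_right]
  simp only [symplForm_smul_right]
  rw [Finset.sum_congr (g := fun _ => (0 : ℝ)) rfl fun i hi => by rw [h.ff j hj i hi, mul_zero],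
    Finset.sum_congr (s₁ := A) (f := fun i => symplForm (f i) v * symplForm (f j) (e i))
      rfl fun i hi => by rw [symplForm_swap (f j), h.ef i hi j hj]]
  simp [hj]

theorem skewProj_eq_self {v : PhaseSpace n} (he : ∀ i ∈ A, symplForm (e i) v = 0)
    (hf : ∀ i ∈ A, symplForm (f i) v = 0) : skewProj A e f v = v := by
  rw [skewProj, Finset.sum_eq_zero fun i hi => by rw [he i hi, zero_smul],
    Finset.sum_eq_zero fun i hi => by rw [hf i hi, zero_smul], sub_zero, add_zero]

theorem symplForm_skewProj_of_orthogonal {v w : PhaseSpace n}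
    (he : ∀ i ∈ A, symplForm (e i) w = 0) (hf : ∀ i ∈ A, symplForm (f i) w = 0) :
    symplForm w (skewProj A e f v) = symplForm w v := by
  rw [skewProj, symplForm_add_right, symplForm_sub_right, symplForm_sum_right, symplForm_sum_right,
    Finset.sum_eq_zero fun i hi => by
      rw [symplForm_smul_right, symplForm_swap w, hf i hi, neg_zero, mul_zero],
    Finset.sum_eq_zero fun i hi => by
      rw [symplForm_smul_right, symplForm_swap w, he i hi, neg_zero, mul_zero], sub_zero, add_zero]

theorem IsSymplecticFamily.adjoin [DecidableEq ι] (h : IsSymplecticFamily A e f) {j : ι} (hj : j ∉ A)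
    {x y : PhaseSpace n} (hxy : symplForm x y = 1)
    (hex : ∀ i ∈ A, symplForm (e i) x = 0) (hfx : ∀ i ∈ A, symplForm (f i) x = 0)
    (hey : ∀ i ∈ A, symplForm (e i) y = 0) (hfy : ∀ i ∈ A, symplForm (f i) y = 0) :
    IsSymplecticFamily (insert j A) (Function.update e j x) (Function.update f j y) := by
  have hne : ∀ i ∈ A, i ≠ j := fun i hi h => hj (h ▸ hi)
  constructor
  · intro i hi i' hi'
    rcases Finset.mem_insert.1 hi with rfl | h₁ <;> rcases Finset.mem_insert.1 hi' with rfl | h₂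
    · simp
    · rw [Function.update_self, Function.update_of_ne (hne _ h₂), symplForm_swap, hex _ h₂,
        neg_zero]
    · rw [Function.update_self, Function.update_of_ne (hne _ h₁), hex _ h₁]
    · rw [Function.update_of_ne (hne _ h₁), Function.update_of_ne (hne _ h₂), h.ee _ h₁ _ h₂]
  · intro i hi i' hi'
    rcases Finset.mem_insert.1 hi with rfl | h₁ <;> rcases Finset.mem_insert.1 hi' with rfl | h₂
    · simp
    · rw [Function.update_self, Function.update_of_ne (hne _ h₂), symplForm_swap, hfy _ h₂,
        neg_zero]
    · rw [Function.update_self, Function.update_of_ne (hne _ h₁), hfy _ h₁]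
    · rw [Function.update_of_ne (hne _ h₁), Function.update_of_ne (hne _ h₂), h.ff _ h₁ _ h₂]
  · intro i hi i' hi'
    rcases Finset.mem_insert.1 hi with rfl | h₁ <;> rcases Finset.mem_insert.1 hi' with rfl | h₂
    · simp [hxy]
    · rw [Function.update_self, Function.update_of_ne (hne _ h₂), symplForm_swap, hfx _ h₂,
        neg_zero, if_neg (hne _ h₂).symm]
    · rw [Function.update_self, Function.update_of_ne (hne _ h₁), hey _ h₁, if_neg (hne _ h₁)]
    · rw [Function.update_of_ne (hne _ h₁), Function.update_of_ne (hne _ h₂), h.ef _ h₁ _ h₂]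

/-- A nonzero vector that is skew-orthogonal to a symplectic family extends it. -/
theorem IsSymplecticFamily.exists_adjoin [DecidableEq ι] (h : IsSymplecticFamily A e f) {j : ι} (hj : j ∉ A)
    {x : PhaseSpace n} (hx : x ≠ 0) (hex : ∀ i ∈ A, symplForm (e i) x = 0)
    (hfx : ∀ i ∈ A, symplForm (f i) x = 0) : ∃ y,
    IsSymplecticFamily (insert j A) (Function.update e j x) (Function.update f j y) := by
  obtain ⟨g, hg⟩ := exists_symplForm_eq_one hx
  refine ⟨skewProj A e f g, h.adjoin hj ?_ hex hfx (fun i hi => h.symplForm_skewProj_left g hi)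
    fun i hi => h.symplForm_skewProj_right g hi⟩
  rw [symplForm_skewProj_of_orthogonal hex hfx, hg]

theorem exists_ne_zero_orthogonal (e f : ι → PhaseSpace n) (hA : A.card < n) :
    ∃ x : PhaseSpace n, x ≠ 0 ∧ (∀ i ∈ A, symplForm (e i) x = 0) ∧
      ∀ i ∈ A, symplForm (f i) x = 0 := by
  let L : PhaseSpace n →ₗ[ℝ] (A ⊕ A → ℝ) := LinearMap.pi
    (Sum.elim (fun i => (symplBilin n (e i)).toLinearMap) fun i => (symplBilin n (f i)).toLinearMap)
  have hlt : Module.finrank ℝ (A ⊕ A → ℝ) < Module.finrank ℝ (PhaseSpace n) := by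
    simp only [Module.finrank_fintype_fun_eq_card, Fintype.card_sum, Fintype.card_coe,
      finrank_euclideanSpace, Fintype.card_fin]
    omega
  obtain ⟨x, hx, hx0⟩ := Submodule.exists_mem_ne_zero_of_ne_bot
    (LinearMap.ker_ne_bot_of_finrank_lt (f := L) hlt)
  have hx' : ∀ i, L x i = 0 := fun i => by rw [LinearMap.mem_ker.1 hx]; rfl
  exact ⟨x, hx0, fun i hi => hx' (Sum.inl ⟨i, hi⟩), fun i hi => hx' (Sum.inr ⟨i, hi⟩)⟩

/-- Every symplectic family extends to a larger one. -/
theorem IsSymplecticFamily.exists_extension [DecidableEq ι] (h : IsSymplecticFamily A e f) {B : Finset ι}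
    (hAB : A ⊆ B) (hB : B.card ≤ n) :
    ∃ e' f' : ι → PhaseSpace n, IsSymplecticFamily B e' f' ∧
      ∀ i ∈ A, e' i = e i ∧ f' i = f i := by
  obtain ⟨m, hm⟩ : ∃ m, m = (B \ A).card := ⟨_, rfl⟩
  induction m generalizing A e f with
  | zero =>
    have : B = A := Finset.Subset.antisymm (Finset.sdiff_eq_empty_iff_subset.1
      (Finset.card_eq_zero.1 hm.symm)) hAB
    exact ⟨e, f, this ▸ h, fun i _ => ⟨rfl, rfl⟩⟩
  | succ m ih =>
    obtain ⟨j, hj⟩ := Finset.card_pos.1 (by omega : 0 < (B \ A).card)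
    rw [Finset.mem_sdiff] at hj
    have hcard : A.card < n := (Finset.card_lt_card
      ⟨hAB, fun hBA => hj.2 (hBA hj.1)⟩).trans_le hB
    obtain ⟨x, hx, hex, hfx⟩ := exists_ne_zero_orthogonal e f hcard
    obtain ⟨y, hy⟩ := h.exists_adjoin hj.2 hx hex hfx
    have hcard' : m = (B \ insert j A).card := by
      rw [Finset.sdiff_insert, Finset.card_erase_of_mem (Finset.mem_sdiff.2 hj)]
      omega
    obtain ⟨e', f', h', hagree⟩ := ih hy (Finset.insert_subset hj.1 hAB) hcard'
    refine ⟨e', f', h', fun i hi => ?_⟩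
    have hij : i ≠ j := fun hij => hj.2 (hij ▸ hi)
    have := hagree i (Finset.mem_insert_of_mem hi)
    rwa [Function.update_of_ne hij, Function.update_of_ne hij] at this

end SymplecticFamilies

/-! ### Smooth completion of moving symplectic families -/

section SmoothFrames

variable {n : ℕ} {ι : Type*}

theorem ContDiffOn.symplForm {f g : ℝ → PhaseSpace n} {m : WithTop ℕ∞} {s : Set ℝ}
    (hf : ContDiffOn ℝ m f s) (hg : ContDiffOn ℝ m g s) :
    ContDiffOn ℝ m (fun r => symplForm (f r) (g r)) s :=
  ((symplBilin n).contDiff.comp_contDiffOn hf).clm_apply hg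

theorem ContDiffOn.skewProj {A : Finset ι} {e f : ι → ℝ → PhaseSpace n} {s : Set ℝ}
    {v : ℝ → PhaseSpace n} (he : ∀ i ∈ A, ContDiffOn ℝ ∞ (e i) s)
    (hf : ∀ i ∈ A, ContDiffOn ℝ ∞ (f i) s) (hv : ContDiffOn ℝ ∞ v s) :
    ContDiffOn ℝ ∞ (fun r => skewProj A (fun i => e i r) (fun i => f i r) (v r)) s := by
  refine (hv.sub (ContDiffOn.sum fun i hi => ?_)).add (ContDiffOn.sum fun i hi => ?_)
  · exact ((he i hi).symplForm hv).smul (hf i hi)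
  · exact ((hf i hi).symplForm hv).smul (he i hi)

/-- A smooth curve of symplectic families extends to a smooth curve of larger symplectic families
with prescribed initial values. -/
theorem exists_smooth_symplecticFamily [DecidableEq ι] {A B : Finset ι} (hAB : A ⊆ B) {e f : ι → PhaseSpace n}
    (h0 : IsSymplecticFamily B e f) {u v : ι → ℝ → PhaseSpace n} {δ : ℝ} (hδ : 0 < δ)
    (hu : ∀ i ∈ A, ContDiffOn ℝ ∞ (u i) (Ico 0 δ)) (hv : ∀ i ∈ A, ContDiffOn ℝ ∞ (v i) (Ico 0 δ))
    (hu0 : ∀ i ∈ A, u i 0 = e i) (hv0 : ∀ i ∈ A, v i 0 = f i)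
    (huv : ∀ s ∈ Ico 0 δ, IsSymplecticFamily A (fun i => u i s) fun i => v i s) :
    ∃ (δ' : ℝ) (u' v' : ι → ℝ → PhaseSpace n), 0 < δ' ∧ δ' ≤ δ ∧
      (∀ i ∈ A, u' i = u i ∧ v' i = v i) ∧
      (∀ i ∈ B, ContDiffOn ℝ ∞ (u' i) (Ico 0 δ')) ∧ (∀ i ∈ B, ContDiffOn ℝ ∞ (v' i) (Ico 0 δ')) ∧
      (∀ i ∈ B, u' i 0 = e i) ∧ (∀ i ∈ B, v' i 0 = f i) ∧
      ∀ s ∈ Ico 0 δ', IsSymplecticFamily B (fun i => u' i s) fun i => v' i s := by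
  obtain ⟨m, hm⟩ : ∃ m, m = (B \ A).card := ⟨_, rfl⟩
  induction m generalizing A u v δ with
  | zero =>
    have : B = A := Finset.Subset.antisymm (Finset.sdiff_eq_empty_iff_subset.1
      (Finset.card_eq_zero.1 hm.symm)) hAB
    subst this
    exact ⟨δ, u, v, hδ, le_rfl, fun i _ => ⟨rfl, rfl⟩, hu, hv, hu0, hv0, huv⟩
  | succ m ih =>
    obtain ⟨j, hj⟩ := Finset.card_pos.1 (by omega : 0 < (B \ A).card)
    rw [Finset.mem_sdiff] at hj
    have hne : ∀ i ∈ A, i ≠ j := fun i hi h => hj.2 (h ▸ hi)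
    -- Symplectic Gram–Schmidt: the target vectors e j, f j are projected to the skew-orthogonal
    -- complement of the moving family. At time 0 the projection does nothing, so σ(x, y) starts at
    -- 1 and can be normalized on a shorter interval.
    set x : ℝ → PhaseSpace n := fun r => skewProj A (fun i => u i r) (fun i => v i r) (e j) with hx
    set y : ℝ → PhaseSpace n := fun r => skewProj A (fun i => u i r) (fun i => v i r) (f j) with hy
    have hxC : ContDiffOn ℝ ∞ x (Ico 0 δ) := ContDiffOn.skewProj hu hv contDiffOn_const
    have hyC : ContDiffOn ℝ ∞ y (Ico 0 δ) := ContDiffOn.skewProj hu hv contDiffOn_const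
    have hx0 : x 0 = e j := by
      refine skewProj_eq_self (fun i hi => ?_) fun i hi => ?_
      · rw [hu0 i hi, h0.ee i (hAB hi) j hj.1]
      · rw [hv0 i hi, symplForm_swap, h0.ef j hj.1 i (hAB hi), if_neg (hne i hi).symm, neg_zero]
    have hy0 : y 0 = f j := by
      refine skewProj_eq_self (fun i hi => ?_) fun i hi => ?_
      · rw [hu0 i hi, h0.ef i (hAB hi) j hj.1, if_neg (hne i hi)]
      · rw [hv0 i hi, h0.ff i (hAB hi) j hj.1]
    have hxy0 : symplForm (x 0) (y 0) = 1 := by rw [hx0, hy0, h0.ef j hj.1 j hj.1, if_pos rfl]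
    have hcont : ContinuousWithinAt (fun r => symplForm (x r) (y r)) (Ico 0 δ) 0 :=
      (hxC.symplForm hyC).continuousOn 0 ⟨le_rfl, hδ⟩
    obtain ⟨δ₁, hδ₁, hpos⟩ : ∃ δ₁ > 0, ∀ s ∈ Ico 0 δ₁, s < δ → 0 < symplForm (x s) (y s) := by
      have h1 : ∀ᶠ r in 𝓝[Ico 0 δ] 0, 0 < symplForm (x r) (y r) :=
        hcont.eventually 
          (lt_mem_nhds (show 0 < symplForm (x 0) (y 0) by rw [hxy0]; exact one_pos))
      obtain ⟨ε, hε, hball⟩ := Metric.mem_nhdsWithin_iff.1 h1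
      refine ⟨ε, hε, fun s hs hsδ => hball ⟨?_, hs.1, hsδ⟩⟩
      simpa [abs_of_nonneg hs.1] using hs.2
    set δ₂ := min δ δ₁ with hδ₂
    have hδ₂0 : 0 < δ₂ := lt_min hδ hδ₁
    have hsub : Ico 0 δ₂ ⊆ Ico 0 δ := Ico_subset_Ico_right (min_le_left _ _)
    have hpos' : ∀ s ∈ Ico 0 δ₂, 0 < symplForm (x s) (y s) := fun s hs =>
      hpos s ⟨hs.1, hs.2.trans_le (min_le_right _ _)⟩ (hsub hs).2
    set z : ℝ → PhaseSpace n := fun r => (symplForm (x r) (y r))⁻¹ • y r with hz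
    have hzC : ContDiffOn ℝ ∞ z (Ico 0 δ₂) :=
      (((hxC.symplForm hyC).mono hsub).inv fun s hs => (hpos' s hs).ne').smul (hyC.mono hsub)
    have hcard' : m = (B \ insert j A).card := by
      rw [Finset.sdiff_insert, Finset.card_erase_of_mem (Finset.mem_sdiff.2 hj)]
      omega
    obtain ⟨δ', u', v', hδ', hδ'le, hag, h1, h2, h3, h4, h5⟩ := ih
      (A := insert j A) (u := Function.update u j x) (v := Function.update v j z)
      (Finset.insert_subset hj.1 hAB) hδ₂0
      (fun i hi => by
        rcases Finset.mem_insert.1 hi with rfl | hi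
        · rw [Function.update_self]; exact hxC.mono hsub
        · rw [Function.update_of_ne (hne i hi)]; exact (hu i hi).mono hsub)
      (fun i hi => by
        rcases Finset.mem_insert.1 hi with rfl | hi
        · rw [Function.update_self]; exact hzC
        · rw [Function.update_of_ne (hne i hi)]; exact (hv i hi).mono hsub)
      (fun i hi => by
        rcases Finset.mem_insert.1 hi with rfl | hi
        · rw [Function.update_self]; exact hx0
        · rw [Function.update_of_ne (hne i hi)]; exact hu0 i hi)
      (fun i hi => by
        rcases Finset.mem_insert.1 hi with rfl | hi
        · rw [Function.update_self]
          change (symplForm (x 0) (y 0))⁻¹ • y 0 = _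
          rw [hxy0, inv_one, one_smul, hy0]
        · rw [Function.update_of_ne (hne i hi)]; exact hv0 i hi)
      (fun s hs => by
        have hfam := huv s (hsub hs)
        have hins := hfam.adjoin hj.2 (x := x s) (y := z s)
          (by
            simp only [hz]
            rw [symplForm_smul_right, inv_mul_cancel₀ (hpos' s hs).ne'])
          (fun i hi => hfam.symplForm_skewProj_left _ hi)
          (fun i hi => hfam.symplForm_skewProj_right _ hi)
          (fun i hi => by
            simp only [hz]
            rw [symplForm_smul_right, hfam.symplForm_skewProj_left _ hi, mul_zero])
          (fun i hi => by
            simp only [hz]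
            rw [symplForm_smul_right, hfam.symplForm_skewProj_right _ hi, mul_zero])
        have e1 : (fun i => Function.update u j x i s) =
            Function.update (fun i => u i s) j (x s) := by
          funext i
          rcases eq_or_ne i j with rfl | h
          · simp
          · simp [h]
        have e2 : (fun i => Function.update v j z i s) =
            Function.update (fun i => v i s) j (z s) := by
          funext i
          rcases eq_or_ne i j with rfl | h
          · simp
          · simp [h]
        rw [e1, e2]
        exact hins)
      hcard'
    refine ⟨δ', u', v', hδ', hδ'le.trans (min_le_left _ _), fun i hi => ?_, h1, h2, h3, h4, h5⟩
    have := hag i (Finset.mem_insert_of_mem hi)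
    rwa [Function.update_of_ne (hne i hi), Function.update_of_ne (hne i hi)] at this

end SmoothFrames

/-! ### The adapted frame and the splitting of the Jacobi equation -/

section Splitting

variable {n : ℕ} {X : ℝ → PhaseSpace n} {β : ℝ → ℝ} {k : ℕ}

/-- There is a symplectic basis, starting with `X(0)`, for which all vectors outside of the first
two pairs are initial values of formal solutions of the Jacobi equation. -/
theorem exists_adapted_symplecticBasis (hX : ContDiff ℝ ∞ X) (hβ : ContDiff ℝ ∞ β)
    (hβ0 : 0 < β 0) (hk : 1 ≤ k) (ha : symplForm (X 0) (deriv X 0) ≠ 0) :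
    ∃ (i₀ : Fin n) (e f : Fin n → PhaseSpace n), IsSymplecticFamily Finset.univ e f ∧
      i₀.val = 0 ∧ e i₀ = X 0 ∧ ∀ i : Fin n, 2 ≤ i.val →
        e i ∈ formalInitialValues X hX β k ∧ f i ∈ formalInitialValues X hX β k := by
  have hn : 0 < n := by
    rcases Nat.eq_zero_or_pos n with rfl | h
    · exact (ha (by simp [symplForm_eq_sum])).elim
    · exact h
  set a := symplForm (X 0) (deriv X 0) with hadef
  set i₀ : Fin n := ⟨0, hn⟩ with hi₀
  set e₀ : Fin n → PhaseSpace n := fun _ => X 0 with he₀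
  set f₀ : Fin n → PhaseSpace n := fun _ => a⁻¹ • deriv X 0 with hf₀
  have hfam₀ : IsSymplecticFamily {i₀} e₀ f₀ := by
    constructor <;> intro i hi j hj <;> rw [Finset.mem_singleton] at hi hj <;> subst hi hj
    · simp
    · simp
    · simp only [he₀, hf₀, if_true]
      rw [symplForm_smul_right, ← hadef, inv_mul_cancel₀ ha]
  have hperp : ∀ ξ, symplForm (X 0) ξ = 0 → symplForm (a⁻¹ • deriv X 0) ξ = 0 →
      symplForm (deriv X 0) ξ = 0 := fun ξ _ h => by
    rw [symplForm_smul_left] at h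
    exact (mul_eq_zero.1 h).resolve_left (inv_ne_zero ha)
  rcases (Nat.succ_le_of_lt hn).eq_or_lt with hn1 | hn2
  · have huniv : (Finset.univ : Finset (Fin n)) = {i₀} := by
      ext i
      simp only [Finset.mem_univ, Finset.mem_singleton, true_iff, hi₀]
      ext
      have := i.2
      simp only
      omega
    refine ⟨i₀, e₀, f₀, huniv ▸ hfam₀, rfl, rfl, fun i hi => ?_⟩
    have := i.2
    omega
  · obtain ⟨c, hc0, hce, hcf, hcN⟩ : ∃ c : PhaseSpace n, c ≠ 0 ∧ symplForm (X 0) c = 0 ∧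
        symplForm (a⁻¹ • deriv X 0) c = 0 ∧ ∀ ξ, symplForm (X 0) ξ = 0 →
          symplForm (a⁻¹ • deriv X 0) ξ = 0 → symplForm c ξ = 0 →
          ξ ∈ formalInitialValues X hX β k := by
      by_cases hall : ∀ ξ, symplForm (X 0) ξ = 0 → symplForm (a⁻¹ • deriv X 0) ξ = 0 →
          ξ ∈ formalInitialValues X hX β k
      · obtain ⟨c, hc0, h1, h2⟩ := exists_ne_zero_orthogonal (A := {i₀}) e₀ f₀ (by simpa using hn2)
        exact ⟨c, hc0, h1 i₀ (by simp), h2 i₀ (by simp), fun ξ h3 h4 _ => hall ξ h3 h4⟩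
      · push Not at hall
        obtain ⟨ζ, hζ0, hζ1, hζ⟩ := hall
        obtain ⟨φ, hφζ, hφ⟩ := Submodule.exists_le_ker_of_notMem hζ
        obtain ⟨c', hc'⟩ := exists_symplForm_eq φ
        set c := skewProj {i₀} e₀ f₀ c' with hc
        have hcξ : ∀ ξ, symplForm (X 0) ξ = 0 → symplForm (a⁻¹ • deriv X 0) ξ = 0 →
            symplForm c ξ = φ ξ := fun ξ h1 h2 => by
          rw [symplForm_swap, hc, symplForm_skewProj_of_orthogonal (fun i _ => h1) (fun i _ => h2),
            ← symplForm_swap, hc']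
        refine ⟨c, fun h0 => ?_, hfam₀.symplForm_skewProj_left c' (Finset.mem_singleton_self i₀),
          hfam₀.symplForm_skewProj_right c' (Finset.mem_singleton_self i₀), fun ξ h1 h2 h3 => ?_⟩
        · have := hcξ ζ hζ0 hζ1
          rw [h0, symplForm_zero_left] at this
          exact hφζ this.symm
        · rw [hcξ ξ h1 h2] at h3
          -- The functional φ kills the combination and ξ but not ζ, so y = 0 and ξ itself is a
          -- formal initial value.
          obtain ⟨x, y, hxy, hmem⟩ := exists_combination_mem_formalInitialValues hX hβ hβ0 hk ha
            h1 (hperp ξ h1 h2) hζ0 (hperp ζ hζ0 hζ1)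
          have h4 : φ (x • ξ + y • ζ) = 0 := hφ hmem
          rw [map_add, map_smul, map_smul, h3, smul_zero, zero_add, smul_eq_mul] at h4
          have hy : y = 0 := (mul_eq_zero.1 h4).resolve_right hφζ
          have hx : x ≠ 0 := hxy.resolve_right (not_not.2 hy)
          rw [hy, zero_smul, add_zero] at hmem
          exact (Submodule.smul_mem_iff _ hx).1 hmem
    set i₁ : Fin n := ⟨1, hn2⟩ with hi₁
    have h10 : i₁ ∉ ({i₀} : Finset (Fin n)) := by simp [hi₀, hi₁]
    obtain ⟨y, hy⟩ := hfam₀.exists_adjoin h10 hc0 (fun _ _ => hce) (fun _ _ => hcf)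
    obtain ⟨e, f, hef, hag⟩ := hy.exists_extension (Finset.subset_univ _) (by simp)
    have hmem0 : i₀ ∈ insert i₁ ({i₀} : Finset (Fin n)) := by simp
    have hmem1 : i₁ ∈ insert i₁ ({i₀} : Finset (Fin n)) := by simp
    have h01 : i₀ ≠ i₁ := by simp [hi₀, hi₁]
    have he0 : e i₀ = X 0 := by rw [(hag i₀ hmem0).1, Function.update_of_ne h01]
    have hf0 : f i₀ = a⁻¹ • deriv X 0 := by rw [(hag i₀ hmem0).2, Function.update_of_ne h01]
    have he1 : e i₁ = c := by rw [(hag i₁ hmem1).1, Function.update_self]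
    refine ⟨i₀, e, f, hef, rfl, he0, fun i hi => ?_⟩
    have hii0 : i₀ ≠ i := fun h => by rw [← h] at hi; simp [hi₀] at hi
    have hii1 : i₁ ≠ i := fun h => by rw [← h] at hi; simp [hi₁] at hi
    have u := Finset.mem_univ (α := Fin n)
    constructor
    · refine hcN _ ?_ ?_ ?_
      · rw [← he0, hef.ee _ (u _) _ (u _)]
      · rw [← hf0, symplForm_swap, hef.ef _ (u _) _ (u _), if_neg hii0.symm, neg_zero]
      · rw [← he1, hef.ee _ (u _) _ (u _)]
    · refine hcN _ ?_ ?_ ?_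
      · rw [← he0, hef.ef _ (u _) _ (u _), if_neg hii0]
      · rw [← hf0, hef.ff _ (u _) _ (u _)]
      · rw [← he1, hef.ef _ (u _) _ (u _), if_neg hii1]

/-- The symplectic form of two solutions of the Jacobi equation is constant. -/
theorem symplForm_eq_of_isSingularSolution {u v : ℝ → PhaseSpace n}
    (hu : IsSingularSolution k (jacobiField X β) u)
    (hv : IsSingularSolution k (jacobiField X β) v) {δ : ℝ}
    (huc : ContinuousOn u (Ico 0 δ)) (hvc : ContinuousOn v (Ico 0 δ)) :
    ∀ s ∈ Ico 0 δ, symplForm (u s) (v s) = symplForm (u 0) (v 0) := by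
  have hd : ∀ s, 0 < s → HasDerivAt (fun r => symplForm (u r) (v r)) 0 s := fun s hs => by
    refine ((hu s hs).symplForm (hv s hs)).congr_deriv ?_
    simp only [jacobiField_apply, symplForm_smul_left, symplForm_smul_right]
    rw [symplForm_swap (u s) (X s)]
    ring
  have hc : ContinuousOn (fun r => symplForm (u r) (v r)) (Ico 0 δ) :=
    contDiffOn_zero.1 ((contDiffOn_zero.2 huc).symplForm (contDiffOn_zero.2 hvc))
  intro s hs
  rcases hs.1.eq_or_lt with rfl | hs0
  · rfl
  refine sub_eq_zero.1 (eq_zero_of_hasDerivAt_zero_of_tendsto (δ := δ)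
    (f := fun r => symplForm (u r) (v r) - symplForm (u 0) (v 0))
    (fun r hr => (hd r hr.1).sub_const _) ?_ s ⟨hs0, hs.2⟩)
  have h1 := (hc 0 ⟨le_rfl, hs0.trans hs.2⟩).tendsto.mono_left
    (nhdsWithin_le_of_mem (mem_of_superset (Ioo_mem_nhdsGT (hs0.trans hs.2))
      Ioo_subset_Ico_self))
  simpa using h1.sub_const (symplForm (u 0) (v 0))

/-- For a symplectic matrix J M⁻¹ = Mᵀ J: coordinates in the frame are read off, up to J, by pairing
with the columns of M. -/
theorem mulVec_inv_eq_symplForm {M : Matrix (Fin n ⊕ Fin n) (Fin n ⊕ Fin n) ℝ}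
    (hM : M ∈ Matrix.symplecticGroup (Fin n) ℝ) (v : Fin n ⊕ Fin n → ℝ) (r : Fin n ⊕ Fin n) :
    (symplJ n *ᵥ (M⁻¹ *ᵥ v)) r =
      symplForm (WithLp.toLp 2 (fun i => M i r)) (WithLp.toLp 2 v : PhaseSpace n) := by
  have hJ : symplJ n = -Matrix.J (Fin n) ℝ := by
    simp [symplJ, Matrix.J, Matrix.fromBlocks_neg]
  have h1 : Mᵀ * symplJ n * M = symplJ n := by
    have := (SymplecticGroup.mem_iff' (A := M)).1 hM
    rw [hJ, Matrix.mul_neg, Matrix.neg_mul, this]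
  have hdet : IsUnit M.det := SymplecticGroup.symplectic_det hM
  have h2 : symplJ n *ᵥ (M⁻¹ *ᵥ v) = Mᵀ *ᵥ (symplJ n *ᵥ v) := by
    conv_lhs => rw [← h1]
    rw [Matrix.mulVec_mulVec, Matrix.mulVec_mulVec, Matrix.mul_assoc, Matrix.mul_nonsing_inv _ hdet,
      Matrix.mul_one]
  rw [h2]
  rfl

theorem IsSymplecticFamily.symplForm_sumElim {U V : Fin n → PhaseSpace n}
    (h : IsSymplecticFamily Finset.univ U V) (c d : Fin n ⊕ Fin n) :
    symplForm (Sum.elim U V c) (Sum.elim U V d) = symplJ n c d := by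
  have u := Finset.mem_univ (α := Fin n)
  rcases c with i | i <;> rcases d with j | j
  · simp [symplJ, h.ee i (u i) j (u j)]
  · simp [symplJ, h.ef i (u i) j (u j), Matrix.one_apply]
  · simp [symplJ, symplForm_swap (V i), h.ef j (u j) i (u i), Matrix.one_apply, eq_comm]
  · simp [symplJ, h.ff i (u i) j (u j)]

theorem mem_symplecticGroup_of_symplForm {C : Fin n ⊕ Fin n → PhaseSpace n}
    (h : ∀ c d, symplForm (C c) (C d) = symplJ n c d) :
    Matrix.of (fun r c => C c r) ∈ Matrix.symplecticGroup (Fin n) ℝ := by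
  have hJ : symplJ n = -Matrix.J (Fin n) ℝ := by
    simp [symplJ, Matrix.J, Matrix.fromBlocks_neg]
  set M : Matrix (Fin n ⊕ Fin n) (Fin n ⊕ Fin n) ℝ := Matrix.of fun r c => C c r with hM
  have h1 : Mᵀ * symplJ n * M = symplJ n := by
    ext c d
    rw [← h c d, symplForm, Matrix.mul_assoc, Matrix.mul_apply]
    rfl
  rw [SymplecticGroup.mem_iff']
  rw [hJ, Matrix.mul_neg, Matrix.neg_mul] at h1
  exact neg_injective h1

theorem jacobiMatrix_mulVec (b : ℝ → ℝ) (s : ℝ) (v : Fin n ⊕ Fin n → ℝ) :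
    jacobiMatrix X b s *ᵥ v =
      ((b s)⁻¹ * symplForm (X s) (WithLp.toLp 2 v)) • (X s).ofLp := by
  rw [jacobiMatrix, Matrix.smul_mulVec, ← Matrix.mulVec_mulVec, Matrix.vecMulVec_mulVec, mul_smul]
  congr 1
  ext i
  simp [symplForm, mul_comm]

theorem jacobiMatrixInFrame_apply (b : ℝ → ℝ)
    (M : ℝ → Matrix (Fin n ⊕ Fin n) (Fin n ⊕ Fin n) ℝ) (s : ℝ) (i j : Fin n ⊕ Fin n) :
    jacobiMatrixInFrame X b M s i j = ((M s)⁻¹ *ᵥ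
      ((jacobiMatrix X b s *ᵥ fun r => M s r j) - fun r => deriv (fun t => M t r j) s)) i := by
  rw [Matrix.mulVec_sub, jacobiMatrixInFrame, Matrix.mul_assoc, Matrix.add_apply, Matrix.neg_apply,
    sub_eq_neg_add]
  rfl

theorem symplJ_mulVec_inl (y : Fin n ⊕ Fin n → ℝ) (i : Fin n) :
    (symplJ n *ᵥ y) (Sum.inl i) = y (Sum.inr i) := by
  rw [symplJ, Matrix.fromBlocks_mulVec]
  simp

theorem symplJ_mulVec_inr (y : Fin n ⊕ Fin n → ℝ) (i : Fin n) :
    (symplJ n *ᵥ y) (Sum.inr i) = -y (Sum.inl i) := by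
  rw [symplJ, Matrix.fromBlocks_mulVec]
  simp [Matrix.neg_mulVec]

/-- The Jacobi equation splits if its data are smooth up to the singular time and the coefficient
has a zero of finite order there. -/
theorem jacobiEquationSplits_of_smooth {b : ℝ → ℝ} {X' : ℝ → PhaseSpace n} {τ : ℝ}
    (hX : ContDiff ℝ ∞ X) (hβ : ContDiff ℝ ∞ β) (hβ0 : ∀ s, 0 < β s) (hk : 1 ≤ k)
    (ha : symplForm (X 0) (deriv X 0) ≠ 0) {δ₀ : ℝ} (hδ₀ : 0 < δ₀)
    (hX' : ∀ s ∈ Icc 0 δ₀, X' (τ + s) = X s)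
    (hb : ∀ s ∈ Ioc 0 δ₀, b (τ + s) = -(s ^ k * β s)) : JacobiEquationSplits X' b τ := by
  obtain ⟨i₀, e, f, hef, hi₀, he₀, hsol⟩ :=
    exists_adapted_symplecticBasis hX hβ (hβ0 0) hk ha
  have hu : ∀ i : Fin n, ∃ η : ℝ → PhaseSpace n, 2 ≤ i.val →
      IsSingularSolution k (jacobiField X β) η ∧ η 0 = e i ∧ ContDiffOn ℝ ∞ η (Ico 0 1) := by
    intro i
    by_cases hi : 2 ≤ i.val
    · obtain ⟨η, h1, h2, h3⟩ := exists_smooth_jacobi_solution hX hβ hβ0 hk ha (hsol i hi).1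
      exact ⟨η, fun _ => ⟨h1, h2, h3 1 one_pos⟩⟩
    · exact ⟨fun _ => 0, fun h => (hi h).elim⟩
  have hv : ∀ i : Fin n, ∃ η : ℝ → PhaseSpace n, 2 ≤ i.val →
      IsSingularSolution k (jacobiField X β) η ∧ η 0 = f i ∧ ContDiffOn ℝ ∞ η (Ico 0 1) := by
    intro i
    by_cases hi : 2 ≤ i.val
    · obtain ⟨η, h1, h2, h3⟩ := exists_smooth_jacobi_solution hX hβ hβ0 hk ha (hsol i hi).2
      exact ⟨η, fun _ => ⟨h1, h2, h3 1 one_pos⟩⟩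
    · exact ⟨fun _ => 0, fun h => (hi h).elim⟩
  choose u hu using hu
  choose v hv using hv
  set A : Finset (Fin n) := Finset.univ.filter fun i => 2 ≤ i.val with hA
  have hmA : ∀ i, i ∈ A ↔ 2 ≤ i.val := fun i => by simp [hA]
  have un := Finset.mem_univ (α := Fin n)
  obtain ⟨δ₁, U, V, hδ₁, -, hag, hUC, hVC, hU0, hV0, hUV⟩ := exists_smooth_symplecticFamily
    (Finset.subset_univ A) hef (u := u) (v := v) one_pos
    (fun i hi => (hu i ((hmA i).1 hi)).2.2) (fun i hi => (hv i ((hmA i).1 hi)).2.2)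
    (fun i hi => (hu i ((hmA i).1 hi)).2.1) (fun i hi => (hv i ((hmA i).1 hi)).2.1)
    (fun s hs => by
      constructor
      · intro i hi j hj
        obtain ⟨h1, h2, h3⟩ := hu i ((hmA i).1 hi)
        obtain ⟨h4, h5, h6⟩ := hu j ((hmA j).1 hj)
        rw [symplForm_eq_of_isSingularSolution h1 h4 h3.continuousOn h6.continuousOn s hs, h2, h5,
          hef.ee i (un i) j (un j)]
      · intro i hi j hj
        obtain ⟨h1, h2, h3⟩ := hv i ((hmA i).1 hi)
        obtain ⟨h4, h5, h6⟩ := hv j ((hmA j).1 hj)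
        rw [symplForm_eq_of_isSingularSolution h1 h4 h3.continuousOn h6.continuousOn s hs, h2, h5,
          hef.ff i (un i) j (un j)]
      · intro i hi j hj
        obtain ⟨h1, h2, h3⟩ := hu i ((hmA i).1 hi)
        obtain ⟨h4, h5, h6⟩ := hv j ((hmA j).1 hj)
        rw [symplForm_eq_of_isSingularSolution h1 h4 h3.continuousOn h6.continuousOn s hs, h2, h5,
          hef.ef i (un i) j (un j)])
  set C : Fin n ⊕ Fin n → ℝ → PhaseSpace n := Sum.elim U V with hC
  have hCC : ∀ c, ContDiffOn ℝ ∞ (C c) (Ico 0 δ₁) := by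
    rintro (i | i)
    · exact hUC i (un i)
    · exact hVC i (un i)
  have hCJ : ∀ s ∈ Ico 0 δ₁, ∀ c d, symplForm (C c s) (C d s) = symplJ n c d := by
    intro s hs c d
    have e : ∀ c, C c s = Sum.elim (fun i => U i s) (fun i => V i s) c := by
      rintro (i | i) <;> rfl
    rw [e, e, (hUV s hs).symplForm_sumElim]
  have hCd : ∀ s ∈ Ioo 0 δ₁, ∀ c, HasDerivAt (C c) (deriv (C c) s) s := fun s hs c =>
    (((hCC c).contDiffAt (mem_of_superset (Ioo_mem_nhds hs.1 hs.2)
      Ioo_subset_Ico_self)).differentiableAt (by simp)).hasDerivAt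
  have hCsol : ∀ c, pairIndex c ∈ A → IsSingularSolution k (jacobiField X β) (C c) := by
    rintro (i | i) hi
    · change IsSingularSolution k (jacobiField X β) (U i)
      rw [(hag i hi).1]
      exact (hu i ((hmA i).1 hi)).1
    · change IsSingularSolution k (jacobiField X β) (V i)
      rw [(hag i hi).2]
      exact (hv i ((hmA i).1 hi)).1
  set δ : ℝ := min δ₀ (δ₁ / 2) with hδ
  have hδ0 : 0 < δ := lt_min hδ₀ (half_pos hδ₁)
  have hδ₁' : δ < δ₁ := (min_le_right _ _).trans_lt (half_lt_self hδ₁)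
  set M : ℝ → Matrix (Fin n ⊕ Fin n) (Fin n ⊕ Fin n) ℝ :=
    fun s => Matrix.of fun r c => C c (s - τ) r with hM
  have hshift : ∀ {s}, s ∈ Icc τ (τ + δ) → s - τ ∈ Ico 0 δ₁ := fun {s} hs =>
    ⟨by linarith [hs.1], by linarith [hs.2]⟩
  have hMsymp : ∀ s ∈ Icc τ (τ + δ), M s ∈ Matrix.symplecticGroup (Fin n) ℝ := fun s hs =>
    mem_symplecticGroup_of_symplForm (C := fun c => C c (s - τ)) (hCJ _ (hshift hs))
  set S : Finset (Fin n) := Finset.univ.filter fun i => i.val < 2 with hS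
  have hSA : ∀ i, i ∉ S → i ∈ A := fun i hi => by
    rw [hS, Finset.mem_filter] at hi
    rw [hmA]
    by_contra h
    exact hi ⟨un i, by omega⟩
  have hbneg : ∀ s ∈ Ioc τ (τ + δ), b s < 0 := fun s hs => by
    have h1 : 0 < s - τ := by linarith [hs.1]
    have := hb (s - τ) ⟨h1, by linarith [hs.2, min_le_left δ₀ (δ₁ / 2)]⟩
    rw [add_sub_cancel] at this
    rw [this]
    have := hβ0 (s - τ)
    have : 0 < (s - τ) ^ k * β (s - τ) := by positivity
    linarith
  -- The frame vectors outside S are solutions, so the corresponding coordinates are constants of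
  -- motion and the regular block is 0.
  refine ⟨δ, hδ0, hbneg, M, fun _ => 0, S, ?_, fun i j => ?_, hMsymp, ⟨i₀, ?_, fun j => ?_⟩,
    fun i j => contDiffOn_const, fun s hs i j => ?_⟩
  · have : S.card ≤ (Finset.range 2).card := by
      refine Finset.card_le_card_of_injOn (fun i => i.val) (fun i hi => ?_)
        (fun i _ j _ h => Fin.ext h)
      simpa [hS] using hi
    simpa using this
  · have h1 : ContDiffOn ℝ ∞ (fun s => C j (s - τ)) (Icc τ (τ + δ)) :=
      (hCC j).comp (contDiff_id.sub contDiff_const).contDiffOn fun s hs => hshift hs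
    exact (contDiffOn_euclidean.1 h1) i
  · simp [hS, hi₀]
  · have h1 : X' τ = X 0 := by simpa using hX' 0 ⟨le_rfl, hδ₀.le⟩
    rw [h1, ← he₀, ← hU0 i₀ (un i₀)]
    simp [hM, hC]
  · have hs' : s - τ ∈ Ioo 0 δ₁ := ⟨by linarith [hs.1], by linarith [hs.2]⟩
    have hs0 : s - τ ∈ Ioc 0 δ₀ :=
      ⟨hs'.1, by linarith [hs.2, min_le_left δ₀ (δ₁ / 2)]⟩
    have hbs : b s = -((s - τ) ^ k * β (s - τ)) := by
      have := hb (s - τ) hs0; rwa [add_sub_cancel] at this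
    have hXs : X' s = X (s - τ) := by
      have := hX' (s - τ) ⟨hs0.1.le, hs0.2⟩; rwa [add_sub_cancel] at this
    set w : Fin n ⊕ Fin n → ℝ := (jacobiMatrix X' b s *ᵥ fun r => M s r j) -
      fun r => deriv (fun t => M t r j) s with hw
    have hwval : WithLp.toLp 2 w =
        ((b s)⁻¹ * symplForm (X (s - τ)) (C j (s - τ))) • X (s - τ) - deriv (C j) (s - τ) := by
      rw [hw, jacobiMatrix_mulVec, hXs]
      ext r
      have h1 : HasDerivAt (fun t => M t r j) (deriv (C j) (s - τ) r) s := by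
        have h2 : HasDerivAt (fun t => C j (t - τ)) (deriv (C j) (s - τ)) s :=
          (hCd _ hs' j).comp_sub_const s τ
        exact (EuclideanSpace.proj r : PhaseSpace n →L[ℝ] ℝ).hasFDerivAt.comp_hasDerivAt s h2
      simp only [PiLp.sub_apply, PiLp.smul_apply, Pi.sub_apply, Pi.smul_apply, h1.deriv]
      rfl
    have hfield : ∀ η, (((s - τ) ^ k)⁻¹ • jacobiField X β (s - τ) η : PhaseSpace n) =
        ((b s)⁻¹ * symplForm (X (s - τ)) η) • X (s - τ) := fun η => by
      rw [jacobiField_apply, smul_smul, hbs, ← neg_inv, mul_inv]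
      congr 1
      ring
    have hentry : jacobiMatrixInFrame X' b M s i j = ((M s)⁻¹ *ᵥ w) i :=
      jacobiMatrixInFrame_apply b M s i j
    have hJw := mulVec_inv_eq_symplForm (hMsymp s ⟨hs.1.le, hs.2.le⟩) w
    -- w is the Jacobi field on the j-th frame vector minus its derivative; it vanishes when that
    -- vector is a solution.
    have hcol : pairIndex j ∉ S → ((M s)⁻¹ *ᵥ w) i = 0 := fun hj => by
      have h1 := ((hCsol j (hSA _ hj)) (s - τ) hs'.1).deriv
      have h2 : (WithLp.toLp 2 w : PhaseSpace n) = 0 := by rw [hwval, h1, hfield, sub_self]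
      have h3 : w = 0 := by simpa using h2
      rw [h3, Matrix.mulVec_zero]
      rfl
    -- For a column j that need not be a solution, differentiate the constant σ(C_c, C_j). As C_c is
    -- a solution and the Jacobi field is infinitesimally symplectic, what is left is the pairing of
    -- C_c with w.
    have hrow : ∀ c, pairIndex c ∉ S → (symplJ n *ᵥ ((M s)⁻¹ *ᵥ w)) c = 0 := fun c hc => by
      rw [hJw c, hwval]
      change symplForm (C c (s - τ)) _ = 0
      have h1 : HasDerivAt (fun r => symplForm (C c r) (C j r)) 0 (s - τ) := by
        refine (hasDerivAt_const (s - τ) (symplJ n c j)).congr_of_eventuallyEq ?_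
        filter_upwards [Ioo_mem_nhds hs'.1 hs'.2] with r hr
        exact hCJ r (Ioo_subset_Ico_self hr) c j
      have h2 := (((hCsol c (hSA _ hc)) (s - τ) hs'.1).symplForm (hCd _ hs' j)).unique h1
      rw [hfield, symplForm_smul_left] at h2
      rw [symplForm_sub_right, symplForm_smul_right, symplForm_swap (C c (s - τ)) (X (s - τ))]
      linarith
    constructor
    · intro h
      rw [hentry]
      by_cases hj : pairIndex j ∈ S
      · have hi : pairIndex i ∉ S := fun hi => h.1 hi hj
        rcases i with i | i
        · have := hrow (Sum.inr i) hi
          rw [symplJ_mulVec_inr] at this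
          linarith
        · have := hrow (Sum.inl i) hi
          rwa [symplJ_mulVec_inl] at this
      · exact hcol hj
    · intro _ hj
      rw [hentry]
      exact hcol hj

end Splitting

/-! ### Normal form of the data to the right of the singular time -/

theorem AnalyticAt.comp_const_add {F : Type*} [NormedAddCommGroup F] [NormedSpace ℝ F] {g : ℝ → F}
    {τ : ℝ} (hg : AnalyticAt ℝ g τ) : AnalyticAt ℝ (fun s => g (τ + s)) 0 :=
  AnalyticAt.fun_comp (by simpa using hg) (analyticAt_const.add analyticAt_id)

theorem tendsto_const_add_nhdsGE (τ : ℝ) : Tendsto (fun s => τ + s) (𝓝[≥] 0) (𝓝[≥] τ) := by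
  refine tendsto_nhdsWithin_iff.2 ⟨?_, ?_⟩
  · exact ((by fun_prop : Continuous fun s : ℝ => τ + s).tendsto' 0 τ (by simp)).mono_left
      nhdsWithin_le_nhds
  · filter_upwards [self_mem_nhdsWithin] with s hs
    simpa using hs

theorem tendsto_const_add_nhdsGT (τ : ℝ) : Tendsto (fun s => τ + s) (𝓝[>] 0) (𝓝[>] τ) := by
  refine tendsto_nhdsWithin_iff.2 ⟨?_, ?_⟩
  · exact ((by fun_prop : Continuous fun s : ℝ => τ + s).tendsto' 0 τ (by simp)).mono_left
      nhdsWithin_le_nhds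
  · filter_upwards [self_mem_nhdsWithin] with s hs
    simpa using hs

/-- A function that is analytic up to the boundary and negative to the right of a zero is, up to a
smooth positive factor, the negative of a power. -/
theorem exists_eventuallyEq_neg_pow_mul {f : ℝ → ℝ} (hf : AnalyticAt ℝ f 0) (h0 : f 0 = 0)
    (hneg : ∀ᶠ s in 𝓝[>] 0, f s < 0) :
    ∃ (k : ℕ) (β : ℝ → ℝ), 1 ≤ k ∧ ContDiff ℝ ∞ β ∧ (∀ s, 0 < β s) ∧
      f =ᶠ[𝓝 0] fun s => -(s ^ k * β s) := by
  obtain ⟨k, g, hg, hg0, hfg⟩ := (hf.exists_eventuallyEq_pow_smul_nonzero_iff).2 fun h => by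
    obtain ⟨s, h1, h2⟩ := (hneg.and (nhdsWithin_le_nhds (s := Ioi (0 : ℝ)) h)).exists
    exact h1.ne h2
  simp only [sub_zero, smul_eq_mul] at hfg
  have hk : 1 ≤ k := by
    by_contra hk
    obtain rfl : k = 0 := by omega
    have := hfg.self_of_nhds
    rw [h0, pow_zero, one_mul] at this
    exact hg0 this.symm
  have hgneg : g 0 < 0 := by
    refine lt_of_le_of_ne ?_ hg0
    refine le_of_tendsto (hg.continuousAt.tendsto.mono_left (nhdsWithin_le_nhds (s := Ioi 0))) ?_
    filter_upwards [hneg, nhdsWithin_le_nhds (s := Ioi (0 : ℝ)) hfg, self_mem_nhdsWithin]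
      with s h1 h2 h3
    rw [h2] at h1
    have h4 : 0 < s ^ k := pow_pos h3 k
    nlinarith
  obtain ⟨g', hg', hgg'⟩ := hg.exists_contDiff_eventuallyEq
  obtain ⟨β, hβ, hβ0, hβe⟩ := (hg'.neg).exists_pos_eventuallyEq (by
    rw [hgg'.self_of_nhds]; linarith)
  refine ⟨k, β, hk, hβ, hβ0, ?_⟩
  filter_upwards [hfg, hgg', hβe] with s h1 h2 h3
  rw [h1, h3, h2]
  ring

/-- The smooth normal form of the data of the Jacobi equation to the right of a singular time. -/
theorem exists_smooth_normal_form {n : ℕ} {T : ℝ} {X : ℝ → PhaseSpace n} {b : ℝ → ℝ}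
    (hX : PiecewiseAnalytic T X) (hb : PiecewiseAnalytic T b) {τ : ℝ} (hτ : 0 ≤ τ) (hτT : τ < T)
    (hbτ : b τ = 0) (hbneg : ∀ᶠ s in 𝓝[>] τ, b s < 0)
    (hσ : symplForm (X τ) (derivWithin X (Ici τ) τ) ≠ 0) :
    ∃ (Y : ℝ → PhaseSpace n) (β : ℝ → ℝ) (k : ℕ) (δ₀ : ℝ), ContDiff ℝ ∞ Y ∧ ContDiff ℝ ∞ β ∧
      (∀ s, 0 < β s) ∧ 1 ≤ k ∧ symplForm (Y 0) (deriv Y 0) ≠ 0 ∧ 0 < δ₀ ∧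
      (∀ s ∈ Icc 0 δ₀, X (τ + s) = Y s) ∧ ∀ s ∈ Ioc 0 δ₀, b (τ + s) = -(s ^ k * β s) := by
  obtain ⟨g, hg, hXg⟩ := hX.1 τ ⟨hτ, hτT⟩
  obtain ⟨f, hf, hbf⟩ := hb.1 τ ⟨hτ, hτT⟩
  obtain ⟨Y, hY, hYg⟩ := (hg.comp_const_add).exists_contDiff_eventuallyEq
  have hf0 : f (τ + 0) = 0 := by
    rw [add_zero, ← hbf.self_of_nhdsWithin (by simp), hbτ]
  have hbf' := (tendsto_const_add_nhdsGE τ).eventually hbf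
  have hXg' := (tendsto_const_add_nhdsGE τ).eventually hXg
  have hGTGE : (𝓝[>] (0 : ℝ)) ≤ 𝓝[≥] 0 := nhdsWithin_mono _ Ioi_subset_Ici_self
  obtain ⟨k, β, hk, hβ, hβ0, hfβ⟩ := exists_eventuallyEq_neg_pow_mul
    (f := fun s => f (τ + s)) hf.comp_const_add hf0 (by
      filter_upwards [(tendsto_const_add_nhdsGT τ).eventually hbneg, hGTGE hbf'] with s h1 h2
      rwa [← h2])
  have hXY : ∀ᶠ s in 𝓝[≥] 0, X (τ + s) = Y s := by
    filter_upwards [hXg', nhdsWithin_le_nhds (s := Ici (0 : ℝ)) hYg] with s h1 h2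
    rw [h1, h2]
  have hbβ : ∀ᶠ s in 𝓝[≥] 0, b (τ + s) = -(s ^ k * β s) := by
    filter_upwards [hbf', nhdsWithin_le_nhds (s := Ici (0 : ℝ)) hfβ] with s h1 h2
    rw [h1, h2]
  obtain ⟨δ₀, hδ₀, hsub⟩ := mem_nhdsGE_iff_exists_Icc_subset.1 (hXY.and hbβ)
  have hX0 : X τ = Y 0 := by simpa using (hsub ⟨le_rfl, le_of_lt hδ₀⟩).1
  have hder : derivWithin X (Ici τ) τ = deriv Y 0 := by
    have h1 : HasDerivAt (fun s => Y (s - τ)) (deriv Y 0) τ := by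
      have := hY.hasDerivAt_of_infty (τ - τ)
      rw [sub_self] at this
      exact HasDerivAt.comp_sub_const τ τ (by rwa [sub_self])
    refine (h1.hasDerivWithinAt.congr_of_eventuallyEq (f := fun s => Y (s - τ)) (s := Ici τ) ?_ ?_).derivWithin
      (uniqueDiffWithinAt_Ici τ)
    · filter_upwards [Icc_mem_nhdsGE (show τ < τ + δ₀ by linarith)] with s hs
      have := (hsub ⟨sub_nonneg.2 hs.1, by linarith [hs.2]⟩ : s - τ ∈ _).1
      rwa [add_sub_cancel] at this
    · simpa using hX0
  exact ⟨Y, β, k, δ₀, hY, hβ, hβ0, hk, by rwa [hX0, hder] at hσ, hδ₀, fun s hs => (hsub hs).1,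
    fun s hs => (hsub ⟨hs.1.le, hs.2⟩).2⟩

/-! ### Integrability of piecewise analytic data -/

section Integrability

variable {E : Type*} [NormedAddCommGroup E] [NormedSpace ℝ E] [CompleteSpace E]

theorem AnalyticAt.integrableAtFilter_of_eventuallyEq {f g : ℝ → E} {s : ℝ} {S : Set ℝ}
    (hS : MeasurableSet S) (hg : AnalyticAt ℝ g s) (hfg : f =ᶠ[𝓝[S] s] g) :
    IntegrableAtFilter f (𝓝[S] s) := by
  obtain ⟨r, hr, hball⟩ := Metric.eventually_nhds_iff_ball.1 hg.eventually_analyticAt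
  obtain ⟨ε, hε, hsub⟩ := Metric.mem_nhdsWithin_iff.1 hfg
  have hcont : ContinuousOn g (Metric.closedBall s (r / 2)) := fun x hx =>
    (hball x (Metric.closedBall_subset_ball (by linarith) hx)).continuousAt.continuousWithinAt
  have hint := hcont.integrableOn_compact (μ := volume) (isCompact_closedBall s (r / 2))
  refine ⟨Metric.ball s (min ε (r / 2)) ∩ S,
    inter_comm S _ ▸ inter_mem_nhdsWithin _ (Metric.ball_mem_nhds _ (lt_min hε (half_pos hr))), ?_⟩
  refine (hint.mono_set ((inter_subset_left.trans
    (Metric.ball_subset_ball (min_le_right _ _))).trans Metric.ball_subset_closedBall)).congr_fun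
    (fun x hx => ?_) (measurableSet_ball.inter hS)
  exact (hsub ⟨Metric.ball_subset_ball (min_le_left _ _) hx.1, hx.2⟩).symm

/-- Analytic germs on both sides of every point give local integrability on the compact interval.
The strict inequality t < T supplies a right germ at the endpoint t as well. -/
theorem PiecewiseAnalytic.integrableOn {T t : ℝ} {f : ℝ → E} (hf : PiecewiseAnalytic T f)
    (ht : t < T) : IntegrableOn f (Ioc 0 t) := by
  have hloc : LocallyIntegrableOn f (Icc 0 t) := by
    intro s hs
    obtain ⟨g, hg, hfg⟩ := hf.1 s ⟨hs.1, hs.2.trans_lt ht⟩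
    have h1 := hg.integrableAtFilter_of_eventuallyEq measurableSet_Ici hfg
    rcases hs.1.eq_or_lt with rfl | h0
    · exact h1.filter_mono (nhdsWithin_mono _ fun x hx => hx.1)
    · obtain ⟨g', hg', hfg'⟩ := hf.2 s ⟨h0, hs.2.trans ht.le⟩
      have h2 := hg'.integrableAtFilter_of_eventuallyEq measurableSet_Iio hfg'
      refine (IntegrableAtFilter.sup_iff.2 ⟨h2, h1⟩).filter_mono ?_
      rw [← nhdsWithin_union, Iio_union_Ici, nhdsWithin_univ]
      exact nhdsWithin_le_nhds
  exact (hloc.integrableOn_isCompact isCompact_Icc).mono_set Ioc_subset_Icc_self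

end Integrability

/-! ### Integration by parts for absolutely continuous curves -/

section IntegrationByParts

variable {n : ℕ}

theorem AbsolutelyContinuousOnInterval.sum {κ : Type*} (s : Finset κ) {f : κ → ℝ → ℝ} {a b : ℝ}
    (h : ∀ i ∈ s, AbsolutelyContinuousOnInterval (f i) a b) :
    AbsolutelyContinuousOnInterval (fun x => ∑ i ∈ s, f i x) a b := by
  classical
  induction s using Finset.induction_on with
  | empty =>
    simpa using (contDiff_const (c := (0 : ℝ)) (𝕜 := ℝ) (n := 1) (E := ℝ)).contDiffOn.absolutelyContinuousOnInterval
      (a := a) (b := b)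
  | insert i s hi ih =>
    simp only [Finset.sum_insert hi]
    exact (h i (Finset.mem_insert_self i s)).add
      (ih fun j hj => h j (Finset.mem_insert_of_mem hj))

theorem integral_ofLp {f : ℝ → PhaseSpace n} {a b : ℝ} (hf : IntervalIntegrable f volume a b)
    (r : Fin n ⊕ Fin n) : (∫ s in a..b, f s) r = ∫ s in a..b, f s r :=
  ((EuclideanSpace.proj r : PhaseSpace n →L[ℝ] ℝ).intervalIntegral_comp_comm hf).symm

theorem intervalIntegrable_ofLp {f : ℝ → PhaseSpace n} {a b : ℝ}
    (hf : IntervalIntegrable f volume a b) (r : Fin n ⊕ Fin n) :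
    IntervalIntegrable (fun s => f s r) volume a b :=
  ⟨(EuclideanSpace.proj r : PhaseSpace n →L[ℝ] ℝ).integrable_comp hf.1,
    (EuclideanSpace.proj r : PhaseSpace n →L[ℝ] ℝ).integrable_comp hf.2⟩

theorem AbsolutelyContinuousOnInterval.congr {f g : ℝ → ℝ} {a b : ℝ}
    (hf : AbsolutelyContinuousOnInterval f a b) (h : EqOn f g (uIcc a b)) :
    AbsolutelyContinuousOnInterval g a b := by
  rw [absolutelyContinuousOnInterval_iff] at hf ⊢
  intro ε hε
  obtain ⟨δ, hδ, H⟩ := hf ε hε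
  refine ⟨δ, hδ, fun I hI hlt => ?_⟩
  refine lt_of_eq_of_lt (Finset.sum_congr rfl fun i hi => ?_) (H I hI hlt)
  have := hI.1 i hi
  rw [h this.1, h this.2]

theorem absolutelyContinuous_primitive_ofLp {f : ℝ → PhaseSpace n} {a b : ℝ}
    (hf : IntervalIntegrable f volume a b) (c : PhaseSpace n) (r : Fin n ⊕ Fin n) :
    AbsolutelyContinuousOnInterval (fun s => (c + ∫ θ in a..s, f θ) r) a b := by
  have h1 := (contDiff_const (c := c r) (𝕜 := ℝ) (n := 1)
    (E := ℝ)).contDiffOn.absolutelyContinuousOnInterval (a := a) (b := b)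
  refine (h1.add ((intervalIntegrable_ofLp hf
    r).absolutelyContinuousOnInterval_intervalIntegral (c := a) left_mem_uIcc)).congr
    fun s hs => ?_
  rw [Pi.add_apply, PiLp.add_apply,
    integral_ofLp (hf.mono_set (uIcc_subset_uIcc_left hs)) r]

/-- Integration by parts for the symplectic form of two absolutely continuous curves. -/
theorem integral_symplForm_primitive {f g : ℝ → PhaseSpace n} {a b : ℝ}
    (hf : IntervalIntegrable f volume a b) (hg : IntervalIntegrable g volume a b)
    (c d : PhaseSpace n) :
    ∫ s in a..b, (symplForm (f s) (d + ∫ θ in a..s, g θ) +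
        symplForm (c + ∫ θ in a..s, f θ) (g s)) =
      symplForm (c + ∫ θ in a..b, f θ) (d + ∫ θ in a..b, g θ) - symplForm c d := by
  have hac : AbsolutelyContinuousOnInterval
      (fun s => symplForm (c + ∫ θ in a..s, f θ) (d + ∫ θ in a..s, g θ)) a b := by
    simp only [symplForm_eq_sum]
    exact AbsolutelyContinuousOnInterval.sum _ fun i _ =>
      ((absolutelyContinuous_primitive_ofLp hf c _).mul
        (absolutelyContinuous_primitive_ofLp hg d _)).sub
      ((absolutelyContinuous_primitive_ofLp hf c _).mul
        (absolutelyContinuous_primitive_ofLp hg d _))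
  have h := hac.integral_deriv_eq_sub
  simp only [intervalIntegral.integral_same, add_zero] at h
  rw [← h]
  refine intervalIntegral.integral_congr_ae ?_
  filter_upwards [hf.ae_hasDerivAt_integral, hg.ae_hasDerivAt_integral] with s h1 h2 hs
  have hs' : s ∈ uIcc a b := uIoc_subset_uIcc hs
  exact (((h1 hs' a left_mem_uIcc).const_add c).symplForm
    ((h2 hs' a left_mem_uIcc).const_add d)).deriv.symm

end IntegrationByParts

/-! ### The Galerkin equations as linear algebra -/

section Variations

variable {n : ℕ} {X : ℝ → PhaseSpace n} {b : ℝ → ℝ} {t : ℝ}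

theorem Variations.integrable_smul {F : Type*} [NormedAddCommGroup F] [NormedSpace ℝ F]
    {f : ℝ → F} (hf : IntegrableOn f (Ioc 0 t)) (v : Variations t) :
    IntegrableOn (fun s => v s • f s) (Ioc 0 t) :=
  Integrable.smul_of_top_right hf (Lp.memLp v)

theorem Variations.intervalIntegrable_smul {F : Type*} [NormedAddCommGroup F] [NormedSpace ℝ F]
    {f : ℝ → F} (hf : IntegrableOn f (Ioc 0 t)) (v : Variations t) {s : ℝ} (hs : s ∈ Icc 0 t) :
    IntervalIntegrable (fun r => v r • f r) volume 0 s :=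
  (intervalIntegrable_iff_integrableOn_Ioc_of_le hs.1).2
    ((v.integrable_smul hf).mono_set (Ioc_subset_Ioc_right hs.2))

theorem continuousOn_variedCurve (hX : IntegrableOn X (Ioc 0 t)) (ht : 0 ≤ t) (ξ : PhaseSpace n)
    (v : Variations t) : ContinuousOn (variedCurve X ξ v) (Icc 0 t) := by
  have := intervalIntegral.continuousOn_primitive_interval'
    (v.intervalIntegrable_smul hX ⟨ht, le_rfl⟩) left_mem_uIcc
  rw [uIcc_of_le ht] at this
  exact continuousOn_const.add this

theorem variedCurve_add (hX : IntegrableOn X (Ioc 0 t)) (ξ ζ : PhaseSpace n) (v w : Variations t)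
    {s : ℝ} (hs : s ∈ Icc 0 t) : variedCurve X (ξ + ζ) (v + w : Variations t) s =
      variedCurve X ξ v s + variedCurve X ζ w s := by
  have h : ∫ θ in (0 : ℝ)..s, (v + w : Variations t) θ • X θ =
      ∫ θ in (0 : ℝ)..s, (v θ • X θ + w θ • X θ) := by
    refine intervalIntegral.integral_congr_ae_restrict ?_
    rw [uIoc_of_le hs.1]
    filter_upwards [ae_restrict_of_ae_restrict_of_subset (Ioc_subset_Ioc_right hs.2)
      (Lp.coeFn_add v w)] with θ hθ
    rw [hθ, Pi.add_apply, add_smul]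
  rw [variedCurve, h, intervalIntegral.integral_add (v.intervalIntegrable_smul hX hs)
    (w.intervalIntegrable_smul hX hs), variedCurve, variedCurve]
  abel

theorem variedCurve_smul (c : ℝ) (ξ : PhaseSpace n) (v : Variations t)
    {s : ℝ} (hs : s ∈ Icc 0 t) : variedCurve X (c • ξ) (c • v : Variations t) s =
      c • variedCurve X ξ v s := by
  have h : ∫ θ in (0 : ℝ)..s, (c • v : Variations t) θ • X θ =
      ∫ θ in (0 : ℝ)..s, c • (v θ • X θ) := by
    refine intervalIntegral.integral_congr_ae_restrict ?_
    rw [uIoc_of_le hs.1]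
    filter_upwards [ae_restrict_of_ae_restrict_of_subset (Ioc_subset_Ioc_right hs.2)
      (Lp.coeFn_smul c v)] with θ hθ
    rw [hθ, Pi.smul_apply, smul_eq_mul, mul_smul]
  rw [variedCurve, h, intervalIntegral.integral_smul, variedCurve, smul_add]

/-- The integrand of the Galerkin equations. -/
noncomputable def galerkinIntegrand (X : ℝ → PhaseSpace n) (b : ℝ → ℝ) (ξ : PhaseSpace n) (v w : ℝ → ℝ)
    (s : ℝ) : ℝ :=
  symplForm (variedCurve X ξ v s) (w s • X s) + b s * (v s * w s)

theorem integrable_symplForm_of_continuousOn {f g : ℝ → PhaseSpace n} (hf : ContinuousOn f (Icc 0 t))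
    (hg : IntegrableOn g (Ioc 0 t)) : IntegrableOn (fun s => symplForm (f s) (g s)) (Ioc 0 t) := by
  obtain ⟨C, hC⟩ := isCompact_Icc.exists_bound_of_continuousOn hf
  have hfm : AEStronglyMeasurable f (volume.restrict (Ioc 0 t)) :=
    (hf.mono Ioc_subset_Icc_self).aestronglyMeasurable measurableSet_Ioc
  refine Integrable.mono' (g := fun s => ‖symplBilin n‖ * C * ‖g s‖) (hg.norm.const_mul _) ?_ ?_
  · exact (symplBilin n).aestronglyMeasurable_comp₂ hfm hg.aestronglyMeasurable
  · filter_upwards [ae_restrict_mem measurableSet_Ioc] with s hs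
    refine ((symplBilin n).le_opNorm₂ (f s) (g s)).trans ?_
    gcongr
    exact hC s (Ioc_subset_Icc_self hs)

theorem integrable_galerkinIntegrand (hX : IntegrableOn X (Ioc 0 t)) (hb : IntegrableOn b (Ioc 0 t))
    (ht : 0 ≤ t) (ξ : PhaseSpace n) (v w : Variations t) :
    IntegrableOn (galerkinIntegrand X b ξ v w) (Ioc 0 t) := by
  refine (integrable_symplForm_of_continuousOn (continuousOn_variedCurve hX ht ξ v)
    (w.integrable_smul hX)).add ?_
  refine (v.integrable_smul (w.integrable_smul hb)).congr (ae_of_all _ fun s => ?_)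
  simp only [smul_eq_mul]
  ring

/-- The bilinear form of the Galerkin equations. -/
noncomputable def galerkinForm (hX : IntegrableOn X (Ioc 0 t)) (hb : IntegrableOn b (Ioc 0 t))
    (ht : 0 ≤ t) : (PhaseSpace n × Variations t) →ₗ[ℝ] Variations t →ₗ[ℝ] ℝ :=
  LinearMap.mk₂ ℝ
    (fun p w => ∫ s in Ioc 0 t, galerkinIntegrand X b p.1 p.2 w s)
    (fun p q w => by
      rw [← integral_add (integrable_galerkinIntegrand hX hb ht _ _ _)
        (integrable_galerkinIntegrand hX hb ht _ _ _)]
      refine integral_congr_ae ?_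
      filter_upwards [ae_restrict_mem measurableSet_Ioc, Lp.coeFn_add p.2 q.2] with s hs h
      simp only [galerkinIntegrand, Prod.fst_add, Prod.snd_add]
      rw [variedCurve_add hX _ _ _ _ (Ioc_subset_Icc_self hs), h, symplForm_add_left, Pi.add_apply]
      ring)
    (fun c p w => by
      rw [smul_eq_mul, ← integral_const_mul]
      refine integral_congr_ae ?_
      filter_upwards [ae_restrict_mem measurableSet_Ioc, Lp.coeFn_smul c p.2] with s hs h
      simp only [galerkinIntegrand, Prod.smul_fst, Prod.smul_snd]
      rw [variedCurve_smul _ _ _ (Ioc_subset_Icc_self hs), h, symplForm_smul_left, Pi.smul_apply,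
        smul_eq_mul]
      ring)
    (fun p w w' => by
      rw [← integral_add (integrable_galerkinIntegrand hX hb ht _ _ _)
        (integrable_galerkinIntegrand hX hb ht _ _ _)]
      refine integral_congr_ae ?_
      filter_upwards [Lp.coeFn_add w w'] with s h
      simp only [galerkinIntegrand]
      rw [h, Pi.add_apply, add_smul, symplForm_add_right]
      ring)
    (fun c p w => by
      rw [smul_eq_mul, ← integral_const_mul]
      refine integral_congr_ae ?_
      filter_upwards [Lp.coeFn_smul c w] with s h
      simp only [galerkinIntegrand]
      rw [h, Pi.smul_apply, smul_eq_mul, mul_smul, symplForm_smul_right]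
      ring)

theorem galerkinForm_apply (hX : IntegrableOn X (Ioc 0 t)) (hb : IntegrableOn b (Ioc 0 t))
    (ht : 0 ≤ t) (ξ : PhaseSpace n) (v w : Variations t) :
    galerkinForm hX hb ht (ξ, v) w = ∫ s in Ioc 0 t, galerkinIntegrand X b ξ v w s := rfl

/-- The end point of a varied curve. -/
noncomputable def variedEndpoint (hX : IntegrableOn X (Ioc 0 t)) (ht : 0 ≤ t) :
    (PhaseSpace n × Variations t) →ₗ[ℝ] PhaseSpace n where
  toFun p := variedCurve X p.1 p.2 t
  map_add' _ _ := variedCurve_add hX _ _ _ _ ⟨ht, le_rfl⟩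
  map_smul' c _ := variedCurve_smul c _ _ ⟨ht, le_rfl⟩

theorem variedEndpoint_apply (hX : IntegrableOn X (Ioc 0 t)) (ht : 0 ≤ t) (ξ : PhaseSpace n)
    (v : Variations t) : variedEndpoint hX ht (ξ, v) = variedCurve X ξ v t := rfl

/-- The solutions of the Galerkin equations. -/
noncomputable def galerkinSolutions (hX : IntegrableOn X (Ioc 0 t)) (hb : IntegrableOn b (Ioc 0 t))
    (ht : 0 ≤ t) (V : Submodule ℝ (Variations t)) : Submodule ℝ (PhaseSpace n × Variations t) where
  carrier := {p | p.1 ∈ verticalPlane n ∧ p.2 ∈ V ∧ ∀ w ∈ V, galerkinForm hX hb ht p w = 0}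
  add_mem' := by
    rintro p q ⟨h1, h2, h3⟩ ⟨h4, h5, h6⟩
    exact ⟨add_mem h1 h4, add_mem h2 h5, fun w hw => by
      rw [map_add, LinearMap.add_apply, h3 w hw, h6 w hw, add_zero]⟩
  zero_mem' := ⟨zero_mem _, zero_mem _, fun w _ => by rw [map_zero, LinearMap.zero_apply]⟩
  smul_mem' := by
    rintro c p ⟨h1, h2, h3⟩
    exact ⟨Submodule.smul_mem _ c h1, Submodule.smul_mem _ c h2, fun w hw => by
      rw [map_smul, LinearMap.smul_apply, h3 w hw, smul_zero]⟩

/-- The endpoints of Galerkin solutions already form a subspace, because curve and integral depend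
linearly on the pair (η₀, v) once X and b are integrable. -/
theorem lPlane_eq_map (hX : IntegrableOn X (Ioc 0 t)) (hb : IntegrableOn b (Ioc 0 t))
    (ht : 0 ≤ t) (V : Submodule ℝ (Variations t)) :
    lPlane X b t V = (galerkinSolutions hX hb ht V).map (variedEndpoint hX ht) := by
  rw [lPlane, ← Submodule.span_eq ((galerkinSolutions hX hb ht V).map (variedEndpoint hX ht))]
  congr 1
  ext η
  constructor
  · rintro ⟨ξ, hξ, v, hv, h, rfl⟩
    refine ⟨(ξ, v), ⟨hξ, hv, fun w hw => ?_⟩, rfl⟩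
    rw [galerkinForm_apply, ← intervalIntegral.integral_of_le ht]
    exact h w hw
  · rintro ⟨⟨ξ, v⟩, ⟨hξ, hv, h⟩, rfl⟩
    refine ⟨ξ, hξ, v, hv, fun w hw => ?_, rfl⟩
    rw [intervalIntegral.integral_of_le ht]
    exact h w hw

end Variations

/-! ### The lower bound for the dimension of 𝓛_t(V) -/

/-- The kernel of A has dimension dim P + dim V − rank A. By `key` and `hinj` the part of it killed
by Φ embeds into the annihilator of the range of A, of dimension dim V − rank A. The image is left
with at least dim P. -/
theorem finrank_le_finrank_map_ker {P V E : Type*} [AddCommGroup P] [Module ℝ P]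
    [FiniteDimensional ℝ P] [AddCommGroup V] [Module ℝ V] [FiniteDimensional ℝ V] [AddCommGroup E]
    [Module ℝ E] (A : (P × V) →ₗ[ℝ] Module.Dual ℝ V) (Φ : (P × V) →ₗ[ℝ] E)
    (key : ∀ p, A p = 0 → Φ p = 0 → ∀ q, A q p.2 = 0) (hinj : ∀ ξ, Φ (ξ, 0) = 0 → ξ = 0) :
    Module.finrank ℝ P ≤ Module.finrank ℝ ((LinearMap.ker A).map Φ) := by
  set N : Submodule ℝ V := (LinearMap.range A).dualCoannihilator with hN
  have h1 : Module.finrank ℝ (LinearMap.range A) + Module.finrank ℝ N = Module.finrank ℝ V :=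
    Subspace.finrank_add_finrank_dualCoannihilator_eq _
  have h2 := LinearMap.finrank_range_add_finrank_ker A
  rw [Module.finrank_prod] at h2
  have h3 := LinearMap.finrank_range_add_finrank_ker (Φ.domRestrict (LinearMap.ker A))
  rw [LinearMap.range_domRestrict] at h3
  have h4 : Module.finrank ℝ (LinearMap.ker (Φ.domRestrict (LinearMap.ker A))) ≤
      Module.finrank ℝ N := by
    let f : LinearMap.ker (Φ.domRestrict (LinearMap.ker A)) →ₗ[ℝ] N :=
      LinearMap.codRestrict N (LinearMap.snd ℝ P V ∘ₗ (LinearMap.ker A).subtype ∘ₗ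
        (LinearMap.ker (Φ.domRestrict (LinearMap.ker A))).subtype)
        fun p => by
          rw [hN, Submodule.mem_dualCoannihilator]
          rintro _ ⟨q, rfl⟩
          exact key p.1.1 p.1.2 p.2 q
    refine LinearMap.finrank_le_finrank_of_injective (f := f) ?_
    rintro ⟨⟨⟨ξ, v⟩, hp⟩, hp'⟩ ⟨⟨⟨ξ', v'⟩, hq⟩, hq'⟩ hf
    have hv : v = v' := congrArg Subtype.val hf
    subst hv
    have h5 : Φ (ξ, v) = 0 := hp'
    have h6 : Φ (ξ', v) = 0 := hq'
    have h7 : ξ - ξ' = 0 := hinj _ (by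
      rw [show ((ξ - ξ', 0) : P × V) = (ξ, v) - (ξ', v) by simp, map_sub, h5, h6, sub_zero])
    obtain rfl : ξ = ξ' := sub_eq_zero.1 h7
    rfl
  omega

section Dimension

variable {n : ℕ} {X : ℝ → PhaseSpace n} {b : ℝ → ℝ} {t : ℝ}

/-- Green's identity: the terms with b are symmetric in v, w and cancel, and the remaining integrand
is the derivative of σ along the two curves. -/
theorem galerkinForm_sub_galerkinForm (hX : IntegrableOn X (Ioc 0 t))
    (hb : IntegrableOn b (Ioc 0 t)) (ht : 0 ≤ t) (ξ ζ : PhaseSpace n) (v w : Variations t) :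
    galerkinForm hX hb ht (ξ, v) w - galerkinForm hX hb ht (ζ, w) v =
      symplForm (variedCurve X ξ v t) (variedCurve X ζ w t) - symplForm ξ ζ := by
  have h := integral_symplForm_primitive (v.intervalIntegrable_smul hX ⟨ht, le_rfl⟩)
    (w.intervalIntegrable_smul hX ⟨ht, le_rfl⟩) ξ ζ
  rw [intervalIntegral.integral_of_le ht] at h
  rw [galerkinForm_apply, galerkinForm_apply, ← integral_sub
    (integrable_galerkinIntegrand hX hb ht _ _ _) (integrable_galerkinIntegrand hX hb ht _ _ _)]
  refine Eq.trans (integral_congr_ae (ae_of_all _ fun s => ?_)) h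
  simp only [galerkinIntegrand]
  rw [symplForm_swap (v s • X s)]
  simp only [variedCurve]
  ring

theorem symplForm_eq_zero_of_mem_verticalPlane {ξ ζ : PhaseSpace n} (hξ : ξ ∈ verticalPlane n)
    (hζ : ζ ∈ verticalPlane n) : symplForm ξ ζ = 0 := by
  rw [symplForm_eq_sum]
  exact Finset.sum_eq_zero fun i _ => by rw [hξ i, hζ i]; ring

theorem le_finrank_verticalPlane (n : ℕ) : n ≤ Module.finrank ℝ (verticalPlane n) := by
  let f : (Fin n → ℝ) →ₗ[ℝ] verticalPlane n :=
    { toFun := fun c => ⟨WithLp.toLp 2 (Sum.elim c fun _ => 0), fun i => rfl⟩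
      map_add' := fun c d => by
        ext r
        rcases r with r | r <;> simp
      map_smul' := fun c d => by
        ext r
        rcases r with r | r <;> simp }
  have hf : Function.Injective f := fun c d h => by
    funext i
    have := congrArg (fun p : verticalPlane n => (p : PhaseSpace n) (Sum.inl i)) h
    exact this
  simpa using LinearMap.finrank_le_finrank_of_injective hf

/-- The planes `𝓛_t(V)` are at least `n`-dimensional. -/
theorem le_finrank_lPlane (hX : IntegrableOn X (Ioc 0 t)) (hb : IntegrableOn b (Ioc 0 t))
    (ht : 0 ≤ t) (V : Submodule ℝ (Variations t)) [FiniteDimensional ℝ V] :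
    n ≤ Module.finrank ℝ (lPlane X b t V) := by
  set P := verticalPlane n with hP
  set ι : (P × V) →ₗ[ℝ] PhaseSpace n × Variations t := P.subtype.prodMap V.subtype with hι
  set A : (P × V) →ₗ[ℝ] Module.Dual ℝ V :=
    V.subtype.dualMap ∘ₗ galerkinForm hX hb ht ∘ₗ ι with hA
  have hAap : ∀ (p : P × V) (w : V), A p w = galerkinForm hX hb ht (p.1, p.2) w := fun _ _ => rfl
  set Φ : (P × V) →ₗ[ℝ] PhaseSpace n := variedEndpoint hX ht ∘ₗ ι with hΦ
  have hΦap : ∀ p : P × V, Φ p = variedCurve X p.1 p.2 t := fun _ => rfl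
  -- Green's identity with zero endpoint and vertical starting points: both boundary terms vanish,
  -- since the vertical plane is isotropic.
  have h := finrank_le_finrank_map_ker A Φ (fun p hp0 hp q => by
      have h5 := galerkinForm_sub_galerkinForm hX hb ht p.1 q.1 p.2 q.2
      rw [← hΦap p, hp, symplForm_zero_left,
        symplForm_eq_zero_of_mem_verticalPlane p.1.2 q.1.2, ← hAap, hp0, LinearMap.zero_apply] at h5
      rw [hAap]
      linarith) (fun ξ hξ => by
      have hcurve : variedCurve X (ξ : PhaseSpace n) ((0 : Variations t) : ℝ → ℝ) t = ξ := by
        have : ∫ θ in (0 : ℝ)..t, (0 : Variations t) θ • X θ = 0 := by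
          rw [intervalIntegral.integral_of_le ht]
          refine integral_eq_zero_of_ae ?_
          filter_upwards [Lp.coeFn_zero ℝ ∞ (volume.restrict (Ioc 0 t))] with s hs
          rw [hs]; simp
        rw [variedCurve, this, add_zero]
      exact Subtype.ext (by rw [hΦap] at hξ; rw [← hcurve]; exact hξ))
  refine (le_finrank_verticalPlane n).trans (h.trans (Submodule.finrank_mono ?_))
  rw [lPlane_eq_map hX hb ht]
  rintro _ ⟨p, hp, rfl⟩
  exact ⟨ι p, ⟨p.1.2, p.2.2, fun w hw =>
    LinearMap.congr_fun (LinearMap.mem_ker.1 hp) (⟨w, hw⟩ : V)⟩, rfl⟩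

end Dimension

/-! ### Concatenation of variations at τ -/

section Gluing

variable {n : ℕ} {X : ℝ → PhaseSpace n} {b : ℝ → ℝ} {τ t : ℝ}

theorem memLp_restrict_variation (hτt : τ ≤ t) (v : Variations t) :
    MemLp v ∞ (volume.restrict (Ioc 0 τ)) :=
  (Lp.memLp v).mono_measure (Measure.restrict_mono (Ioc_subset_Ioc_right hτt) le_rfl)

/-- The restriction of a variation to a shorter interval. -/
noncomputable def restrictVariation (hτt : τ ≤ t) : Variations t →ₗ[ℝ] Variations τ where
  toFun v := (memLp_restrict_variation hτt v).toLp v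
  map_add' v w := by
    refine Lp.ext ?_
    filter_upwards [MemLp.coeFn_toLp (memLp_restrict_variation hτt (v + w)),
      MemLp.coeFn_toLp (memLp_restrict_variation hτt v),
      MemLp.coeFn_toLp (memLp_restrict_variation hτt w),
      ae_restrict_of_ae_restrict_of_subset (Ioc_subset_Ioc_right hτt) (Lp.coeFn_add v w),
      Lp.coeFn_add ((memLp_restrict_variation hτt v).toLp v)
        ((memLp_restrict_variation hτt w).toLp w)] with s h1 h2 h3 h4 h5
    rw [h1, h5, Pi.add_apply, h2, h3, h4, Pi.add_apply]
  map_smul' c v := by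
    refine Lp.ext ?_
    filter_upwards [MemLp.coeFn_toLp (memLp_restrict_variation hτt (c • v)),
      MemLp.coeFn_toLp (memLp_restrict_variation hτt v),
      ae_restrict_of_ae_restrict_of_subset (Ioc_subset_Ioc_right hτt) (Lp.coeFn_smul c v),
      Lp.coeFn_smul c ((memLp_restrict_variation hτt v).toLp v)] with s h1 h2 h3 h4
    rw [h1, RingHom.id_apply, h4, Pi.smul_apply, h2, h3, Pi.smul_apply]

theorem coeFn_restrictVariation (hτt : τ ≤ t) (v : Variations t) :
    restrictVariation hτt v =ᵐ[volume.restrict (Ioc 0 τ)] v :=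
  MemLp.coeFn_toLp (memLp_restrict_variation hτt v)

theorem memLp_extend_variation (hτt : τ ≤ t) (v : Variations τ) :
    MemLp ((Ioc 0 τ).indicator v) ∞ (volume.restrict (Ioc 0 t)) := by
  rw [memLp_indicator_iff_restrict measurableSet_Ioc, Measure.restrict_restrict measurableSet_Ioc,
    inter_eq_left.2 (Ioc_subset_Ioc_right hτt)]
  exact Lp.memLp v

/-- The extension of a variation by zero to a longer interval. -/
noncomputable def extendVariation (hτt : τ ≤ t) : Variations τ →ₗ[ℝ] Variations t where
  toFun v := (memLp_extend_variation hτt v).toLp _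
  map_add' v w := by
    refine Lp.ext ?_
    filter_upwards [MemLp.coeFn_toLp (memLp_extend_variation hτt (v + w)),
      MemLp.coeFn_toLp (memLp_extend_variation hτt v),
      MemLp.coeFn_toLp (memLp_extend_variation hτt w),
      ae_restrict_of_ae ((ae_restrict_iff' measurableSet_Ioc).1 (Lp.coeFn_add v w)),
      Lp.coeFn_add ((memLp_extend_variation hτt v).toLp _)
        ((memLp_extend_variation hτt w).toLp _)] with s h1 h2 h3 h4 h5
    rw [h1, h5, Pi.add_apply, h2, h3]
    by_cases hs : s ∈ Ioc 0 τ
    · rw [indicator_of_mem hs, indicator_of_mem hs, indicator_of_mem hs, h4 hs, Pi.add_apply]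
    · simp [indicator_of_notMem hs]
  map_smul' c v := by
    refine Lp.ext ?_
    filter_upwards [MemLp.coeFn_toLp (memLp_extend_variation hτt (c • v)),
      MemLp.coeFn_toLp (memLp_extend_variation hτt v),
      ae_restrict_of_ae ((ae_restrict_iff' measurableSet_Ioc).1 (Lp.coeFn_smul c v)),
      Lp.coeFn_smul c ((memLp_extend_variation hτt v).toLp _)] with s h1 h2 h3 h4
    rw [h1, RingHom.id_apply, h4, Pi.smul_apply, h2]
    by_cases hs : s ∈ Ioc 0 τ
    · rw [indicator_of_mem hs, indicator_of_mem hs, h3 hs, Pi.smul_apply]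
    · simp [indicator_of_notMem hs]

theorem coeFn_extendVariation (hτt : τ ≤ t) (v : Variations τ) :
    extendVariation hτt v =ᵐ[volume.restrict (Ioc 0 t)] (Ioc 0 τ).indicator v :=
  MemLp.coeFn_toLp (memLp_extend_variation hτt v)

theorem coeFn_extendVariation_left (hτt : τ ≤ t) (v : Variations τ) :
    extendVariation hτt v =ᵐ[volume.restrict (Ioc 0 τ)] v := by
  filter_upwards [ae_restrict_of_ae_restrict_of_subset (Ioc_subset_Ioc_right hτt)
    (coeFn_extendVariation hτt v), ae_restrict_mem measurableSet_Ioc] with s h1 h2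
  rw [h1, indicator_of_mem h2]

theorem coeFn_extendVariation_right (hτ : 0 ≤ τ) (hτt : τ ≤ t) (v : Variations τ) :
    extendVariation hτt v =ᵐ[volume.restrict (Ioc τ t)] 0 := by
  filter_upwards [ae_restrict_of_ae_restrict_of_subset (Ioc_subset_Ioc_left hτ)
    (coeFn_extendVariation hτt v), ae_restrict_mem measurableSet_Ioc] with s h1 h2
  rw [h1, indicator_of_notMem fun h => (h.2.trans_lt h2.1).false]
  rfl

theorem ae_eq_restrict_Ioc_of_split {F : Type*} {f g : ℝ → F} (hτ : 0 ≤ τ) (hτt : τ ≤ t)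
    (h1 : f =ᵐ[volume.restrict (Ioc 0 τ)] g) (h2 : f =ᵐ[volume.restrict (Ioc τ t)] g) :
    f =ᵐ[volume.restrict (Ioc 0 t)] g := by
  rw [← Ioc_union_Ioc_eq_Ioc hτ hτt]
  exact (ae_restrict_union_iff _ _ _).2 ⟨h1, h2⟩

theorem variedCurve_congr_ae {ξ : PhaseSpace n} {v w : ℝ → ℝ} {s : ℝ} (hs : 0 ≤ s)
    (h : v =ᵐ[volume.restrict (Ioc 0 s)] w) : variedCurve X ξ v s = variedCurve X ξ w s := by
  rw [variedCurve, variedCurve, intervalIntegral.integral_of_le hs,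
    intervalIntegral.integral_of_le hs]
  congr 1
  refine integral_congr_ae ?_
  filter_upwards [h] with r hr
  rw [hr]

theorem variedCurve_eq_of_ae_zero {ξ : PhaseSpace n} {v : ℝ → ℝ} {s : ℝ} (hτ : 0 ≤ τ)
    (hs : τ ≤ s) (h : v =ᵐ[volume.restrict (Ioc τ s)] 0) :
    variedCurve X ξ v s = variedCurve X ξ v τ := by
  rw [variedCurve, variedCurve, intervalIntegral.integral_of_le hτ,
    intervalIntegral.integral_of_le (hτ.trans hs)]
  congr 1
  refine setIntegral_eq_of_subset_of_ae_sdiff_eq_zero measurableSet_Ioc.nullMeasurableSet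
    (Ioc_subset_Ioc_right hs) ?_
  filter_upwards [(ae_restrict_iff' measurableSet_Ioc).1 h] with r hr hmem
  have : r ∈ Ioc τ s := ⟨by
    by_contra hlt
    exact hmem.2 ⟨hmem.1.1, not_lt.1 hlt⟩, hmem.1.2⟩
  rw [hr this, Pi.zero_apply, zero_smul]

theorem variedCurve_eq_add (ξ : PhaseSpace n) (v : ℝ → ℝ) (s : ℝ) :
    variedCurve X ξ v s = ξ + variedCurve X 0 v s := by simp [variedCurve]

/-- Extending an element of `𝓛_τ(V₀)` by a solution of the Galerkin equations on `(τ, t]`. -/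
theorem variedCurve_mem_lPlane_sup (hτ : 0 ≤ τ) (hτt : τ ≤ t) (hX : IntegrableOn X (Ioc 0 t))
    (hb : IntegrableOn b (Ioc 0 t)) {V₀ : Submodule ℝ (Variations τ)}
    {V₁ : Submodule ℝ (Variations t)}
    (hV₁ : ∀ w ∈ V₁, w =ᵐ[volume.restrict (Ioc 0 τ)] 0) {ξ : PhaseSpace n}
    (hξ : ξ ∈ lPlane X b τ V₀) {v₁ : Variations t} (hv₁ : v₁ ∈ V₁)
    (hG : ∀ w ∈ V₁, galerkinForm hX hb (hτ.trans hτt) (ξ, v₁) w = 0) :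
    variedCurve X ξ v₁ t ∈ lPlane X b t (V₀.map (extendVariation hτt) ⊔ V₁) := by
  have ht := hτ.trans hτt
  have hX' : IntegrableOn X (Ioc 0 τ) := hX.mono_set (Ioc_subset_Ioc_right hτt)
  have hb' : IntegrableOn b (Ioc 0 τ) := hb.mono_set (Ioc_subset_Ioc_right hτt)
  rw [lPlane_eq_map hX' hb' hτ] at hξ
  obtain ⟨⟨ξ₀, v₀⟩, ⟨hξ₀, hv₀, hG₀⟩, hend⟩ := hξ
  simp only at hξ₀ hv₀
  rw [variedEndpoint_apply] at hend
  -- The concatenated control. Up to τ the curve is the one ending at ξ, afterwards the one starting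
  -- at ξ. Tests supported in (0, τ] see only the equations for v₀, and tests in V₁ only those for
  -- v₁.
  set v : Variations t := extendVariation hτt v₀ + v₁ with hv
  have hvl : v =ᵐ[volume.restrict (Ioc 0 τ)] v₀ := by
    filter_upwards [ae_restrict_of_ae_restrict_of_subset (Ioc_subset_Ioc_right hτt)
      (Lp.coeFn_add (extendVariation hτt v₀) v₁), coeFn_extendVariation_left hτt v₀,
      hV₁ v₁ hv₁] with s h1 h2 h3
    rw [h1, Pi.add_apply, h2, h3, Pi.zero_apply, add_zero]
  have hvr : v =ᵐ[volume.restrict (Ioc τ t)] v₁ := by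
    filter_upwards [ae_restrict_of_ae_restrict_of_subset (Ioc_subset_Ioc_left hτ)
      (Lp.coeFn_add (extendVariation hτt v₀) v₁), coeFn_extendVariation_right hτ hτt v₀]
      with s h1 h2
    rw [h1, Pi.add_apply, h2, Pi.zero_apply, zero_add]
  have hcl : ∀ s ∈ Icc 0 τ, variedCurve X ξ₀ v s = variedCurve X ξ₀ v₀ s := fun s hs =>
    variedCurve_congr_ae hs.1 (ae_restrict_of_ae_restrict_of_subset (Ioc_subset_Ioc_right hs.2) hvl)
  have hcr : ∀ s ∈ Icc τ t, variedCurve X ξ₀ v s = variedCurve X ξ v₁ s := fun s hs => by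
    have h1 := variedCurve_add hX ξ₀ 0 (extendVariation hτt v₀) v₁ ⟨hτ.trans hs.1, hs.2⟩
    rw [add_zero] at h1
    rw [hv, h1, variedCurve_eq_add ξ, ← hend]
    congr 1
    rw [variedCurve_eq_of_ae_zero hτ hs.1 (ae_restrict_of_ae_restrict_of_subset
      (Ioc_subset_Ioc_right hs.2) (coeFn_extendVariation_right hτ hτt v₀)),
      variedCurve_congr_ae hτ (coeFn_extendVariation_left hτt v₀)]
  rw [← hcr t ⟨hτt, le_rfl⟩, lPlane_eq_map hX hb ht]
  refine ⟨(ξ₀, v), ⟨hξ₀, add_mem (Submodule.mem_sup_left ⟨v₀, hv₀, rfl⟩)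
    (Submodule.mem_sup_right hv₁), fun w hw => ?_⟩, rfl⟩
  obtain ⟨_, ⟨w₀, hw₀, rfl⟩, w₁, hw₁, rfl⟩ := Submodule.mem_sup.1 hw
  rw [map_add]
  have e1 : galerkinForm hX hb ht (ξ₀, v) (extendVariation hτt w₀) = 0 := by
    refine Eq.trans ?_ (hG₀ w₀ hw₀)
    rw [galerkinForm_apply, galerkinForm_apply]
    refine Eq.trans (setIntegral_eq_of_subset_of_ae_sdiff_eq_zero
      measurableSet_Ioc.nullMeasurableSet (Ioc_subset_Ioc_right hτt) ?_) ?_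
    · filter_upwards [(ae_restrict_iff' measurableSet_Ioc).1
        (coeFn_extendVariation_right hτ hτt w₀)] with r hr hmem
      have : r ∈ Ioc τ t := ⟨by
        by_contra hlt
        exact hmem.2 ⟨hmem.1.1, not_lt.1 hlt⟩, hmem.1.2⟩
      rw [galerkinIntegrand, hr this]
      simp
    · refine integral_congr_ae ?_
      filter_upwards [ae_restrict_mem measurableSet_Ioc, coeFn_extendVariation_left hτt w₀, hvl]
        with s h1 h2 h3
      rw [galerkinIntegrand, galerkinIntegrand, hcl s (Ioc_subset_Icc_self h1), h2, h3]
  have e2 : galerkinForm hX hb ht (ξ₀, v) w₁ = 0 := by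
    refine Eq.trans ?_ (hG w₁ hw₁)
    rw [galerkinForm_apply, galerkinForm_apply]
    refine integral_congr_ae ?_
    refine ae_eq_restrict_Ioc_of_split hτ hτt ?_ ?_
    · filter_upwards [hV₁ w₁ hw₁] with s h1
      rw [galerkinIntegrand, galerkinIntegrand, h1]
      simp
    · filter_upwards [ae_restrict_mem measurableSet_Ioc, hvr] with s h1 h2
      rw [galerkinIntegrand, galerkinIntegrand, hcr s (Ioc_subset_Icc_self h1), h2]
  rw [e1, e2, add_zero]

end Gluing

/-! ### Energy estimate for controls of mean zero -/

section Energy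

variable {n : ℕ}

/-- Integration by parts for an absolutely continuous and a differentiable function. -/
theorem integral_mul_eq_sub_integral_primitive_mul {v : ℝ → ℝ} {a b : ℝ}
    (hv : IntervalIntegrable v volume a b) {g g' : ℝ → ℝ} (hg : ∀ s, HasDerivAt g (g' s) s)
    (hg' : Continuous g') : ∫ s in a..b, v s * g s =
      (∫ s in a..b, v s) * g b - ∫ s in a..b, (∫ r in a..s, v r) * g' s := by
  have hgC : ContDiff ℝ 1 g := contDiff_one_iff_deriv.2 ⟨fun s => (hg s).differentiableAt, by
    rwa [funext fun s => (hg s).deriv]⟩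
  have hu := hv.absolutelyContinuousOnInterval_intervalIntegral (c := a) left_mem_uIcc
  have h := (hu.mul hgC.contDiffOn.absolutelyContinuousOnInterval).integral_deriv_eq_sub
  simp only [Pi.mul_apply, intervalIntegral.integral_same, zero_mul, sub_zero] at h
  rw [← h, eq_comm, sub_eq_iff_eq_add, ← intervalIntegral.integral_add
    (hv.mul_continuousOn hgC.continuous.continuousOn)
    ((hu.continuousOn.fun_mul hg'.continuousOn).intervalIntegrable)]
  refine intervalIntegral.integral_congr_ae ?_
  filter_upwards [hv.ae_hasDerivAt_integral] with s h1 hs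
  exact ((h1 (uIoc_subset_uIcc hs) a left_mem_uIcc).mul (hg s)).deriv

theorem integral_smul_eq_sub_integral_primitive_smul {v : ℝ → ℝ} {a b : ℝ}
    (hv : IntervalIntegrable v volume a b) {G G' : ℝ → PhaseSpace n}
    (hG : ∀ s, HasDerivAt G (G' s) s) (hG' : Continuous G') : ∫ s in a..b, v s • G s =
      (∫ s in a..b, v s) • G b - ∫ s in a..b, (∫ r in a..s, v r) • G' s := by
  have hGc : Continuous G := continuous_iff_continuousAt.2 fun s => (hG s).continuousAt
  have hu := hv.absolutelyContinuousOnInterval_intervalIntegral (c := a) left_mem_uIcc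
  have h1 : IntervalIntegrable (fun s => v s • G s) volume a b :=
    hv.smul_continuousOn hGc.continuousOn
  have h2 : IntervalIntegrable (fun s => (∫ r in a..s, v r) • G' s) volume a b :=
    (hu.continuousOn.smul hG'.continuousOn).intervalIntegrable
  ext r
  rw [PiLp.sub_apply, integral_ofLp h1, integral_ofLp h2, PiLp.smul_apply]
  exact integral_mul_eq_sub_integral_primitive_mul hv (g := fun s => G s r)
    (fun s => (EuclideanSpace.proj r : PhaseSpace n →L[ℝ] ℝ).hasFDerivAt.comp_hasDerivAt s (hG s))
    ((EuclideanSpace.proj r : PhaseSpace n →L[ℝ] ℝ).continuous.comp hG')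

variable {v : ℝ → ℝ} {G G' : ℝ → PhaseSpace n} {τ t : ℝ}

theorem continuous_primitive_of_integrable (hv : Integrable v) (τ : ℝ) :
    Continuous fun s => ∫ r in τ..s, v r :=
  intervalIntegral.continuous_primitive (fun _ _ => hv.intervalIntegrable) τ

/-- The energy identity for a control with mean zero. -/
theorem integral_symplForm_eq_of_mean_zero (hv : Integrable v) (hG : ∀ s, HasDerivAt G (G' s) s)
    (hG' : Continuous G') (hu : ∫ s in τ..t, v s = 0) (ξ : PhaseSpace n) :
    ∫ s in τ..t, symplForm (ξ + ∫ r in τ..s, v r • G r) (v s • G s) =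
      -∫ s in τ..t, (symplForm (G s) (G' s) * (∫ r in τ..s, v r) ^ 2 +
        symplForm (ξ - ∫ r in τ..s, (∫ q in τ..r, v q) • G' r) (G' s) * ∫ r in τ..s, v r) := by
  set u : ℝ → ℝ := fun s => ∫ r in τ..s, v r with hu_def
  have huc : Continuous u := continuous_primitive_of_integrable hv τ
  have hGc : Continuous G := continuous_iff_continuousAt.2 fun s => (hG s).continuousAt
  -- With u the primitive of v, the curve is ζ + u G, where ζ' = −u G' no longer contains v. A
  -- further integration by parts of v σ(ζ, G) has no boundary term because u vanishes at both ends.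
  set ζ : ℝ → PhaseSpace n := fun s => ξ - ∫ r in τ..s, u r • G' r with hζ
  have huG : Continuous fun s => u s • G' s := huc.smul hG'
  have hζd : ∀ s, HasDerivAt ζ (-(u s • G' s)) s := fun s =>
    ((intervalIntegral.integral_hasDerivAt_right (huG.intervalIntegrable _ _)
      huG.stronglyMeasurable.stronglyMeasurableAtFilter huG.continuousAt).const_sub ξ)
  have hζc : Continuous ζ := continuous_iff_continuousAt.2 fun s => (hζd s).continuousAt
  have hη : ∀ s, ξ + ∫ r in τ..s, v r • G r = ζ s + u s • G s := fun s => by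
    rw [integral_smul_eq_sub_integral_primitive_smul hv.intervalIntegrable hG hG', hζ]
    simp only [hu_def]
    abel
  have hφd : ∀ s, HasDerivAt (fun s => symplForm (ζ s) (G s))
      (symplForm (G s) (G' s) * u s + symplForm (ζ s) (G' s)) s := fun s => by
    refine ((hζd s).symplForm (hG s)).congr_deriv ?_
    rw [← neg_smul, symplForm_smul_left, symplForm_swap (G' s)]
    ring
  have hφ'c : Continuous fun s => symplForm (G s) (G' s) * u s + symplForm (ζ s) (G' s) :=
    ((hGc.symplForm hG').mul huc).add (hζc.symplForm hG')
  have h := integral_mul_eq_sub_integral_primitive_mul (hv.intervalIntegrable (a := τ) (b := t))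
    hφd hφ'c
  rw [hu, zero_mul, zero_sub] at h
  rw [intervalIntegral.integral_congr (g := fun s => v s * symplForm (ζ s) (G s)) fun s _ => by
    simp only [hη s, symplForm_add_left, symplForm_smul_left, symplForm_smul_right, symplForm_self]
    ring, h]
  congr 1
  refine intervalIntegral.integral_congr fun s _ => ?_
  ring

/-- Cauchy–Schwarz, in the form that the variance of |u| is nonnegative. -/
theorem sq_integral_abs_le {u : ℝ → ℝ} (hu : Continuous u) (hτt : τ < t) :
    (∫ s in τ..t, |u s|) ^ 2 ≤ (t - τ) * ∫ s in τ..t, u s ^ 2 := by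
  set m := (∫ s in τ..t, |u s|) / (t - τ) with hm
  have hδ : 0 < t - τ := sub_pos.2 hτt
  have h1 : 0 ≤ ∫ s in τ..t, (|u s| - m) ^ 2 :=
    intervalIntegral.integral_nonneg hτt.le fun s _ => sq_nonneg _
  have i1 : IntervalIntegrable (fun s => u s ^ 2) volume τ t := (hu.pow 2).intervalIntegrable _ _
  have i2 : IntervalIntegrable (fun s => 2 * m * |u s|) volume τ t :=
    (continuous_const.mul hu.abs).intervalIntegrable _ _
  have i3 : IntervalIntegrable (fun _ => m ^ 2) volume τ t := continuous_const.intervalIntegrable _ _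
  have h2 : ∫ s in τ..t, (|u s| - m) ^ 2 =
      (∫ s in τ..t, u s ^ 2) - 2 * m * (∫ s in τ..t, |u s|) + (t - τ) * m ^ 2 := by
    rw [← intervalIntegral.integral_const_mul, ← intervalIntegral.integral_sub i1 i2,
      show (t - τ) * m ^ 2 = ∫ _ in τ..t, m ^ 2 by simp,
      ← intervalIntegral.integral_add (i1.sub i2) i3]
    refine intervalIntegral.integral_congr fun s _ => ?_
    rw [sub_sq, sq_abs]
    ring
  have h3 : ∫ s in τ..t, |u s| = m * (t - τ) := by rw [hm]; field_simp
  rw [h2, h3] at h1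
  rw [h3]
  nlinarith

/-- The energy estimate for a control with mean zero that solves the Galerkin equation tested with
itself, in the case where the second order Legendre condition holds. -/
theorem integral_abs_primitive_le {b : ℝ → ℝ} (hv : Integrable v)
    (hG : ∀ s, HasDerivAt G (G' s) s)
    (hG' : Continuous G') (hτt : τ < t) (hu : ∫ s in τ..t, v s = 0) (ξ : PhaseSpace n)
    {a₀ C K : ℝ} (ha₀ : 0 < a₀) (ha : ∀ s ∈ Icc τ t, a₀ ≤ symplForm (G s) (G' s))
    (hC0 : 0 ≤ C) (hC : ∀ s ∈ Icc τ t, ‖G' s‖ ≤ C) (hK : K = ‖symplBilin n‖)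
    (hsmall : (t - τ) * (K * C ^ 2) ≤ a₀ / 2)
    (hb : ∀ s ∈ Ioc τ t, b s < 0)
    (hgal : ∫ s in τ..t, symplForm (ξ + ∫ r in τ..s, v r • G r) (v s • G s) =
      -∫ s in τ..t, b s * (v s * v s))
    (hbi : IntervalIntegrable (fun s => b s * (v s * v s)) volume τ t) :
    (∫ s in τ..t, |∫ r in τ..s, v r|) ≤ 2 * (t - τ) * K * C / a₀ * ‖ξ‖ ∧
      (ξ = 0 → v =ᵐ[volume.restrict (Ioc τ t)] 0) := by
  rw [integral_symplForm_eq_of_mean_zero hv hG hG' hu, neg_inj] at hgal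
  set u : ℝ → ℝ := fun s => ∫ r in τ..s, v r with hu_def
  have huc : Continuous u := continuous_primitive_of_integrable hv τ
  have hGc : Continuous G := continuous_iff_continuousAt.2 fun s => (hG s).continuousAt
  set ζ : ℝ → PhaseSpace n := fun s => ξ - ∫ r in τ..s, u r • G' r with hζ
  have huG : Continuous fun s => u s • G' s := huc.smul hG'
  have hζc : Continuous ζ := continuous_const.sub
    (intervalIntegral.continuous_primitive (fun _ _ => huG.intervalIntegrable _ _) τ)
  have hK0 : 0 ≤ K := hK ▸ (symplBilin n).opNorm_nonneg
  set U₁ := ∫ s in τ..t, |u s| with hU₁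
  set U₂ := ∫ s in τ..t, u s ^ 2 with hU₂
  have hU₁0 : 0 ≤ U₁ := intervalIntegral.integral_nonneg hτt.le fun s _ => abs_nonneg _
  have hCS : U₁ ^ 2 ≤ (t - τ) * U₂ := sq_integral_abs_le huc hτt
  have i1 : IntervalIntegrable (fun s => symplForm (G s) (G' s) * u s ^ 2) volume τ t :=
    ((hGc.symplForm hG').mul (huc.pow 2)).intervalIntegrable _ _
  have i2 : IntervalIntegrable (fun s => symplForm (ζ s) (G' s) * u s) volume τ t :=
    ((hζc.symplForm hG').mul huc).intervalIntegrable _ _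
  rw [intervalIntegral.integral_add i1 i2] at hgal
  have hneg : ∫ s in τ..t, b s * (v s * v s) ≤ 0 := by
    rw [intervalIntegral.integral_of_le hτt.le]
    refine setIntegral_nonpos measurableSet_Ioc fun s hs => ?_
    exact mul_nonpos_of_nonpos_of_nonneg (hb s hs).le (mul_self_nonneg _)
  have hlow : a₀ * U₂ ≤ ∫ s in τ..t, symplForm (G s) (G' s) * u s ^ 2 := by
    rw [hU₂, ← intervalIntegral.integral_const_mul]
    refine intervalIntegral.integral_mono_on hτt.le
      ((continuous_const.mul (huc.pow 2)).intervalIntegrable _ _) i1 fun s hs => ?_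
    exact mul_le_mul_of_nonneg_right (ha s hs) (sq_nonneg _)
  have hζb : ∀ s ∈ Icc τ t, ‖ζ s‖ ≤ ‖ξ‖ + C * U₁ := fun s hs => by
    refine (norm_sub_le _ _).trans (add_le_add le_rfl ?_)
    calc ‖∫ r in τ..s, u r • G' r‖ ≤ ∫ r in τ..s, ‖u r • G' r‖ :=
          intervalIntegral.norm_integral_le_integral_norm hs.1
      _ ≤ ∫ r in τ..s, C * |u r| := by
          refine intervalIntegral.integral_mono_on hs.1 (huG.norm.intervalIntegrable _ _)
            ((continuous_const.mul huc.abs).intervalIntegrable _ _) fun r hr => ?_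
          rw [norm_smul, mul_comm, Real.norm_eq_abs]
          exact mul_le_mul_of_nonneg_right (hC r ⟨hr.1, hr.2.trans hs.2⟩) (abs_nonneg _)
      _ ≤ ∫ r in τ..t, C * |u r| := by
          refine intervalIntegral.integral_mono_interval le_rfl hs.1 hs.2
            (ae_of_all _ fun r => by positivity)
            ((continuous_const.mul huc.abs).intervalIntegrable _ _)
      _ = C * U₁ := intervalIntegral.integral_const_mul _ _
  have hup : |∫ s in τ..t, symplForm (ζ s) (G' s) * u s| ≤ K * (‖ξ‖ + C * U₁) * C * U₁ := by
    rw [hU₁, ← intervalIntegral.integral_const_mul]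
    refine (intervalIntegral.abs_integral_le_integral_abs hτt.le).trans
      (intervalIntegral.integral_mono_on hτt.le i2.abs
        ((continuous_const.mul huc.abs).intervalIntegrable _ _) fun s hs => ?_)
    rw [abs_mul]
    refine mul_le_mul_of_nonneg_right ?_ (abs_nonneg _)
    refine ((symplBilin n).le_opNorm₂ (ζ s) (G' s)).trans ?_
    rw [← hK]
    exact mul_le_mul (mul_le_mul_of_nonneg_left (hζb s hs) hK0) (hC s hs) (norm_nonneg _)
      (by positivity)
  have hδ : 0 < t - τ := sub_pos.2 hτt
  -- As b < 0, the quadratic term a₀ ∫ u² is bounded by the mixed term. Cauchy–Schwarz turns this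
  -- into an inequality for U₁, and `hsmall` absorbs the part quadratic in U₁ into the left side.
  have hmain : U₁ ≤ 2 * (t - τ) * K * C / a₀ * ‖ξ‖ := by
    have h1 : a₀ * U₂ ≤ K * (‖ξ‖ + C * U₁) * C * U₁ := by
      have := (abs_le.1 hup).1
      linarith
    have h2 : a₀ * U₁ ^ 2 ≤ (t - τ) * (K * (‖ξ‖ + C * U₁) * C * U₁) := by nlinarith
    have h3 : (t - τ) * (K * C ^ 2) * U₁ ^ 2 ≤ a₀ / 2 * U₁ ^ 2 :=
      mul_le_mul_of_nonneg_right hsmall (sq_nonneg _)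
    have h4 : a₀ / 2 * U₁ ^ 2 ≤ (t - τ) * K * C * ‖ξ‖ * U₁ := by nlinarith
    rcases hU₁0.eq_or_lt with h0 | h0
    · rw [← h0]; positivity
    · have h5 : a₀ / 2 * U₁ ≤ (t - τ) * K * C * ‖ξ‖ := by
        refine le_of_mul_le_mul_right ?_ h0
        nlinarith
      rw [div_mul_eq_mul_div, le_div_iff₀ ha₀]
      nlinarith
  refine ⟨hmain, fun hξ => ?_⟩
  rw [hξ, norm_zero, mul_zero] at hmain
  have hU0 : U₁ = 0 := le_antisymm hmain hU₁0
  rw [hU0, mul_zero, abs_nonpos_iff] at hup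
  have hU₂0 : 0 ≤ U₂ := intervalIntegral.integral_nonneg hτt.le fun s _ => sq_nonneg _
  -- For ξ = 0 the mixed term vanishes, so the integral of b v² is squeezed between a nonnegative
  -- quantity and 0; strict negativity of b then gives v = 0.
  have hzero : ∫ s in τ..t, b s * (v s * v s) = 0 := by
    refine le_antisymm hneg ?_
    rw [← hgal, hup, add_zero]
    exact (mul_nonneg ha₀.le hU₂0).trans hlow
  rw [intervalIntegral.integral_of_le hτt.le, ← neg_eq_zero, ← integral_neg] at hzero
  have hae := (setIntegral_eq_zero_iff_of_nonneg_ae ?_ hbi.1.neg).1 hzero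
  · filter_upwards [hae, ae_restrict_mem measurableSet_Ioc] with s h1 h2
    have h3 : b s * (v s * v s) = 0 := neg_eq_zero.1 h1
    simpa using (mul_eq_zero.1 h3).resolve_left (hb s h2).ne
  · filter_upwards [ae_restrict_mem measurableSet_Ioc] with s hs
    exact neg_nonneg.2 (mul_nonpos_of_nonpos_of_nonneg (hb s hs).le (mul_self_nonneg (v s)))

end Energy

/-! ### Continuation beyond τ in the case σ(X, X') > 0 -/

/-- Rank–nullity for a system with at most one equation too many: the kernel has dimension at least
dim P − 1, and it projects injectively to P because v is determined by ξ. -/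
theorem finrank_le_finrank_map_fst_ker_add_one {P V W : Type*} [AddCommGroup P] [Module ℝ P]
    [FiniteDimensional ℝ P] [AddCommGroup V] [Module ℝ V] [FiniteDimensional ℝ V]
    [AddCommGroup W] [Module ℝ W] [FiniteDimensional ℝ W] (Ψ : (P × V) →ₗ[ℝ] W)
    (hinj : ∀ v, Ψ (0, v) = 0 → v = 0)
    (hW : Module.finrank ℝ W ≤ Module.finrank ℝ V + 1) :
    Module.finrank ℝ P ≤
      Module.finrank ℝ ((LinearMap.ker Ψ).map (LinearMap.fst ℝ P V)) + 1 := by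
  have h2 := LinearMap.finrank_range_add_finrank_ker Ψ
  rw [Module.finrank_prod] at h2
  have h3 := (LinearMap.range Ψ).finrank_le
  have h4 : Module.finrank ℝ (LinearMap.ker Ψ) ≤
      Module.finrank ℝ ((LinearMap.ker Ψ).map (LinearMap.fst ℝ P V)) := by
    refine LinearMap.finrank_le_finrank_of_injective
      (f := (LinearMap.fst ℝ P V).submoduleMap (LinearMap.ker Ψ)) ?_
    rintro ⟨⟨ξ, v⟩, hp⟩ ⟨⟨ξ', v'⟩, hq⟩ h
    have hξ : ξ = ξ' := congrArg Subtype.val h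
    subst hξ
    have h5 : Ψ (ξ, v) = 0 := hp
    have h6 : Ψ (ξ, v') = 0 := hq
    have h7 : v - v' = 0 := hinj _ (by
      rw [show ((0, v - v') : P × V) = (ξ, v) - (ξ, v') by simp, map_sub, h5, h6, sub_zero])
    obtain rfl : v = v' := sub_eq_zero.1 h7
    rfl
  omega

section PositiveCase

variable {n : ℕ} {X : ℝ → PhaseSpace n} {b : ℝ → ℝ} {τ t : ℝ}

/-- The integral of a variation. -/
noncomputable def integralVariation (t : ℝ) : Variations t →ₗ[ℝ] ℝ where
  toFun v := ∫ s in Ioc 0 t, v s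
  map_add' v w := by
    rw [← integral_add ((Lp.memLp v).integrable le_top) ((Lp.memLp w).integrable le_top)]
    refine integral_congr_ae ?_
    filter_upwards [Lp.coeFn_add v w] with s hs
    rw [hs, Pi.add_apply]
  map_smul' c v := by
    rw [RingHom.id_apply, ← integral_smul]
    refine integral_congr_ae ?_
    filter_upwards [Lp.coeFn_smul c v] with s hs
    rw [hs, Pi.smul_apply]

theorem setIntegral_Ioc_eq_of_ae_zero {F : Type*} [NormedAddCommGroup F] [NormedSpace ℝ F]
    {f : ℝ → F} {s : ℝ} (hτ : 0 ≤ τ) (h : ∀ᵐ r ∂volume.restrict (Ioc 0 τ), f r = 0) :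
    ∫ r in Ioc 0 s, f r = ∫ r in Ioc τ s, f r := by
  refine setIntegral_eq_of_subset_of_ae_sdiff_eq_zero measurableSet_Ioc.nullMeasurableSet
    (Ioc_subset_Ioc_left hτ) ?_
  filter_upwards [(ae_restrict_iff' measurableSet_Ioc).1 h] with r hr hmem
  exact hr ⟨hmem.1.1, by
    by_contra hlt
    exact hmem.2 ⟨not_le.1 hlt, hmem.1.2⟩⟩

theorem variedCurve_eq_integral_right {ξ : PhaseSpace n} {v : ℝ → ℝ} {s : ℝ} (hτ : 0 ≤ τ)
    (hs : τ ≤ s) (h : v =ᵐ[volume.restrict (Ioc 0 τ)] 0) :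
    variedCurve X ξ v s = ξ + ∫ r in τ..s, v r • X r := by
  rw [variedCurve, intervalIntegral.integral_of_le (hτ.trans hs),
    intervalIntegral.integral_of_le hs, setIntegral_Ioc_eq_of_ae_zero hτ]
  filter_upwards [h] with r hr
  rw [hr, Pi.zero_apply, zero_smul]

/-- If the second order Legendre condition holds, then most of the elements of `𝓛_τ(V₀)` are close
to elements of `𝓛_t(V₀ ⊕ V₁)`. -/
theorem exists_subspace_near_lPlane_of_pos (hτ : 0 ≤ τ) (hτt : τ < t)
    (hX : IntegrableOn X (Ioc 0 t)) (hb : IntegrableOn b (Ioc 0 t))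
    {G G' : ℝ → PhaseSpace n} (hXG : ∀ s ∈ Icc τ t, X s = G s) (hG : ∀ s, HasDerivAt G (G' s) s)
    (hG' : Continuous G') {a₀ C K : ℝ} (ha₀ : 0 < a₀)
    (ha : ∀ s ∈ Icc τ t, a₀ ≤ symplForm (G s) (G' s))
    (hC0 : 0 ≤ C) (hC : ∀ s ∈ Icc τ t, ‖G' s‖ ≤ C) (hK : K = ‖symplBilin n‖)
    (hsmall : (t - τ) * (K * C ^ 2) ≤ a₀ / 2) (hbneg : ∀ s ∈ Ioc τ t, b s < 0)
    (V₀ : Submodule ℝ (Variations τ)) [FiniteDimensional ℝ V₀]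
    (V₁ : Submodule ℝ (Variations t)) [FiniteDimensional ℝ V₁]
    (hV₁ : ∀ w ∈ V₁, w =ᵐ[volume.restrict (Ioc 0 τ)] 0) :
    ∃ A : Submodule ℝ (PhaseSpace n), A ≤ lPlane X b τ V₀ ∧ n ≤ Module.finrank ℝ A + 2 ∧
      ∀ ξ ∈ A, ∃ x ∈ lPlane X b t (V₀.map (extendVariation hτt.le) ⊔ V₁),
        ‖x - ξ‖ ≤ C * (2 * (t - τ) * K * C / a₀) * ‖ξ‖ := by
  have ht : 0 ≤ t := hτ.trans hτt.le
  have hest : ∀ (ξ : PhaseSpace n) (v : Variations t), v ∈ V₁ →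
      galerkinForm hX hb ht (ξ, v) v = 0 → integralVariation t v = 0 →
      ‖variedCurve X ξ v t - ξ‖ ≤ C * (2 * (t - τ) * K * C / a₀) * ‖ξ‖ ∧ (ξ = 0 → v = 0) := by
    intro ξ v hv hgal hmean
    have hv0 := hV₁ v hv
    -- A class in L^∞ of (0, t] has no meaning outside this interval; its cut-off is integrable on
    -- the line, as the energy estimate requires.
    set v' : ℝ → ℝ := (Ioc τ t).indicator v with hv'
    have hvint₀ : IntegrableOn v (Ioc 0 t) volume := (Lp.memLp v).integrable le_top
    have hvint : IntegrableOn v (Ioc τ t) volume := hvint₀.mono_set (Ioc_subset_Ioc_left hτ)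
    have hv'int : Integrable v' := (integrable_indicator_iff measurableSet_Ioc).2 hvint
    have hvv' : ∀ s ∈ Ioc τ t, v' s = v s := fun s hs => indicator_of_mem hs _
    have hmean' : ∫ s in τ..t, v' s = 0 := by
      rw [intervalIntegral.integral_of_le hτt.le, ← hmean]
      change _ = ∫ s in Ioc 0 t, v s
      rw [setIntegral_Ioc_eq_of_ae_zero hτ hv0]
      exact setIntegral_congr_fun measurableSet_Ioc hvv'
    have hcurve : ∀ s ∈ Icc τ t, variedCurve X ξ v s = ξ + ∫ r in τ..s, v' r • G r :=
      fun s hs => by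
      rw [variedCurve_eq_integral_right hτ hs.1 hv0, intervalIntegral.integral_of_le hs.1,
        intervalIntegral.integral_of_le hs.1]
      congr 1
      refine setIntegral_congr_fun measurableSet_Ioc fun r hr => ?_
      have hr' : r ∈ Ioc τ t := ⟨hr.1, hr.2.trans hs.2⟩
      rw [hvv' r hr', hXG r (Ioc_subset_Icc_self hr')]
    have hbi : IntervalIntegrable (fun s => b s * (v' s * v' s)) volume τ t := by
      rw [intervalIntegrable_iff_integrableOn_Ioc_of_le hτt.le]
      refine ((v.integrable_smul (v.integrable_smul hb)).mono_set
        (Ioc_subset_Ioc_left hτ)).congr_fun (fun s hs => ?_) measurableSet_Ioc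
      simp only [smul_eq_mul]
      rw [hvv' s hs]
      ring
    have i1 : IntervalIntegrable
        (fun s => symplForm (ξ + ∫ r in τ..s, v' r • G r) (v' s • G s)) volume τ t := by
      rw [intervalIntegrable_iff_integrableOn_Ioc_of_le hτt.le]
      refine ((integrable_symplForm_of_continuousOn (continuousOn_variedCurve hX ht ξ v)
        (v.integrable_smul hX)).mono_set (Ioc_subset_Ioc_left hτ)).congr_fun (fun s hs => ?_)
        measurableSet_Ioc
      simp only
      rw [hcurve s (Ioc_subset_Icc_self hs), hvv' s hs, hXG s (Ioc_subset_Icc_self hs)]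
    have hgal' : ∫ s in τ..t, symplForm (ξ + ∫ r in τ..s, v' r • G r) (v' s • G s) =
        -∫ s in τ..t, b s * (v' s * v' s) := by
      rw [eq_neg_iff_add_eq_zero, ← intervalIntegral.integral_add i1 hbi,
        intervalIntegral.integral_of_le hτt.le]
      refine Eq.trans ?_ hgal
      rw [galerkinForm_apply, setIntegral_Ioc_eq_of_ae_zero hτ]
      · refine setIntegral_congr_fun measurableSet_Ioc fun s hs => ?_
        simp only [galerkinIntegrand]
        rw [hcurve s (Ioc_subset_Icc_self hs), hvv' s hs, hXG s (Ioc_subset_Icc_self hs)]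
      · filter_upwards [hv0] with s hs
        rw [galerkinIntegrand, hs]
        simp
    obtain ⟨h1, h2⟩ := integral_abs_primitive_le hv'int hG hG' hτt hmean' ξ ha₀ ha hC0 hC hK hsmall
      hbneg hgal' hbi
    constructor
    -- Mean zero removes the boundary term, so the displacement of the endpoint is −∫ u G' and is
    -- controlled by the L¹ norm of u.
    · rw [hcurve t ⟨hτt.le, le_rfl⟩, add_sub_cancel_left,
        integral_smul_eq_sub_integral_primitive_smul hv'int.intervalIntegrable hG hG', hmean',
        zero_smul, zero_sub, norm_neg, mul_assoc]
      have huc := continuous_primitive_of_integrable hv'int τ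
      calc ‖∫ s in τ..t, (∫ r in τ..s, v' r) • G' s‖
          ≤ ∫ s in τ..t, ‖(∫ r in τ..s, v' r) • G' s‖ :=
            intervalIntegral.norm_integral_le_integral_norm hτt.le
        _ ≤ ∫ s in τ..t, C * |∫ r in τ..s, v' r| := by
            refine intervalIntegral.integral_mono_on hτt.le
              ((huc.smul hG').norm.intervalIntegrable _ _)
              ((continuous_const.mul huc.abs).intervalIntegrable _ _) fun r hr => ?_
            rw [norm_smul, mul_comm, Real.norm_eq_abs]
            exact mul_le_mul_of_nonneg_right (hC r hr) (abs_nonneg _)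
        _ = C * ∫ s in τ..t, |∫ r in τ..s, v' r| := intervalIntegral.integral_const_mul _ _
        _ ≤ _ := mul_le_mul_of_nonneg_left h1 hC0
    · intro hξ
      refine Lp.ext ?_
      refine (ae_eq_restrict_Ioc_of_split hτ hτt.le hv0 ?_).trans (Lp.coeFn_zero _ _ _).symm
      filter_upwards [h2 hξ, ae_restrict_mem measurableSet_Ioc] with s h3 h4
      rw [← hvv' s h4, h3]
  set Λ := lPlane X b τ V₀ with hΛ
  let ι : (Λ × V₁) →ₗ[ℝ] PhaseSpace n × Variations t := Λ.subtype.prodMap V₁.subtype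
  -- The Galerkin equations on V₁ together with the mean zero condition: one equation more than
  -- unknown controls.
  let Ψ : (Λ × V₁) →ₗ[ℝ] Module.Dual ℝ V₁ × ℝ :=
    (V₁.subtype.dualMap ∘ₗ galerkinForm hX hb ht ∘ₗ ι).prod
      (integralVariation t ∘ₗ V₁.subtype ∘ₗ LinearMap.snd ℝ Λ V₁)
  have hΨ : ∀ (ξ : Λ) (v : V₁), Ψ (ξ, v) = 0 →
      (∀ w ∈ V₁, galerkinForm hX hb ht (ξ, v) w = 0) ∧ integralVariation t v = 0 := by
    intro ξ v h
    exact ⟨fun w hw => LinearMap.congr_fun (congrArg Prod.fst h) (⟨w, hw⟩ : V₁),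
      congrArg Prod.snd h⟩
  have hdim := finrank_le_finrank_map_fst_ker_add_one Ψ (fun v hv => by
    obtain ⟨h1, h2⟩ := hΨ 0 v hv
    exact Subtype.ext ((hest 0 v v.2 (h1 v v.2) h2).2 rfl)) (by
    rw [Module.finrank_prod, Subspace.dual_finrank_eq, Module.finrank_self])
  have hΛn : n ≤ Module.finrank ℝ Λ :=
    le_finrank_lPlane (hX.mono_set (Ioc_subset_Ioc_right hτt.le))
      (hb.mono_set (Ioc_subset_Ioc_right hτt.le)) hτ V₀
  refine ⟨((LinearMap.ker Ψ).map (LinearMap.fst ℝ Λ V₁)).map Λ.subtype,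
    Submodule.map_subtype_le _ _, ?_, ?_⟩
  -- Only one dimension is lost here; the bound with 2 is the form shared with the negative case.
  · rw [Submodule.finrank_map_subtype_eq]
    omega
  · rintro _ ⟨_, ⟨⟨ξ, v⟩, hp, rfl⟩, rfl⟩
    obtain ⟨h1, h2⟩ := hΨ ξ v hp
    exact ⟨variedCurve X ξ v t,
      variedCurve_mem_lPlane_sup hτ hτt.le hX hb hV₁ ξ.2 v.2 h1,
      (hest ξ v v.2 (h1 v v.2) h2).1⟩

end PositiveCase

/-! ### Smooth Jacobi solutions as bounded variations -/

section JacobiControls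

variable {n : ℕ} {X Y : ℝ → PhaseSpace n} {b β : ℝ → ℝ} {k : ℕ} {τ t : ℝ} {η : ℝ → PhaseSpace n}

/-- The variation that generates a solution of the Jacobi equation. -/
noncomputable def jacobiControl (Y : ℝ → PhaseSpace n) (β : ℝ → ℝ) (k : ℕ) (η : ℝ → PhaseSpace n)
    (s : ℝ) : ℝ :=
  (s ^ k)⁻¹ * (-(β s)⁻¹ * symplForm (Y s) (η s))

theorem IsSingularSolution.hasDerivAt_jacobiControl
    (hη : IsSingularSolution k (jacobiField Y β) η) {s : ℝ} (hs : 0 < s) :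
    HasDerivAt η (jacobiControl Y β k η s • Y s) s :=
  (hη s hs).congr_deriv (by rw [jacobiField_apply, smul_smul, jacobiControl])

theorem IsSingularSolution.continuousOn_jacobiControl (hY : Continuous Y) (hβ : Continuous β)
    (hβ0 : ∀ s, 0 < β s) (hη : IsSingularSolution k (jacobiField Y β) η) :
    ContinuousOn (jacobiControl Y β k η) (Ioi 0) := by
  have h1 : ContinuousOn η (Ioi 0) := fun s hs => (hη s hs).continuousAt.continuousWithinAt
  have h2 : ContinuousOn (fun s => symplForm (Y s) (η s)) (Ioi 0) :=
    ((symplBilin n).continuous.comp hY).continuousOn.clm_apply h1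
  refine ContinuousOn.mul (ContinuousOn.inv₀ (by fun_prop) fun s hs => (pow_pos hs k).ne') ?_
  exact (hβ.inv₀ fun s => (hβ0 s).ne').neg.continuousOn.mul h2

/-- The product of the control with Y is the derivative of a solution that is smooth up to 0, hence
bounded, and Y stays away from 0. The singular factor s^{-k} is thus compensated. -/
theorem IsSingularSolution.exists_abs_jacobiControl_le (hY : Continuous Y) (hY0 : Y 0 ≠ 0)
    (hη : IsSingularSolution k (jacobiField Y β) η) (hηs : ContDiffOn ℝ ∞ η (Ico 0 1)) :
    ∃ r > 0, ∃ C, ∀ s ∈ Ioc 0 r, |jacobiControl Y β k η s| ≤ C := by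
  have hg : ContinuousOn (derivWithin η (Ico 0 1)) (Icc 0 (1 / 2)) :=
    (hηs.continuousOn_derivWithin (uniqueDiffOn_Ico 0 1) (by simp)).mono
      fun s hs => ⟨hs.1, hs.2.trans_lt (by norm_num)⟩
  obtain ⟨D, hD⟩ := isCompact_Icc.exists_bound_of_continuousOn hg
  have hpos : 0 < ‖Y 0‖ := norm_pos_iff.2 hY0
  have hev : ∀ᶠ s in 𝓝 (0 : ℝ), ‖Y 0‖ / 2 < ‖Y s‖ :=
    hY.norm.continuousAt.eventually_const_lt (half_lt_self hpos)
  obtain ⟨r, hr, hrY⟩ := Metric.eventually_nhds_iff.1 hev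
  refine ⟨min (r / 2) (1 / 2), by positivity, D / (‖Y 0‖ / 2), fun s hs => ?_⟩
  have h1 : s ≤ r / 2 := hs.2.trans (min_le_left _ _)
  have h2 : s ≤ 1 / 2 := hs.2.trans (min_le_right _ _)
  have hs1 : s ∈ Ico (0 : ℝ) 1 := ⟨hs.1.le, by linarith⟩
  have hd := (hη.hasDerivAt_jacobiControl hs.1).hasDerivWithinAt.derivWithin
    (uniqueDiffOn_Ico 0 1 s hs1)
  have h3 := hD s ⟨hs.1.le, h2⟩
  rw [hd, norm_smul, Real.norm_eq_abs] at h3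
  have h4 : ‖Y 0‖ / 2 < ‖Y s‖ := hrY (by
    rw [Real.dist_eq, sub_zero, abs_of_pos hs.1]; linarith)
  rw [le_div_iff₀ (by positivity)]
  exact (mul_le_mul_of_nonneg_left h4.le (abs_nonneg _)).trans h3

/-- A smooth solution of the Jacobi equation is a curve generated by a bounded variation which
solves the Galerkin equations. -/
theorem exists_variation_of_jacobi_solution (hτ : 0 ≤ τ) (hτt : τ < t)
    (hX : IntegrableOn X (Ioc 0 t)) (hb : IntegrableOn b (Ioc 0 t))
    (hY : Continuous Y) (hβ : Continuous β) (hβ0 : ∀ s, 0 < β s)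
    (hXY : ∀ s ∈ Ioc τ t, X s = Y (s - τ))
    (hbβ : ∀ s ∈ Ioc τ t, b s = -((s - τ) ^ k * β (s - τ)))
    (hη : IsSingularSolution k (jacobiField Y β) η) (hη0 : ContinuousWithinAt η (Ici 0) 0)
    {C : ℝ} (hC : ∀ s ∈ Ioc 0 (t - τ), |jacobiControl Y β k η s| ≤ C) :
    ∃ v : Variations t, v =ᵐ[volume.restrict (Ioc 0 τ)] 0 ∧
      variedCurve X (η 0) v t = η (t - τ) ∧
      ∀ w : Variations t, w =ᵐ[volume.restrict (Ioc 0 τ)] 0 →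
        galerkinForm hX hb (hτ.trans hτt.le) (η 0, v) w = 0 := by
  have ht : 0 ≤ t := hτ.trans hτt.le
  set u : ℝ → ℝ := fun s => jacobiControl Y β k η (s - τ) with hu
  have hmap : ∀ s ∈ Ioc τ t, s - τ ∈ Ioc 0 (t - τ) := fun s hs =>
    ⟨sub_pos.2 hs.1, sub_le_sub_right hs.2 τ⟩
  have huc : ContinuousOn u (Ioc τ t) :=
    (hη.continuousOn_jacobiControl hY hβ hβ0).comp (by fun_prop) fun s hs => (hmap s hs).1
  have hum : AEStronglyMeasurable ((Ioc τ t).indicator u) (volume.restrict (Ioc 0 t)) :=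
    ((aestronglyMeasurable_indicator_iff measurableSet_Ioc).2
      (huc.aestronglyMeasurable measurableSet_Ioc)).restrict
  have hub : ∀ s, ‖(Ioc τ t).indicator u s‖ ≤ |C| := fun s => by
    by_cases hs : s ∈ Ioc τ t
    · rw [indicator_of_mem hs, Real.norm_eq_abs]
      exact (hC _ (hmap s hs)).trans (le_abs_self C)
    · rw [indicator_of_notMem hs, norm_zero]; exact abs_nonneg C
  have hmem : MemLp ((Ioc τ t).indicator u) ∞ (volume.restrict (Ioc 0 t)) :=
    memLp_top_of_bound hum |C| (Eventually.of_forall hub)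
  set v : Variations t := hmem.toLp _ with hv
  have hvae : v =ᵐ[volume.restrict (Ioc 0 t)] (Ioc τ t).indicator u := hmem.coeFn_toLp
  have hvl : v =ᵐ[volume.restrict (Ioc 0 τ)] 0 := by
    filter_upwards [ae_restrict_of_ae_restrict_of_subset (Ioc_subset_Ioc_right hτt.le) hvae,
      ae_restrict_mem measurableSet_Ioc] with s h1 h2
    rw [h1, indicator_of_notMem fun h => (h2.2.trans_lt h.1).false, Pi.zero_apply]
  have hvr : v =ᵐ[volume.restrict (Ioc τ t)] u := by
    filter_upwards [ae_restrict_of_ae_restrict_of_subset (Ioc_subset_Ioc_left hτ) hvae,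
      ae_restrict_mem measurableSet_Ioc] with s h1 h2
    rw [h1, indicator_of_mem h2]
  have hcurve : ∀ s ∈ Icc τ t, variedCurve X (η 0) v s = η (s - τ) := by
    intro s hs
    rw [variedCurve_eq_integral_right hτ hs.1 hvl]
    have hint : IntervalIntegrable (fun r => v r • X r) volume τ s := by
      rw [intervalIntegrable_iff_integrableOn_Ioc_of_le hs.1]
      exact (v.integrable_smul hX).mono_set (Ioc_subset_Ioc hτ hs.2)
    have hae : ∀ᵐ r ∂(volume.restrict (uIoc τ s)), v r • X r = u r • Y (r - τ) := by
      rw [uIoc_of_le hs.1]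
      filter_upwards [ae_restrict_of_ae_restrict_of_subset (Ioc_subset_Ioc_right hs.2) hvr,
        ae_restrict_mem measurableSet_Ioc] with r h1 h2
      rw [h1, hXY r ⟨h2.1, h2.2.trans hs.2⟩]
    have hint' : IntervalIntegrable (fun r => u r • Y (r - τ)) volume τ s :=
      hint.congr_ae hae
    rw [intervalIntegral.integral_congr_ae_restrict hae]
    have hcont : ContinuousOn (fun r => η (r - τ)) (Icc τ s) := by
      have : ContinuousOn η (Ici 0) := fun r hr => by
        rcases (mem_Ici.1 hr).eq_or_lt with h | h
        · rw [← h]; exact hη0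
        · exact (hη r h).continuousAt.continuousWithinAt
      exact this.comp (by fun_prop) fun r hr => sub_nonneg.2 hr.1
    rw [intervalIntegral.integral_eq_sub_of_hasDerivAt_of_le hs.1 hcont (fun r hr => ?_) hint',
      sub_self]
    · abel
    · exact (hη.hasDerivAt_jacobiControl (sub_pos.2 hr.1)).comp_sub_const r τ
  refine ⟨v, hvl, hcurve t ⟨hτt.le, le_rfl⟩, fun w hw => ?_⟩
  rw [galerkinForm_apply]
  refine integral_eq_zero_of_ae (ae_eq_restrict_Ioc_of_split hτ hτt.le ?_ ?_)
  · filter_upwards [hw] with s h1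
    rw [galerkinIntegrand, h1]
    simp
  · filter_upwards [hvr, ae_restrict_mem measurableSet_Ioc] with s h1 h2
    have h3 := hmap s h2
    rw [galerkinIntegrand, hcurve s (Ioc_subset_Icc_self h2), h1, hbβ s h2, hXY s h2,
      symplForm_smul_right, symplForm_swap]
    have h4 : (s - τ) ^ k ≠ 0 := (pow_pos h3.1 k).ne'
    have h5 : β (s - τ) ≠ 0 := (hβ0 _).ne'
    simp only [Pi.zero_apply, hu, jacobiControl]
    field_simp
    ring

end JacobiControls

/-! ### Comparison of 𝓛_τ(V₀) with 𝓛_t(V₀ ⊕ V₁) -/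

section Bridge

variable {n : ℕ} {X Y : ℝ → PhaseSpace n} {b β : ℝ → ℝ} {k : ℕ} {τ t : ℝ}

theorem finrank_le_finrank_inf_ker_add_two (Λ : Submodule ℝ (PhaseSpace n))
    (f g : PhaseSpace n →ₗ[ℝ] ℝ) :
    Module.finrank ℝ Λ ≤
      Module.finrank ℝ (Λ ⊓ LinearMap.ker (f.prod g) : Submodule ℝ (PhaseSpace n)) + 2 := by
  have h1 := LinearMap.finrank_range_add_finrank_ker ((f.prod g).domRestrict Λ)
  have h2 : Module.finrank ℝ (LinearMap.range ((f.prod g).domRestrict Λ)) ≤ 2 :=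
    (Submodule.finrank_le _).trans (by simp)
  have h3 : LinearMap.ker ((f.prod g).domRestrict Λ) =
      (LinearMap.ker (f.prod g)).comap Λ.subtype := rfl
  have h4 := Submodule.finrank_map_subtype_eq Λ (LinearMap.ker ((f.prod g).domRestrict Λ))
  rw [h3, Submodule.map_comap_subtype] at h4
  rw [h3, ← h4] at h1
  omega

/-- If the generalized Legendre condition fails, then the elements of `𝓛_τ(V₀)` in a subspace of
codimension two are close to elements of `𝓛_t(V₀ ⊕ V₁)` for all large `V₁`. -/
theorem eventually_exists_subspace_near_lPlane_of_neg {δ₀ T : ℝ} (hτ : 0 ≤ τ) (hτT : τ < T)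
    (hX : ∀ t < T, IntegrableOn X (Ioc 0 t)) (hb : ∀ t < T, IntegrableOn b (Ioc 0 t))
    (hY : ContDiff ℝ ∞ Y) (hβ : ContDiff ℝ ∞ β) (hβ0 : ∀ s, 0 < β s) (hk : 1 ≤ k)
    (ha : symplForm (Y 0) (deriv Y 0) < 0) (hδ₀ : 0 < δ₀)
    (hXY : ∀ s ∈ Icc 0 δ₀, X (τ + s) = Y s)
    (hbβ : ∀ s ∈ Ioc 0 δ₀, b (τ + s) = -(s ^ k * β s)) {ε : ℝ} (hε : 0 < ε) :
    ∀ᶠ t in 𝓝[>] τ, ∀ hτt : τ ≤ t, ∃ U : Submodule ℝ (Variations t), FiniteDimensional ℝ U ∧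
      (∀ w ∈ U, w =ᵐ[volume.restrict (Ioc 0 τ)] 0) ∧
      ∀ (V₀ : Submodule ℝ (Variations τ)) (V₁ : Submodule ℝ (Variations t)),
        FiniteDimensional ℝ V₀ → FiniteDimensional ℝ V₁ → U ≤ V₁ →
        (∀ w ∈ V₁, w =ᵐ[volume.restrict (Ioc 0 τ)] 0) →
        ∃ A : Submodule ℝ (PhaseSpace n), A ≤ lPlane X b τ V₀ ∧ n ≤ Module.finrank ℝ A + 2 ∧
          ∀ ξ ∈ A, ∃ x ∈ lPlane X b t (V₀.map (extendVariation hτt) ⊔ V₁), ‖x - ξ‖ ≤ ε * ‖ξ‖ := by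
  have hY0 : Y 0 ≠ 0 := fun h => by simp [h] at ha
  -- For a < 0 every vector of this complement of codimension two starts a smooth solution, and
  -- finitely many basis solutions suffice.
  let E : Submodule ℝ (PhaseSpace n) := LinearMap.ker
    ((symplBilin n (Y 0)).toLinearMap.prod (symplBilin n (deriv Y 0)).toLinearMap)
  let e := Module.finBasis ℝ E
  have hsol : ∀ i, ∃ η : ℝ → PhaseSpace n, IsSingularSolution k (jacobiField Y β) η ∧
      η 0 = e i ∧ ∀ δ, 0 < δ → ContDiffOn ℝ ∞ η (Ico 0 δ) := fun i => by
    have hi := LinearMap.mem_ker.1 (e i).2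
    exact exists_smooth_jacobi_solution hY hβ hβ0 hk ha.ne
      (mem_formalInitialValues_of_neg hY hβ (hβ0 0) hk ha (congrArg Prod.fst hi)
        (congrArg Prod.snd hi))
  choose η hη hη0 hηs using hsol
  have hηc : ∀ i, ContinuousWithinAt (η i) (Ici 0) 0 := fun i =>
    ((hηs i 1 one_pos).continuousOn 0 ⟨le_rfl, one_pos⟩).mono_of_mem_nhdsWithin
      (Ico_mem_nhdsGE one_pos)
  have hbd : ∀ i, ∃ r > 0, ∃ C, ∀ s ∈ Ioc 0 r, |jacobiControl Y β k (η i) s| ≤ C := fun i =>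
    (hη i).exists_abs_jacobiControl_le hY.continuous hY0 (hηs i 1 one_pos)
  choose r hr C hC using hbd
  let φ : ∀ i, E →L[ℝ] ℝ := fun i => LinearMap.toContinuousLinearMap (e.coord i)
  have hsub : Tendsto (fun t => t - τ) (𝓝[>] τ) (𝓝[≥] 0) := by
    refine tendsto_nhdsWithin_iff.2 ⟨?_, ?_⟩
    · have : Tendsto (fun t => t - τ) (𝓝 τ) (𝓝 (τ - τ)) := (continuous_id.sub continuous_const).tendsto τ
      rw [sub_self] at this
      exact this.mono_left nhdsWithin_le_nhds
    · filter_upwards [self_mem_nhdsWithin] with t ht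
      exact sub_nonneg.2 (mem_Ioi.1 ht).le
  -- The coordinate functionals turn convergence of the basis solutions into a bound ε‖ξ‖ uniform
  -- over E.
  have hlim : Tendsto (fun t => ∑ i, ‖φ i‖ * ‖η i (t - τ) - e i‖) (𝓝[>] τ) (𝓝 0) := by
    have h1 : ∀ i ∈ (Finset.univ : Finset (Fin (Module.finrank ℝ E))),
        Tendsto (fun t => ‖φ i‖ * ‖η i (t - τ) - e i‖) (𝓝[>] τ) (𝓝 0) := fun i _ => by
      have h2 := (((hηc i).tendsto.comp hsub).sub_const (e i : PhaseSpace n)).norm.const_mul ‖φ i‖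
      rwa [hη0 i, sub_self, norm_zero, mul_zero] at h2
    simpa using tendsto_finsetSum _ h1
  have hr' : ∀ᶠ t in 𝓝[>] τ, ∀ i, t - τ ≤ r i := eventually_all.2 fun i =>
    (hsub.mono_right nhdsWithin_le_nhds).eventually (eventually_le_nhds (hr i))
  have hδ' : ∀ᶠ t in 𝓝[>] τ, t - τ ≤ δ₀ :=
    (hsub.mono_right nhdsWithin_le_nhds).eventually (eventually_le_nhds hδ₀)
  filter_upwards [hr', hδ', hlim.eventually (eventually_le_nhds hε), self_mem_nhdsWithin,
    nhdsWithin_le_nhds (eventually_lt_nhds hτT)] with t htr htδ htε hτt' htT hτt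
  replace hτt' : τ < t := hτt'
  have hv : ∀ i, ∃ v : Variations t, v =ᵐ[volume.restrict (Ioc 0 τ)] 0 ∧
      variedCurve X (η i 0) v t = η i (t - τ) ∧
      ∀ w : Variations t, w =ᵐ[volume.restrict (Ioc 0 τ)] 0 →
        galerkinForm (hX t htT) (hb t htT) (hτ.trans hτt) (η i 0, v) w = 0 := fun i =>
    exists_variation_of_jacobi_solution hτ hτt' (hX t htT) (hb t htT) hY.continuous hβ.continuous
      hβ0 (fun s hs => by
        rw [← hXY (s - τ) ⟨sub_nonneg.2 hs.1.le, (sub_le_sub_right hs.2 τ).trans htδ⟩,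
          add_sub_cancel])
      (fun s hs => by
        rw [← hbβ (s - τ) ⟨sub_pos.2 hs.1, (sub_le_sub_right hs.2 τ).trans htδ⟩,
          add_sub_cancel])
      (hη i) (hηc i) (fun s hs => hC i s ⟨hs.1, hs.2.trans (htr i)⟩)
  choose v hv0 hvend hvgal using hv
  -- Once V₁ contains the controls of the basis solutions, these solve the Galerkin equations for
  -- every such V₁, because they solve the Jacobi equation pointwise.
  refine ⟨Submodule.span ℝ (range v), FiniteDimensional.span_of_finite ℝ (finite_range v),
    fun w hw => ?_, fun V₀ V₁ _ _ hU hV₁ => ⟨lPlane X b τ V₀ ⊓ E, inf_le_left, ?_, ?_⟩⟩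
  · induction hw using Submodule.span_induction with
    | mem w hw =>
      obtain ⟨i, rfl⟩ := hw
      exact hv0 i
    | zero =>
      exact ae_restrict_of_ae_restrict_of_subset (Ioc_subset_Ioc_right hτt) (Lp.coeFn_zero _ _ _)
    | add x y _ _ hx hy =>
      filter_upwards [hx, hy, ae_restrict_of_ae_restrict_of_subset (Ioc_subset_Ioc_right hτt)
        (Lp.coeFn_add x y)] with s h1 h2 h3
      rw [h3, Pi.add_apply, h1, h2, Pi.zero_apply, add_zero]
    | smul c x _ hx =>
      filter_upwards [hx, ae_restrict_of_ae_restrict_of_subset (Ioc_subset_Ioc_right hτt)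
        (Lp.coeFn_smul c x)] with s h1 h3
      rw [h3, Pi.smul_apply, h1, Pi.zero_apply, smul_zero]
  · exact (le_finrank_lPlane (hX τ hτT) (hb τ hτT) hτ V₀).trans
      (finrank_le_finrank_inf_ker_add_two _ _ _)
  · rintro ξ ⟨hξ, hξE⟩
    set c : Fin (Module.finrank ℝ E) → ℝ := fun i => φ i ⟨ξ, hξE⟩ with hc
    have hsum : ∑ i, c i • η i 0 = ξ := by
      have h1 := congrArg E.subtype (e.sum_repr ⟨ξ, hξE⟩)
      rw [map_sum] at h1
      simp only [hη0]
      exact h1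
    have hpair : (ξ, ∑ i, c i • v i) = ∑ i, c i • (η i 0, v i) := by
      rw [Prod.ext_iff]
      simp only [Prod.fst_sum, Prod.snd_sum, Prod.smul_mk, hsum, and_self]
    have hend : variedCurve X ξ (∑ i, c i • v i : Variations t) t =
        ∑ i, c i • η i (t - τ) := by
      have h1 : variedEndpoint (hX t htT) (hτ.trans hτt) (ξ, ∑ i, c i • v i) =
          ∑ i, c i • η i (t - τ) := by
        rw [hpair, map_sum]
        refine Finset.sum_congr rfl fun i _ => ?_
        rw [map_smul, variedEndpoint_apply, hvend]
      exact h1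
    refine ⟨variedCurve X ξ (∑ i, c i • v i : Variations t) t,
      variedCurve_mem_lPlane_sup hτ hτt (hX t htT) (hb t htT) hV₁ hξ
        (Submodule.sum_mem _ fun i _ => V₁.smul_mem _ (hU (Submodule.subset_span ⟨i, rfl⟩)))
        (fun w hw => ?_), ?_⟩
    · rw [hpair, map_sum, LinearMap.sum_apply]
      refine Finset.sum_eq_zero fun i _ => ?_
      rw [map_smul, LinearMap.smul_apply, hvgal i w (hV₁ w hw), smul_zero]
    · rw [hend]
      calc ‖∑ i, c i • η i (t - τ) - ξ‖ = ‖∑ i, c i • (η i (t - τ) - e i)‖ := by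
            simp only [smul_sub, Finset.sum_sub_distrib]
            congr 2
            rw [← hsum]
            exact Finset.sum_congr rfl fun i _ => by rw [hη0]
        _ ≤ ∑ i, (‖φ i‖ * ‖η i (t - τ) - e i‖) * ‖ξ‖ := by
            refine norm_sum_le_of_le _ fun i _ => ?_
            rw [norm_smul, mul_right_comm]
            exact mul_le_mul_of_nonneg_right ((φ i).le_opNorm ⟨ξ, hξE⟩) (norm_nonneg _)
        _ ≤ ε * ‖ξ‖ := by
            rw [← Finset.sum_mul]
            exact mul_le_mul_of_nonneg_right htε (norm_nonneg _)

/-- The elements of a subspace of codimension two of `𝓛_τ(V₀)` are close to elements of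
`𝓛_t(V₀ ⊕ V₁)` for all large `V₁`. -/
theorem eventually_exists_subspace_near_lPlane {δ₀ T : ℝ} (hτ : 0 ≤ τ) (hτT : τ < T)
    (hX : ∀ t < T, IntegrableOn X (Ioc 0 t)) (hb : ∀ t < T, IntegrableOn b (Ioc 0 t))
    (hY : ContDiff ℝ ∞ Y) (hβ : ContDiff ℝ ∞ β) (hβ0 : ∀ s, 0 < β s) (hk : 1 ≤ k)
    (ha : symplForm (Y 0) (deriv Y 0) ≠ 0) (hδ₀ : 0 < δ₀)
    (hXY : ∀ s ∈ Icc 0 δ₀, X (τ + s) = Y s)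
    (hbβ : ∀ s ∈ Ioc 0 δ₀, b (τ + s) = -(s ^ k * β s)) {ε : ℝ} (hε : 0 < ε) :
    ∀ᶠ t in 𝓝[>] τ, ∀ hτt : τ ≤ t, ∃ U : Submodule ℝ (Variations t), FiniteDimensional ℝ U ∧
      (∀ w ∈ U, w =ᵐ[volume.restrict (Ioc 0 τ)] 0) ∧
      ∀ (V₀ : Submodule ℝ (Variations τ)) (V₁ : Submodule ℝ (Variations t)),
        FiniteDimensional ℝ V₀ → FiniteDimensional ℝ V₁ → U ≤ V₁ →
        (∀ w ∈ V₁, w =ᵐ[volume.restrict (Ioc 0 τ)] 0) →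
        ∃ A : Submodule ℝ (PhaseSpace n), A ≤ lPlane X b τ V₀ ∧ n ≤ Module.finrank ℝ A + 2 ∧
          ∀ ξ ∈ A, ∃ x ∈ lPlane X b t (V₀.map (extendVariation hτt) ⊔ V₁), ‖x - ξ‖ ≤ ε * ‖ξ‖ := by
  rcases ha.lt_or_gt with ha | ha
  · exact eventually_exists_subspace_near_lPlane_of_neg hτ hτT hX hb hY hβ hβ0 hk ha hδ₀ hXY hbβ hε
  have hY1 : Continuous (deriv Y) := hY.continuous_deriv (by simp)
  set K := ‖symplBilin n‖ with hK
  set a₀ := symplForm (Y 0) (deriv Y 0) / 2 with ha₀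
  have ha₀pos : 0 < a₀ := half_pos ha
  set C := ‖deriv Y 0‖ + 1 with hC
  have hsub : Tendsto (fun t => t - τ) (𝓝 τ) (𝓝 0) := by
    have : Tendsto (fun t => t - τ) (𝓝 τ) (𝓝 (τ - τ)) := (continuous_id.sub continuous_const).tendsto τ
    rwa [sub_self] at this
  have hσc : Continuous fun s => symplForm (Y s) (deriv Y s) :=
    ((symplBilin n).continuous.comp hY.continuous).clm_apply hY1
  obtain ⟨r, hr, hnear⟩ := Metric.eventually_nhds_iff.1
    ((hσc.continuousAt.eventually_const_lt (half_lt_self ha)).and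
      (hY1.norm.continuousAt.eventually_lt_const (lt_add_one ‖deriv Y 0‖)))
  have e1 : ∀ᶠ t in 𝓝[>] τ, t - τ < r :=
    (hsub.eventually_lt_const hr).filter_mono nhdsWithin_le_nhds
  have e2 : ∀ᶠ t in 𝓝[>] τ, t - τ < δ₀ :=
    (hsub.eventually_lt_const hδ₀).filter_mono nhdsWithin_le_nhds
  have e3 : ∀ᶠ t in 𝓝[>] τ, (t - τ) * (K * C ^ 2) < a₀ / 2 := by
    have h := hsub.mul_const (K * C ^ 2)
    rw [zero_mul] at h
    exact (h.eventually_lt_const (half_pos ha₀pos)).filter_mono nhdsWithin_le_nhds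
  have e4 : ∀ᶠ t in 𝓝[>] τ, C * (2 * (t - τ) * K * C / a₀) < ε := by
    have h := ((((hsub.const_mul 2).mul_const K).mul_const C).div_const a₀).const_mul C
    simp only [mul_zero, zero_mul, zero_div] at h
    exact (h.eventually_lt_const hε).filter_mono nhdsWithin_le_nhds
  filter_upwards [e1, e2, e3, e4, self_mem_nhdsWithin,
    nhdsWithin_le_nhds (eventually_lt_nhds hτT)] with t h1 h2 h3 h4 hτt' htT hτt
  replace hτt' : τ < t := hτt'
  have hnear' : ∀ s ∈ Icc τ t, dist (s - τ) 0 < r := fun s hs => by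
    rw [Real.dist_eq, sub_zero, abs_of_nonneg (sub_nonneg.2 hs.1)]
    linarith [hs.2]
  -- In the coercive case no particular control is needed: the estimate is uniform in V₁.
  refine ⟨⊥, inferInstance, fun w hw => ?_, fun V₀ V₁ _ _ _ hV₁ => ?_⟩
  · rw [(Submodule.mem_bot ℝ).1 hw]
    exact ae_restrict_of_ae_restrict_of_subset (Ioc_subset_Ioc_right hτt) (Lp.coeFn_zero _ _ _)
  · obtain ⟨A, hA, hdim, hAx⟩ := exists_subspace_near_lPlane_of_pos hτ hτt' (hX t htT) (hb t htT)
      (G := fun s => Y (s - τ)) (G' := fun s => deriv Y (s - τ)) (a₀ := a₀) (C := C) (K := K)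
      (fun s hs => by
        rw [← hXY (s - τ) ⟨sub_nonneg.2 hs.1, by linarith [hs.2]⟩, add_sub_cancel])
      (fun s => ((hY.differentiable (by simp)) (s - τ)).hasDerivAt.comp_sub_const s τ)
      (hY1.comp (continuous_id.sub continuous_const)) ha₀pos
      (fun s hs => (hnear (hnear' s hs)).1.le) (by positivity)
      (fun s hs => (hnear (hnear' s hs)).2.le) hK h3.le
      (fun s hs => by
        have h := hbβ (s - τ) ⟨sub_pos.2 hs.1, by linarith [hs.2]⟩
        rw [add_sub_cancel] at h
        rw [h]
        exact neg_neg_of_pos (mul_pos (pow_pos (sub_pos.2 hs.1) k) (hβ0 _)))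
      V₀ V₁ hV₁
    refine ⟨A, hA, hdim, fun ξ hξ => ?_⟩
    obtain ⟨x, hx, hxξ⟩ := hAx ξ hξ
    exact ⟨x, hx, hxξ.trans (mul_le_mul_of_nonneg_right h4.le (norm_nonneg _))⟩

end Bridge

/-! ### Passage to the limit in the Grassmannian -/

section Limits

variable {n : ℕ} {X Y : ℝ → PhaseSpace n} {b β : ℝ → ℝ} {k : ℕ} {τ t : ℝ}

/-- A subspace all of whose vectors are almost fixed by the orthogonal projections to `P` and `Q`
has at most the dimension of `P ⊓ Q`. -/
theorem exists_pos_finrank_le_finrank_inf {F : Type*} [NormedAddCommGroup F]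
    [InnerProductSpace ℝ F] [FiniteDimensional ℝ F] (P Q : Submodule ℝ F) :
    ∃ c > 0, ∀ A : Submodule ℝ F,
      (∀ ξ ∈ A, ‖ξ - P.starProjection ξ‖ ≤ c * ‖ξ‖ ∧ ‖ξ - Q.starProjection ξ‖ ≤ c * ‖ξ‖) →
      Module.finrank ℝ A ≤ Module.finrank ℝ (P ⊓ Q : Submodule ℝ F) := by
  -- A vector with zero image lies in P ∩ Q and in its orthogonal complement, so this map is
  -- injective and hence bounded below.
  let f : (P ⊓ Q)ᗮ →ₗ[ℝ] F × F :=
    ((LinearMap.id - P.starProjection.toLinearMap).prod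
      (LinearMap.id - Q.starProjection.toLinearMap)) ∘ₗ (P ⊓ Q)ᗮ.subtype
  have hker : LinearMap.ker f = ⊥ := by
    refine (Submodule.eq_bot_iff _).2 fun x hx => ?_
    have h1 : (x : F) - P.starProjection x = 0 := congrArg Prod.fst (LinearMap.mem_ker.1 hx)
    have h2 : (x : F) - Q.starProjection x = 0 := congrArg Prod.snd (LinearMap.mem_ker.1 hx)
    have h3 : (x : F) ∈ P ⊓ Q := ⟨Submodule.starProjection_eq_self_iff.1 (sub_eq_zero.1 h1).symm,
      Submodule.starProjection_eq_self_iff.1 (sub_eq_zero.1 h2).symm⟩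
    exact Subtype.ext (inner_self_eq_zero.1 ((Submodule.mem_orthogonal _ _).1 x.2 x h3))
  obtain ⟨K, hK, hf⟩ := f.exists_antilipschitzWith hker
  -- Half of the lower bound of f. If A had larger dimension than P ∩ Q it would meet the orthogonal
  -- complement, and the vector found there would contradict that bound.
  refine ⟨(2 * (K : ℝ))⁻¹, by positivity, fun A hA => ?_⟩
  by_contra! hlt
  have hne : A ⊓ (P ⊓ Q)ᗮ ≠ ⊥ := fun h => by
    have h1 := Submodule.finrank_add_finrank_le_of_disjoint (disjoint_iff.2 h)
    have h2 := (P ⊓ Q).finrank_add_finrank_orthogonal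
    omega
  obtain ⟨ξ, ⟨hξA, hξ⟩, hξ0⟩ := Submodule.exists_mem_ne_zero_of_ne_bot hne
  have h1 := hf.le_mul_dist ⟨ξ, hξ⟩ 0
  rw [map_zero, dist_zero_right, dist_zero_right] at h1
  have h2 : ‖f ⟨ξ, hξ⟩‖ ≤ (2 * (K : ℝ))⁻¹ * ‖ξ‖ := max_le (hA ξ hξA).1 (hA ξ hξA).2
  have h3 : 0 < ‖ξ‖ := norm_pos_iff.2 hξ0
  have hK' : (0 : ℝ) < K := hK
  have h4 : ‖ξ‖ ≤ K * ((2 * (K : ℝ))⁻¹ * ‖ξ‖) := h1.trans (mul_le_mul_of_nonneg_left h2 hK'.le)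
  have h5 : (K : ℝ) * ((2 * (K : ℝ))⁻¹ * ‖ξ‖) = ‖ξ‖ / 2 := by field_simp
  linarith

theorem IsJacobiPlane.exists_forall_le {L : Submodule ℝ (PhaseSpace n)} (h : IsJacobiPlane X b t L)
    {ε : ℝ} (hε : 0 < ε) : ∃ Q : Submodule ℝ (Variations t), FiniteDimensional ℝ Q ∧
      ∀ V : Submodule ℝ (Variations t), FiniteDimensional ℝ V → Q ≤ V →
        ‖(lPlane X b t V).starProjection - L.starProjection‖ ≤ ε := by
  have : IsDirectedOrder (FinDimVariations t) := ⟨fun V W => by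
    have := V.2
    have := W.2
    exact ⟨⟨V.1 ⊔ W.1, inferInstance⟩, (le_sup_left : V.1 ≤ V.1 ⊔ W.1),
      (le_sup_right : W.1 ≤ V.1 ⊔ W.1)⟩⟩
  have : Nonempty (FinDimVariations t) := ⟨⟨⊥, inferInstance⟩⟩
  obtain ⟨Q, hQ⟩ := eventually_atTop.1 (Metric.tendsto_nhds.1 h ε hε)
  exact ⟨Q.1, Q.2, fun V hV hQV => by
    have := hQ ⟨V, hV⟩ hQV
    rw [dist_eq_norm] at this
    exact this.le⟩

theorem norm_sub_starProjection_le {F : Type*} [NormedAddCommGroup F]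
    [InnerProductSpace ℝ F] [FiniteDimensional ℝ F] {P Q : Submodule ℝ F} {ε : ℝ}
    (h : ‖P.starProjection - Q.starProjection‖ ≤ ε) {ξ : F} (hξ : ξ ∈ P) :
    ‖ξ - Q.starProjection ξ‖ ≤ ε * ‖ξ‖ := by
  have h1 := (P.starProjection - Q.starProjection).le_of_opNorm_le h ξ
  rwa [sub_apply, Submodule.starProjection_eq_self_iff.2 hξ] at h1

/-- The threshold c depends on the two limit planes only. Then ε, the time t and the space U are
fixed before the finite-dimensional spaces, so V₀ and V₁ can be taken large enough for the nets at τ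
and at t simultaneously. -/
theorem le_finrank_jacobiPlane_inf_add_two {δ₀ T : ℝ} (hτ : 0 ≤ τ) (hτT : τ < T)
    (hX : ∀ t < T, IntegrableOn X (Ioc 0 t)) (hb : ∀ t < T, IntegrableOn b (Ioc 0 t))
    (hY : ContDiff ℝ ∞ Y) (hβ : ContDiff ℝ ∞ β) (hβ0 : ∀ s, 0 < β s) (hk : 1 ≤ k)
    (ha : symplForm (Y 0) (deriv Y 0) ≠ 0) (hδ₀ : 0 < δ₀)
    (hXY : ∀ s ∈ Icc 0 δ₀, X (τ + s) = Y s)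
    (hbβ : ∀ s ∈ Ioc 0 δ₀, b (τ + s) = -(s ^ k * β s))
    {L : ℝ → Submodule ℝ (PhaseSpace n)} {Lplus : Submodule ℝ (PhaseSpace n)}
    (hLτ : IsJacobiPlane X b τ (L τ)) (hL : ∀ᶠ t in 𝓝[>] τ, IsJacobiPlane X b t (L t))
    (hLplus : PlaneTendsto L (𝓝[>] τ) Lplus) :
    n ≤ Module.finrank ℝ ↥(L τ ⊓ Lplus) + 2 := by
  obtain ⟨c, hc, hcA⟩ := exists_pos_finrank_le_finrank_inf (L τ) Lplus
  -- Six: ε for moving ξ to x, another ε for projecting the difference, and 2ε‖x‖ ≤ 4ε‖ξ‖ for the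
  -- distance of x from its projection.
  obtain ⟨ε, hε, hε1, hεc⟩ : ∃ ε : ℝ, 0 < ε ∧ ε ≤ 1 ∧ 6 * ε ≤ c :=
    ⟨min 1 (c / 6), by positivity, min_le_left _ _, by linarith [min_le_right 1 (c / 6)]⟩
  obtain ⟨t, hbridge, hLt, hLε, hτt'⟩ := ((eventually_exists_subspace_near_lPlane hτ hτT hX hb hY hβ
    hβ0 hk ha hδ₀ hXY hbβ hε).and (hL.and ((Metric.tendsto_nhds.1 hLplus ε hε).and
    self_mem_nhdsWithin))).exists
  have hτt : τ ≤ t := (mem_Ioi.1 hτt').le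
  rw [dist_eq_norm] at hLε
  obtain ⟨U, hUfd, hU0, hU⟩ := hbridge hτt
  obtain ⟨Q₀, hQ₀fd, hQ₀⟩ := hLτ.exists_forall_le hε
  obtain ⟨Q, hQfd, hQ⟩ := hLt.exists_forall_le hε
  -- D cuts a variation off to (τ, t]. Splitting each element of Q at τ shows that the concatenated
  -- space contains Q, although Q need not be spanned by variations supported on one side of τ.
  let D : Variations t →ₗ[ℝ] Variations t :=
    LinearMap.id - extendVariation hτt ∘ₗ restrictVariation hτt
  have hD : ∀ q, q = extendVariation hτt (restrictVariation hτt q) + D q := fun q =>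
    (add_sub_cancel _ _).symm
  have hD0 : ∀ q, D q =ᵐ[volume.restrict (Ioc 0 τ)] 0 := fun q => by
    filter_upwards [ae_restrict_of_ae_restrict_of_subset (Ioc_subset_Ioc_right hτt)
      (Lp.coeFn_sub q (extendVariation hτt (restrictVariation hτt q))),
      coeFn_extendVariation_left hτt (restrictVariation hτt q),
      coeFn_restrictVariation hτt q] with s h1 h2 h3
    refine h1.trans ?_
    rw [Pi.sub_apply, h2, h3, sub_self, Pi.zero_apply]
  set V₀ := Q₀ ⊔ Q.map (restrictVariation hτt) with hV₀
  set V₁ := Q.map D ⊔ U with hV₁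
  have hV₁0 : ∀ w ∈ V₁, w =ᵐ[volume.restrict (Ioc 0 τ)] 0 := fun w hw => by
    obtain ⟨_, ⟨q, -, rfl⟩, u, hu, rfl⟩ := Submodule.mem_sup.1 hw
    filter_upwards [hD0 q, hU0 u hu, ae_restrict_of_ae_restrict_of_subset
      (Ioc_subset_Ioc_right hτt) (Lp.coeFn_add (D q) u)] with s h1 h2 h3
    rw [h3, Pi.add_apply, h1, h2, Pi.zero_apply, add_zero]
  obtain ⟨A, hA, hdim, hAx⟩ := hU V₀ V₁ inferInstance inferInstance le_sup_right hV₁0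
  have hQV : Q ≤ V₀.map (extendVariation hτt) ⊔ V₁ := fun q hq => by
    rw [hD q]
    exact add_mem
      (Submodule.mem_sup_left ⟨_, Submodule.mem_sup_right ⟨q, hq, rfl⟩, rfl⟩)
      (Submodule.mem_sup_right (Submodule.mem_sup_left ⟨q, hq, rfl⟩))
  have h₀ := hQ₀ V₀ inferInstance le_sup_left
  have h₁ : ‖(lPlane X b t (V₀.map (extendVariation hτt) ⊔ V₁)).starProjection -
      Lplus.starProjection‖ ≤ 2 * ε := by
    have h := norm_sub_le_norm_sub_add_norm_sub
      (lPlane X b t (V₀.map (extendVariation hτt) ⊔ V₁)).starProjection (L t).starProjection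
      Lplus.starProjection
    linarith [hQ _ inferInstance hQV]
  refine hdim.trans (Nat.add_le_add_right (hcA A fun ξ hξ => ⟨?_, ?_⟩) 2)
  · exact (norm_sub_starProjection_le h₀ (hA hξ)).trans
      (mul_le_mul_of_nonneg_right (by linarith) (norm_nonneg _))
  · obtain ⟨x, hx, hxξ⟩ := hAx ξ hξ
    have h2 := norm_sub_starProjection_le h₁ hx
    have h3 : ‖Lplus.starProjection (x - ξ)‖ ≤ ‖x - ξ‖ := Lplus.norm_starProjection_apply_le _
    have h4 : ‖x‖ ≤ ‖x - ξ‖ + ‖ξ‖ := by simpa using norm_add_le (x - ξ) ξ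
    have h5 : ξ - Lplus.starProjection ξ =
        -(x - ξ) + (x - Lplus.starProjection x) + Lplus.starProjection (x - ξ) := by
      rw [map_sub]; abel
    have h6 : ‖ξ - Lplus.starProjection ξ‖ ≤
        ‖x - ξ‖ + ‖x - Lplus.starProjection x‖ + ‖Lplus.starProjection (x - ξ)‖ := by
      rw [h5, ← norm_neg (x - ξ)]
      exact norm_add₃_le
    have h7 := norm_nonneg ξ
    have h8 : ε * ‖ξ‖ ≤ ‖ξ‖ := mul_le_of_le_one_left h7 hε1
    have h9 : 2 * ε * ‖x‖ ≤ 2 * ε * (2 * ‖ξ‖) :=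
      mul_le_mul_of_nonneg_left (by linarith) (by positivity)
    have h10 : 6 * ε * ‖ξ‖ ≤ c * ‖ξ‖ := mul_le_mul_of_nonneg_right hεc h7
    linarith

end Limits

/-! ### The theorem -/

theorem mainTheorem5 (n : ℕ) (T : ℝ) (X : ℝ → PhaseSpace n) (b : ℝ → ℝ)
    (hX : PiecewiseAnalytic T X) (hb : PiecewiseAnalytic T b)
    (τ : ℝ) (hτ : 0 ≤ τ) (hτT : τ < T)
    (hbτ : b τ = 0) (hbneg : ∀ᶠ s in 𝓝[>] τ, b s < 0)
    (hσ : symplForm (X τ) (derivWithin X (Ici τ) τ) ≠ 0)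
    (hdim : ∃ ε > 0, ∃ d : ℕ, ∀ s ∈ Icc τ (τ + ε),
      Module.finrank ℝ (Submodule.span ℝ
        {iteratedDerivWithin 2 X (Ici τ) s, derivWithin X (Ici τ) s, X s}) = d) :
    JacobiEquationSplits X b τ ∧
    ∀ (L : ℝ → Submodule ℝ (PhaseSpace n)) (Lplus : Submodule ℝ (PhaseSpace n)),
      IsJacobiPlane X b τ (L τ) →
      (∀ᶠ t in 𝓝[>] τ, IsJacobiPlane X b t (L t)) →
      PlaneTendsto L (𝓝[>] τ) Lplus →
      n ≤ Module.finrank ℝ ↥(L τ ⊓ Lplus) + 2 := by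
  obtain ⟨Y, β, k, δ₀, hY, hβ, hβ0, hk, ha, hδ₀, hXY, hbβ⟩ :=
    exists_smooth_normal_form hX hb hτ hτT hbτ hbneg hσ
  exact ⟨jacobiEquationSplits_of_smooth hY hβ hβ0 hk ha hδ₀ hXY hbβ, fun L Lplus hLτ hL hLplus =>
    le_finrank_jacobiPlane_inf_add_two hτ hτT (fun t ht => hX.integrableOn ht)
      (fun t ht => hb.integrableOn ht) hY hβ hβ0 hk ha hδ₀ hXY hbβ hLτ hL hLplus⟩
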